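/- **Setting.** Everything is $C^\infty$; $k\ge 1$. Let $\pi\colon E\to\mathbb R$ be a smooth fibre bundle, $\dim E=n+1$, with $t$ the coordinate of $\mathbb R$; $\Gamma(\cdot)$ denotes smooth sections. Let $J^m\pi$ be the manifold of $m$-jets of sections of $\pi$, with projections $\pi^m_r\colon J^m\pi\to J^r\pi$, $\pi^m\colon J^m\pi\to E$, $\bar\pi^m\colon J^m\pi\to\mathbb R$ and natural coordinates $(t,q_0^A,\dots,q_m^A)$, $1\le A\le n$, induced by coordinates $(t,q_0^A)$ of $E$ adapted to $\pi$. A section $\sigma$ of $\bar\pi^m$ is *holonomic* if $\sigma=j^m\phi$ with $\phi=\pi^m\circ\sigma\in\Gamma(\pi)$. Let $L\in C^\infty(J^k\pi)$ (so $\mathcal L=L\,dt$ is a $k$-th order Lagrangian density). *Unified formalism.* Put $J^{k-1}\pi^*=T^*(J^{k-1}\pi)/(\bar\pi^{k-1})^*T^*\mathbb R$ and $\mathcal W_r=J^{2k-1}\pi\times_{J^{k-1}\pi}J^{k-1}\pi^*$, with projections $\rho_1^r\colon\mathcal W_r\to J^{2k-1}\pi$ and $\rho^r_{\mathbb R}\colon\mathcal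 W_r\to\mathbb R$. For $w=(y,p)\in\mathcal W_r$ let $\alpha_w\in T^*(J^{k-1}\pi)$ be the unique covector in the class $p$ such that $\langle\alpha_w,(j^{k-1}\varphi)'(t)\rangle=L(\pi^{2k-1}_k(y))$, where $\varphi$ is a section representing the jet $y$ at $t=\bar\pi^{2k-1}(y)$. Let $\Theta_r$ be the pull-back of the canonical $1$-form of $T^*(J^{k-1}\pi)$ by $w\mapsto\alpha_w$; in coordinates $\Theta_r=p^i_A\,dq^A_i+(L-p^i_Aq^A_{i+1})\,dt$. *Lagrangian formalism.* Let $\mathcal{FL}\colon J^{2k-1}\pi\to J^{k-1}\pi^*$ be the Legendre–Ostrogradsky map, over $J^{k-1}\pi$, given in natural coordinates by $$p_A^{r-1}=\sum_{i=0}^{k-r}(-1)^i d_T^i\Big(\frac{\partial L}{\partial q^A_{r+i}}\Big),\qquad 1\le r\le k,\qquad d_T=\frac{\partial}{\partial t}+q^A_{j+1}\frac{\partial}{\partial q^A_j},$$ and let $\Theta_{\mathcal L}$ be the pull-back of $\Theta_r$ by $y\mapsto(y,\mathcal{FL}(y))$. *Variational problems.* Let $V\subseteq\mathbb R$ be open (for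 instance $V=\mathbb R$, or a bounded interval) and consider $$\mathbf{LH}_V(\psi)=\int_V\psi^*\Theta_r\quad(\psi\in\Gamma(\rho^r_{\mathbb R})),\qquad \mathbf L_V(\phi)=\int_V(j^{2k-1}\phi)^*\Theta_{\mathcal L}\quad(\phi\in\Gamma(\pi)).$$ A section $\psi$ (resp. $\phi$) is *critical* if the integral converges absolutely at it and, for every compactly supported $\rho^r_{\mathbb R}$-vertical vector field $Z$ on $\mathcal W_r$ (resp. $\pi$-vertical $Z$ on $E$) with support over $V$ and every local one-parameter group $\{\sigma_s\}$ of $Z$, the derivative at $s=0$ of $\mathbf{LH}_V(\sigma_s\circ\psi)$ (resp. $\mathbf L_V(\sigma_s\circ\phi)$) exists and is $0$. A *solution of the Lagrangian–Hamiltonian variational problem* is a critical $\psi\in\Gamma(\rho^r_{\mathbb R})$ that is holonomic, i.e. $\rho^r_1\circ\psi$ is holonomic; a *solution of the Lagrangian variational problem* is a critical $\phi\in\Gamma(\pi)$. **Theorem.** (1) Let $\psi$ be a solution of the Lagrangian–Hamiltonian variational problem. Then $\psi_{\mathcal L}=\rho^r_1\circ\psi\in\Gamma(\bar\pi^{2k-1})$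 is holonomic, and $\phi=\pi^{2k-1}\circ\psi_{\mathcal L}\in\Gamma(\pi)$ is a solution of the Lagrangian variational problem. In any natural coordinates, $\phi$ satisfies over $V$ the $k$-th order Euler–Lagrange equations $$\sum_{i=0}^k(-1)^i\frac{d^i}{dt^i}\Big(\frac{\partial L}{\partial q^A_i}\circ j^k\phi\Big)=0,\qquad 1\le A\le n.$$ (2) Conversely, if $\phi\in\Gamma(\pi)$ is a solution of the Lagrangian variational problem and $\psi_{\mathcal L}=j^{2k-1}\phi$, then $\psi=(\psi_{\mathcal L},\mathcal{FL}\circ\psi_{\mathcal L})$ is a solution of the Lagrangian–Hamiltonian variational problem. -/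

import Mathlib

open Set Filter Topology MeasureTheory
open scoped Manifold ContDiff

noncomputable section

namespace HOMech

universe u

/-- The model fibre `ℝⁿ`. -/
abbrev Fib (n : ℕ) : Type := EuclideanSpace ℝ (Fin n)

/-- A smooth fibre bundle `π : E → ℝ` with `dim E = n + 1`: a map to `ℝ` that is smoothly locally
trivial, with an `n`-dimensional typical fibre `F`. -/
structure FibreBundle (n : ℕ) (E : Type u) [TopologicalSpace E]
    [ChartedSpace (ℝ × Fib n) E] where
  toFun : E → ℝ
  locTriv : ∃ (F : Type u) (_ : TopologicalSpace F) (_ : ChartedSpace (Fib n) F)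
    (_ : IsManifold 𝓘(ℝ, Fib n) ∞ F), ∀ t : ℝ, ∃ (U : Set ℝ) (Φ : OpenPartialHomeomorph E (ℝ × F)),
      IsOpen U ∧ t ∈ U ∧ Φ.source = toFun ⁻¹' U ∧ Φ.target = U ×ˢ (univ : Set F) ∧
      (∀ x ∈ Φ.source, (Φ x).1 = toFun x) ∧
      ContMDiffOn 𝓘(ℝ, ℝ × Fib n) (𝓘(ℝ, ℝ).prod 𝓘(ℝ, Fib n)) ∞ Φ Φ.source ∧
      ContMDiffOn (𝓘(ℝ, ℝ).prod 𝓘(ℝ, Fib n)) 𝓘(ℝ, ℝ × Fib n) ∞ Φ.symm Φ.target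

section Calculus
variable {X Y : Type*} [NormedAddCommGroup X] [NormedSpace ℝ X]
  [NormedAddCommGroup Y] [NormedSpace ℝ Y]

theorem contDiffAt_deriv_of {f : ℝ → X} {t : ℝ} (hf : ContDiffAt ℝ ∞ f t) :
    ContDiffAt ℝ ∞ (deriv f) t := by
  have h : ContDiffAt ℝ ∞ (fun s => fderiv ℝ f s 1) t :=
    (hf.fderiv_right (m := ∞) (by simp)).clm_apply contDiffAt_const
  exact h

theorem iteratedDeriv_clm (A : X →L[ℝ] Y) {f : ℝ → X} {t : ℝ} (i : ℕ) (hf : ContDiffAt ℝ i f t) :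
    iteratedDeriv i (fun s => A (f s)) t = A (iteratedDeriv i f t) := by
  have := A.iteratedFDeriv_comp_left hf (i := i) le_rfl
  simp only [iteratedDeriv, Function.comp_def] at this ⊢
  rw [this]; rfl

/-- The derivatives of `Φ ∘ f` at `t` up to order `i` depend on `f` only through its derivatives
at `t` up to order `i`. -/
theorem iteratedDeriv_comp_eq (i : ℕ) : ∀ {X : Type} [NormedAddCommGroup X] [NormedSpace ℝ X]
    {f g : ℝ → X} {t : ℝ} {Φ : X → Y}, (∀ᶠ x in 𝓝 (f t), ContDiffAt ℝ ∞ Φ x) →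
    (∀ᶠ s in 𝓝 t, ContDiffAt ℝ ∞ f s) → (∀ᶠ s in 𝓝 t, ContDiffAt ℝ ∞ g s) →
    (∀ j ≤ i, iteratedDeriv j f t = iteratedDeriv j g t) →
    iteratedDeriv i (fun s => Φ (f s)) t = iteratedDeriv i (fun s => Φ (g s)) t := by
  induction i with
  | zero =>
    intro X _ _ f g t Φ _ _ _ h
    have := h 0 le_rfl
    simp only [iteratedDeriv_zero] at this ⊢
    rw [this]
  | succ i ih =>
    intro X _ _ f g t Φ hΦ hf hg h
    have h0 : f t = g t := by simpa using h 0 (Nat.zero_le _)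
    have key : ∀ {f : ℝ → X}, (∀ᶠ x in 𝓝 (f t), ContDiffAt ℝ ∞ Φ x) →
        (∀ᶠ s in 𝓝 t, ContDiffAt ℝ ∞ f s) →
        deriv (fun s => Φ (f s)) =ᶠ[𝓝 t] fun s => fderiv ℝ Φ (f s) (deriv f s) := by
      intro f hΦ hf
      have hc : ContinuousAt f t := hf.self_of_nhds.continuousAt
      filter_upwards [hc.eventually hΦ, hf] with s h1 h2
      exact fderiv_comp_deriv s (h1.differentiableAt (by simp)) (h2.differentiableAt (by simp))
    have pair : ∀ {f : ℝ → X}, (∀ᶠ s in 𝓝 t, ContDiffAt ℝ ∞ f s) → ∀ j,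
        iteratedDeriv j (fun s => (f s, deriv f s)) t
          = (iteratedDeriv j f t, iteratedDeriv (j + 1) f t) := by
      intro f hf j
      have hs : ContDiffAt ℝ j (fun s => (f s, deriv f s)) t :=
        (hf.self_of_nhds.prodMk (contDiffAt_deriv_of hf.self_of_nhds)).of_le
          (by exact_mod_cast le_top)
      ext1
      · exact (iteratedDeriv_clm (ContinuousLinearMap.fst ℝ X X) j hs).symm
      · rw [iteratedDeriv_succ']
        exact (iteratedDeriv_clm (ContinuousLinearMap.snd ℝ X X) j hs).symm
    rw [iteratedDeriv_succ', iteratedDeriv_succ', (key hΦ hf).iteratedDeriv_eq,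
      (key (h0 ▸ hΦ) hg).iteratedDeriv_eq]
    refine ih (X := X × X) (f := fun s => (f s, deriv f s)) (g := fun s => (g s, deriv g s))
      (Φ := fun p => fderiv ℝ Φ p.1 p.2) ?_ ?_ ?_ ?_
    · have : Tendsto (Prod.fst : X × X → X) (𝓝 (f t, deriv f t)) (𝓝 (f t)) :=
        continuous_fst.tendsto _
      filter_upwards [this.eventually hΦ] with p hp
      exact ((hp.fderiv_right (m := ∞) (by simp)).comp p contDiffAt_fst).clm_apply contDiffAt_snd
    · filter_upwards [hf] with s hs using hs.prodMk (contDiffAt_deriv_of hs)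
    · filter_upwards [hg] with s hs using hs.prodMk (contDiffAt_deriv_of hs)
    · intro j hj
      rw [pair hf, pair hg, h j (by omega), h (j + 1) (by omega)]

/-- Iterated derivatives in a real parameter of a smooth function are smooth. -/
theorem contDiffOn_iteratedDeriv_param {U : Set (X × ℝ)} (hU : IsOpen U) {G : X × ℝ → Y}
    (hG : ContDiffOn ℝ ∞ G U) (i : ℕ) :
    ContDiffOn ℝ ∞ (fun p : X × ℝ => iteratedDeriv i (fun r => G (p.1, r)) p.2) U := by
  induction i with
  | zero => simpa using hG
  | succ i ih =>
    have h1 : ContDiffOn ℝ ∞ (fun p : X × ℝ => fderiv ℝ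
        (fun p : X × ℝ => iteratedDeriv i (fun r => G (p.1, r)) p.2) p (0, 1)) U :=
      (ih.fderiv_of_isOpen hU (by simp)).clm_apply contDiffOn_const
    refine h1.congr fun p hp => ?_
    have hd := ((ih.contDiffAt (hU.mem_nhds hp)).differentiableAt (by simp)).hasFDerivAt
    have hl : HasDerivAt (fun r : ℝ => (p.1, r)) ((0 : X), (1 : ℝ)) p.2 :=
      (hasDerivAt_const _ _).prodMk (hasDerivAt_id _)
    rw [iteratedDeriv_succ]
    exact (HasFDerivAt.comp_hasDerivAt (x := p.2) (f := fun r : ℝ => (p.1, r)) hd hl).deriv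

/-- Taylor polynomial at `t` with prescribed derivatives. -/
noncomputable def taylorPoly {m : ℕ} (t : ℝ) (q : Fin (m + 1) → Y) (s : ℝ) : Y :=
  ∑ j : Fin (m + 1), ((s - t) ^ (j : ℕ) / ((j : ℕ).factorial : ℝ)) • q j

theorem contDiff_taylorPoly {m : ℕ} :
    ContDiff ℝ ∞ (fun p : (ℝ × (Fin (m + 1) → Y)) × ℝ => taylorPoly p.1.1 p.1.2 p.2) := by
  unfold taylorPoly
  refine ContDiff.sum fun j _ => ContDiff.smul ?_ ?_
  · exact ((contDiff_snd.sub (contDiff_fst.comp contDiff_fst)).pow _).div_const _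
  · exact (contDiff_apply ℝ Y j).comp (contDiff_snd.comp contDiff_fst)

theorem iteratedDeriv_taylorPoly {m : ℕ} (t : ℝ) (q : Fin (m + 1) → Y) (i : Fin (m + 1)) :
    iteratedDeriv i (taylorPoly t q) t = q i := by
  have hs : ∀ (j : ℕ), ContDiffAt ℝ (i : ℕ) (fun s : ℝ => (s - t) ^ j / (j.factorial : ℝ)) t :=
    fun j => by fun_prop
  have : taylorPoly t q = fun s => ∑ j : Fin (m + 1),
      ((s - t) ^ (j : ℕ) / ((j : ℕ).factorial : ℝ)) • q j := rfl
  rw [this, iteratedDeriv_fun_sum (f := fun (j : Fin (m + 1)) (s : ℝ) =>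
    ((s - t) ^ (j : ℕ) / ((j : ℕ).factorial : ℝ)) • q j)
    fun j _ => (hs j).smul contDiffAt_const]
  rw [Finset.sum_eq_single i]
  · rw [iteratedDeriv_smul_const (hs i), iteratedDeriv_div_const,
      iteratedDeriv_comp_sub_const (f := fun x : ℝ => x ^ (i : ℕ))]
    simp [Nat.descFactorial_self, Nat.factorial_ne_zero]
  · intro j _ hj
    rw [iteratedDeriv_smul_const (hs j), iteratedDeriv_div_const,
      iteratedDeriv_comp_sub_const (f := fun x : ℝ => x ^ (j : ℕ))]
    have h1 : (i : ℕ) ≠ j := fun h => hj (Fin.ext h.symm)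
    simp only [sub_self]
    rw [iteratedDeriv_fun_pow_zero, if_neg h1]
    simp
  · simp
theorem taylorPoly_self {m : ℕ} (t : ℝ) (q : Fin (m + 1) → Y) : taylorPoly t q t = q 0 := by
  simpa using iteratedDeriv_taylorPoly t q 0

theorem contDiff_graph_taylorPoly {m : ℕ} (t : ℝ) (q : Fin (m + 1) → Y) :
    ContDiff ℝ ∞ (fun s : ℝ => (s, taylorPoly t q s)) := by
  refine contDiff_id.prodMk ?_
  exact contDiff_taylorPoly.comp (g := fun p : (ℝ × (Fin (m + 1) → Y)) × ℝ =>
    taylorPoly p.1.1 p.1.2 p.2) (f := fun s : ℝ => ((t, q), s)) (contDiff_const.prodMk contDiff_id)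

theorem eventually_taylorPoly_mem {E : Type*} [TopologicalSpace E]
    (e : OpenPartialHomeomorph E (ℝ × Y)) {m : ℕ} (z : ℝ × (Fin (m + 1) → Y)) (hz : (z.1, z.2 0) ∈ e.target) :
    ∀ᶠ s in 𝓝 z.1, (s, taylorPoly z.1 z.2 s) ∈ e.target := by
  have h0 : (z.1, taylorPoly z.1 z.2 z.1) ∈ e.target := by rwa [taylorPoly_self]
  exact (contDiff_graph_taylorPoly z.1 z.2).continuous.continuousAt.eventually
    (e.open_target.mem_nhds h0)

end Calculus

section Jets

variable {n : ℕ} {E : Type u} [TopologicalSpace E] [ChartedSpace (ℝ × Fib n) E]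
  (π : FibreBundle n E)

/-- Local coordinates `(t, q₀)` on `E` adapted to the bundle. -/
structure IsAdapted (e : OpenPartialHomeomorph E (ℝ × Fib n)) : Prop where
  contMDiffOn : ContMDiffOn 𝓘(ℝ, ℝ × Fib n) 𝓘(ℝ, ℝ × Fib n) ∞ e e.source
  contMDiffOn_symm : ContMDiffOn 𝓘(ℝ, ℝ × Fib n) 𝓘(ℝ, ℝ × Fib n) ∞ e.symm e.target
  fst_eq : ∀ x ∈ e.source, (e x).1 = π.toFun x

theorem exists_isAdapted (x : E) : ∃ e : OpenPartialHomeomorph E (ℝ × Fib n),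
    IsAdapted π e ∧ x ∈ e.source := by
  obtain ⟨F, _, _, _, h⟩ := π.locTriv
  obtain ⟨U, Φ, hU, htU, hs, ht, hfst, h1, h2⟩ := h (π.toFun x)
  have hx : x ∈ Φ.source := by rw [hs]; exact htU
  let c := chartAt (Fib n) (Φ x).2
  refine ⟨Φ.trans ((OpenPartialHomeomorph.refl ℝ).prod c), ⟨?_, ?_, ?_⟩, ?_⟩
  · intro y hy
    have hy1 : y ∈ Φ.source := by simp at hy; exact hy.1
    have hy2 : (Φ y).2 ∈ c.source := by simp at hy; exact hy.2
    refine ContMDiffAt.contMDiffWithinAt ?_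
    have hΦ := h1.contMDiffAt (Φ.open_source.mem_nhds hy1)
    have hc : ContMDiffAt 𝓘(ℝ, Fib n) 𝓘(ℝ, Fib n) ∞ c (Φ y).2 :=
      contMDiffAt_of_mem_maximalAtlas (IsManifold.chart_mem_maximalAtlas _) hy2
    have e1 : ContMDiffAt 𝓘(ℝ, ℝ × Fib n) 𝓘(ℝ, ℝ) ∞ (fun y => (Φ y).1) y :=
      contMDiffAt_fst.comp y hΦ
    have e2 : ContMDiffAt 𝓘(ℝ, ℝ × Fib n) 𝓘(ℝ, Fib n) ∞ (fun y => c (Φ y).2) y :=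
      hc.comp y (contMDiffAt_snd.comp y hΦ)
    exact e1.prodMk_space e2
  · intro z hz
    have hz2 : z.2 ∈ c.target := by simp at hz; exact hz.1
    have hz1 : (z.1, c.symm z.2) ∈ Φ.target := by simp at hz; exact hz.2
    refine ContMDiffAt.contMDiffWithinAt ?_
    have hΦ := h2.contMDiffAt (Φ.open_target.mem_nhds hz1)
    have hc : ContMDiffAt 𝓘(ℝ, Fib n) 𝓘(ℝ, Fib n) ∞ c.symm z.2 :=
      contMDiffAt_symm_of_mem_maximalAtlas (IsManifold.chart_mem_maximalAtlas _) hz2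
    have e1 : ContMDiffAt 𝓘(ℝ, ℝ × Fib n) 𝓘(ℝ, ℝ) ∞ (fun z : ℝ × Fib n => z.1) z :=
      contDiff_fst.contMDiff.contMDiffAt
    have e2 : ContMDiffAt 𝓘(ℝ, ℝ × Fib n) 𝓘(ℝ, Fib n) ∞ (fun z : ℝ × Fib n => c.symm z.2) z :=
      hc.comp z contDiff_snd.contMDiff.contMDiffAt
    exact ContMDiffAt.comp (g := Φ.symm) (f := fun z : ℝ × Fib n => (z.1, c.symm z.2)) z hΦ
      (e1.prodMk e2)
  · intro y hy
    have hy1 : y ∈ Φ.source := by simp at hy; exact hy.1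
    exact hfst y hy1
  · simp [hx, c]

/-- A local section of `π` near the instant `base`. -/
structure LocalSection where
  base : ℝ
  map : ℝ → E
  smooth : ∀ᶠ s in 𝓝 base, ContMDiffAt 𝓘(ℝ, ℝ) 𝓘(ℝ, ℝ × Fib n) ∞ map s
  isSection : ∀ᶠ s in 𝓝 base, π.toFun (map s) = s

variable {π}

/-- The base point, the value, and the derivatives up to order `m` (read in the preferred chart of
`E` at the value) of a local section. -/
def LocalSection.taylor (m : ℕ) (f : LocalSection π) : ℝ × E × (Fin (m + 1) → ℝ × Fib n) :=
  (f.base, f.map f.base, fun i =>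
    iteratedDeriv i (fun s => chartAt (ℝ × Fib n) (f.map f.base) (f.map s)) f.base)

variable (π)

/-- The set `J^m π` of `m`-jets of sections of `π`. -/
def Jet (m : ℕ) : Type u := Quotient (Setoid.ker (LocalSection.taylor (π := π) m))

variable {π}

/-- The `m`-jet of a local section. -/
def LocalSection.jet (m : ℕ) (f : LocalSection π) : Jet π m := Quotient.mk _ f

namespace Jet

/-- A representative of a jet. -/
def rep {m : ℕ} (y : Jet π m) : LocalSection π := Quotient.out y

theorem jet_rep {m : ℕ} (y : Jet π m) : y.rep.jet m = y := Quotient.out_eq y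

/-- The projection of `J^m π` onto `ℝ`. -/
def base {m : ℕ} (y : Jet π m) : ℝ := y.rep.base

/-- The projection of `J^m π` onto `E`. -/
def pt {m : ℕ} (y : Jet π m) : E := y.rep.map y.rep.base

/-- The projection `J^m π → J^r π` for `r ≤ m`. -/
def proj {m : ℕ} (r : ℕ) (_h : r ≤ m) (y : Jet π m) : Jet π r := y.rep.jet r

end Jet

/-- Natural coordinates `(t, q₀, …, q_m)`. -/
abbrev JetCoord (n m : ℕ) : Type := ℝ × (Fin (m + 1) → Fib n)

section

theorem LocalSection.jet_eq {m : ℕ} {f g : LocalSection π} :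
    f.jet m = g.jet m ↔ f.taylor m = g.taylor m := by
  exact Quotient.eq (r := Setoid.ker (LocalSection.taylor (π := π) m))

theorem Jet.pt_jet {m : ℕ} (f : LocalSection π) : (f.jet m).pt = f.map f.base := by
  have := LocalSection.jet_eq.1 (Jet.jet_rep (f.jet m))
  exact congrArg (fun z => z.2.1) this

theorem Jet.base_jet {m : ℕ} (f : LocalSection π) : (f.jet m).base = f.base := by
  have := LocalSection.jet_eq.1 (Jet.jet_rep (f.jet m))
  exact congrArg Prod.fst this

theorem proj_pt {m : ℕ} (r : ℕ) (h : r ≤ m) (y : Jet π m) : (y.proj r h).pt = y.pt :=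
  Jet.pt_jet y.rep

theorem LocalSection.smooth_chart (f : LocalSection π) {e : OpenPartialHomeomorph E (ℝ × Fib n)}
    (he : ContMDiffOn 𝓘(ℝ, ℝ × Fib n) 𝓘(ℝ, ℝ × Fib n) ∞ e e.source)
    (h : f.map f.base ∈ e.source) :
    (∀ᶠ s in 𝓝 f.base, ContDiffAt ℝ ∞ (fun s => e (f.map s)) s) ∧
      ∀ᶠ s in 𝓝 f.base, f.map s ∈ e.source := by
  have hc : ContinuousAt f.map f.base := f.smooth.self_of_nhds.continuousAt
  have h2 := hc.eventually (e.open_source.mem_nhds h)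
  refine ⟨?_, h2⟩
  filter_upwards [f.smooth, h2] with s hs h2s
  exact ((he.contMDiffAt (e.open_source.mem_nhds h2s)).comp s hs).contDiffAt

theorem comp_symm_smooth {e e' : OpenPartialHomeomorph E (ℝ × Fib n)}
    (he : ContMDiffOn 𝓘(ℝ, ℝ × Fib n) 𝓘(ℝ, ℝ × Fib n) ∞ e.symm e.target)
    (he' : ContMDiffOn 𝓘(ℝ, ℝ × Fib n) 𝓘(ℝ, ℝ × Fib n) ∞ e' e'.source) {x : E}
    (h : x ∈ e.source) (h' : x ∈ e'.source) :
    ∀ᶠ z in 𝓝 (e x), ContDiffAt ℝ ∞ (fun z => e' (e.symm z)) z := by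
  have h1 : ContinuousAt e.symm (e x) := e.continuousAt_symm (e.map_source h)
  have h2 : e'.source ∈ 𝓝 (e.symm (e x)) := by
    rw [e.left_inv h]; exact e'.open_source.mem_nhds h'
  filter_upwards [h1.eventually h2, e.open_target.mem_nhds (e.map_source h)] with z hz hzt
  exact ((he'.contMDiffAt (e'.open_source.mem_nhds hz)).comp z
    (he.contMDiffAt (e.open_target.mem_nhds hzt))).contDiffAt

theorem LocalSection.transfer {f g : LocalSection π} (m : ℕ)
    (hb : f.base = g.base) (hp : f.map f.base = g.map g.base)
    {e e' : OpenPartialHomeomorph E (ℝ × Fib n)}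
    (he1 : ContMDiffOn 𝓘(ℝ, ℝ × Fib n) 𝓘(ℝ, ℝ × Fib n) ∞ e e.source)
    (he : ContMDiffOn 𝓘(ℝ, ℝ × Fib n) 𝓘(ℝ, ℝ × Fib n) ∞ e.symm e.target)
    (he' : ContMDiffOn 𝓘(ℝ, ℝ × Fib n) 𝓘(ℝ, ℝ × Fib n) ∞ e' e'.source)
    (hf : f.map f.base ∈ e.source) (hf' : f.map f.base ∈ e'.source)
    (h : ∀ i ≤ m, iteratedDeriv i (fun s => e (f.map s)) f.base
      = iteratedDeriv i (fun s => e (g.map s)) g.base) :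
    ∀ i ≤ m, iteratedDeriv i (fun s => e' (f.map s)) f.base
      = iteratedDeriv i (fun s => e' (g.map s)) g.base := by
  intro i hi
  have key : ∀ f : LocalSection π, f.map f.base ∈ e.source →
      iteratedDeriv i (fun s => e' (f.map s)) f.base
        = iteratedDeriv i (fun s => (fun z => e' (e.symm z)) (e (f.map s))) f.base := by
    intro f hf
    apply Filter.EventuallyEq.iteratedDeriv_eq
    filter_upwards [(f.smooth_chart he1 hf).2] with s hs
    simp only [e.left_inv hs]
  rw [key f hf, key g (hp ▸ hf), ← hb]
  refine iteratedDeriv_comp_eq i (comp_symm_smooth he he' hf hf')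
    (f.smooth_chart he1 hf).1 (hb ▸ (g.smooth_chart he1 (hp ▸ hf)).1) fun j hj => ?_
  rw [h j (hj.trans hi), hb]

variable [IsManifold 𝓘(ℝ, ℝ × Fib n) ∞ E]

theorem LocalSection.jet_eq_iff {f g : LocalSection π} {m : ℕ}
    {e : OpenPartialHomeomorph E (ℝ × Fib n)} (he : IsAdapted π e)
    (hf : f.map f.base ∈ e.source) (hg : g.map g.base ∈ e.source) :
    f.jet m = g.jet m ↔ f.base = g.base ∧ ∀ i ≤ m,
      iteratedDeriv i (fun s => (e (f.map s)).2) f.base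
        = iteratedDeriv i (fun s => (e (g.map s)).2) g.base := by
  have hc : ∀ x : E, ContMDiffOn 𝓘(ℝ, ℝ × Fib n) 𝓘(ℝ, ℝ × Fib n) ∞ (chartAt (ℝ × Fib n) x)
      (chartAt (ℝ × Fib n) x).source := fun x => contMDiffOn_chart
  have hc' : ∀ x : E, ContMDiffOn 𝓘(ℝ, ℝ × Fib n) 𝓘(ℝ, ℝ × Fib n) ∞ (chartAt (ℝ × Fib n) x).symm
      (chartAt (ℝ × Fib n) x).target := fun x => contMDiffOn_chart_symm
  have snd : ∀ f : LocalSection π, f.map f.base ∈ e.source → ∀ i : ℕ,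
      iteratedDeriv i (fun s => (e (f.map s)).2) f.base
        = (iteratedDeriv i (fun s => e (f.map s)) f.base).2 := fun f hf i =>
    iteratedDeriv_clm (ContinuousLinearMap.snd ℝ ℝ (Fib n)) i
      ((f.smooth_chart he.contMDiffOn hf).1.self_of_nhds.of_le (by exact_mod_cast le_top))
  have fst : ∀ f : LocalSection π, f.map f.base ∈ e.source → ∀ i : ℕ,
      (iteratedDeriv i (fun s => e (f.map s)) f.base).1 = iteratedDeriv i (fun s => s) f.base := by
    intro f hf i
    have h1 := iteratedDeriv_clm (ContinuousLinearMap.fst ℝ ℝ (Fib n)) i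
      ((f.smooth_chart he.contMDiffOn hf).1.self_of_nhds.of_le
        (by exact_mod_cast le_top : ((i : ℕ) : WithTop ℕ∞) ≤ ∞))
    refine Eq.trans h1.symm (Filter.EventuallyEq.iteratedDeriv_eq _ ?_)
    filter_upwards [(f.smooth_chart he.contMDiffOn hf).2, f.isSection] with s hs h2
    exact (he.fst_eq _ hs).trans h2
  rw [LocalSection.jet_eq]
  constructor
  · intro h
    have hb : f.base = g.base := congrArg Prod.fst h
    have hp : f.map f.base = g.map g.base := congrArg (fun z => z.2.1) h
    refine ⟨hb, fun i hi => ?_⟩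
    have hd : ∀ i ≤ m, iteratedDeriv i (fun s => chartAt (ℝ × Fib n) (f.map f.base) (f.map s)) f.base
        = iteratedDeriv i (fun s => chartAt (ℝ × Fib n) (f.map f.base) (g.map s)) g.base := by
      intro i hi
      have := congrFun (congrArg (fun z => z.2.2) h) ⟨i, Nat.lt_succ_of_le hi⟩
      simp only [LocalSection.taylor] at this
      rw [this, hp]
    have := LocalSection.transfer m hb hp (hc _) (hc' _) he.contMDiffOn (mem_chart_source _ _) hf hd
      i hi
    rw [snd f hf, snd g hg, this]
  · rintro ⟨hb, h⟩
    have hE : ∀ i ≤ m, iteratedDeriv i (fun s => e (f.map s)) f.base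
        = iteratedDeriv i (fun s => e (g.map s)) g.base := by
      intro i hi
      ext1
      · rw [fst f hf, fst g hg, hb]
      · rw [← snd f hf, ← snd g hg, h i hi]
    have hp : f.map f.base = g.map g.base := by
      have := hE 0 (Nat.zero_le _)
      simp only [iteratedDeriv_zero] at this
      exact e.injOn hf hg this
    have := LocalSection.transfer m hb hp he.contMDiffOn he.contMDiffOn_symm (hc _) hf
      (mem_chart_source (ℝ × Fib n) (f.map f.base)) hE
    simp only [LocalSection.taylor]
    refine Prod.ext hb (Prod.ext hp ?_)
    funext i
    have h3 := this i (Nat.lt_succ_iff.1 i.2)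
    simp only [h3]
    rw [hp]

end

/-- The natural coordinates `(t, q₀, …, q_m)` on `J^m π` induced by coordinates `e` on `E`. -/
def jetCoord (e : OpenPartialHomeomorph E (ℝ × Fib n)) (m : ℕ) (y : Jet π m) : JetCoord n m :=
  (y.base, fun i => iteratedDeriv i (fun s => (e (y.rep.map s)).2) y.rep.base)

/-- The local section with prescribed natural coordinates, polynomial in the coordinates `e`. -/
def polySection {e : OpenPartialHomeomorph E (ℝ × Fib n)} (he : IsAdapted π e) {m : ℕ}
    (z : JetCoord n m) (hz : (z.1, z.2 0) ∈ e.target) : LocalSection π where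
  base := z.1
  map := fun s => e.symm (s, taylorPoly z.1 z.2 s)
  smooth := by
    filter_upwards [eventually_taylorPoly_mem e z hz] with s hs
    exact ContMDiffAt.comp (g := e.symm) (f := fun s : ℝ => (s, taylorPoly z.1 z.2 s)) s
      (he.contMDiffOn_symm.contMDiffAt (e.open_target.mem_nhds hs))
      (contDiff_graph_taylorPoly z.1 z.2).contMDiff.contMDiffAt
  isSection := by
    filter_upwards [eventually_taylorPoly_mem e z hz] with s hs
    rw [← he.fst_eq _ (e.map_target hs), e.right_inv hs]

section JetCharts

theorem polySection_pt {e : OpenPartialHomeomorph E (ℝ × Fib n)} (he : IsAdapted π e) {m : ℕ}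
    (z : JetCoord n m) (hz : (z.1, z.2 0) ∈ e.target) :
    (polySection he z hz).map (polySection he z hz).base = e.symm (z.1, z.2 0) := by
  simp only [polySection, taylorPoly_self]

theorem polySection_deriv {e : OpenPartialHomeomorph E (ℝ × Fib n)} (he : IsAdapted π e) {m : ℕ}
    (z : JetCoord n m) (hz : (z.1, z.2 0) ∈ e.target) (i : Fin (m + 1)) :
    iteratedDeriv i (fun s => (e ((polySection he z hz).map s)).2) (polySection he z hz).base
      = z.2 i := by
  rw [← iteratedDeriv_taylorPoly z.1 z.2 i]
  apply Filter.EventuallyEq.iteratedDeriv_eq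
  filter_upwards [eventually_taylorPoly_mem e z hz] with s hs
  simp only [polySection]
  rw [e.right_inv hs]

theorem jetCoord_fst {e : OpenPartialHomeomorph E (ℝ × Fib n)} (he : IsAdapted π e) {m : ℕ}
    (y : Jet π m) (hy : y.pt ∈ e.source) :
    ((jetCoord e m y).1, (jetCoord e m y).2 0) = e y.pt := by
  have h1 : (jetCoord e m y).2 0 = (e y.pt).2 := by simp [jetCoord, Jet.pt]
  have h2 : (jetCoord e m y).1 = (e y.pt).1 := by
    rw [he.fst_eq _ hy]; exact y.rep.isSection.self_of_nhds.symm
  rw [h1, h2]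

/-- Adapted coordinates around a given point of `E`. -/
def chartE (π : FibreBundle n E) (x : E) : OpenPartialHomeomorph E (ℝ × Fib n) :=
  (exists_isAdapted π x).choose

theorem chartE_adapted (x : E) : IsAdapted π (chartE π x) := (exists_isAdapted π x).choose_spec.1

theorem mem_chartE_source (x : E) : x ∈ (chartE π x).source := (exists_isAdapted π x).choose_spec.2

variable [IsManifold 𝓘(ℝ, ℝ × Fib n) ∞ E]

theorem jetCoord_jet {e : OpenPartialHomeomorph E (ℝ × Fib n)} (he : IsAdapted π e) (m : ℕ)
    (f : LocalSection π) (hf : f.map f.base ∈ e.source) :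
    jetCoord e m (f.jet m)
      = (f.base, fun i : Fin (m + 1) => iteratedDeriv i (fun s => (e (f.map s)).2) f.base) := by
  have hp : (f.jet m).rep.map (f.jet m).rep.base = f.map f.base := Jet.pt_jet f
  have := (LocalSection.jet_eq_iff he (hp ▸ hf) hf).1 (Jet.jet_rep (f.jet m))
  refine Prod.ext this.1 ?_
  funext i
  exact this.2 i (Nat.lt_succ_iff.1 i.2)

open Classical in
/-- The natural chart of `J^m π` induced by adapted coordinates `e`; the jet `y₀` is a value of the
inverse outside of its domain. -/
def jetChart {e : OpenPartialHomeomorph E (ℝ × Fib n)} (he : IsAdapted π e) {m : ℕ}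
    (y₀ : Jet π m) : PartialEquiv (Jet π m) (JetCoord n m) where
  toFun := jetCoord e m
  invFun z := if hz : (z.1, z.2 0) ∈ e.target then (polySection he z hz).jet m else y₀
  source := {y | y.pt ∈ e.source}
  target := {z | (z.1, z.2 0) ∈ e.target}
  map_source' := by
    intro y hy
    show ((jetCoord e m y).1, (jetCoord e m y).2 0) ∈ e.target
    rw [jetCoord_fst he y hy]
    exact e.map_source hy
  map_target' := by
    intro z hz
    have hz' : (z.1, z.2 0) ∈ e.target := hz
    show Jet.pt _ ∈ e.source
    rw [dif_pos hz', Jet.pt_jet, polySection_pt]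
    exact e.map_target hz'
  left_inv' := by
    intro y hy
    have h3 : ((jetCoord e m y).1, (jetCoord e m y).2 0) ∈ e.target := by
      rw [jetCoord_fst he y hy]; exact e.map_source hy
    rw [dif_pos h3]
    conv_rhs => rw [← Jet.jet_rep y]
    refine (LocalSection.jet_eq_iff he ?_ hy).2 ⟨rfl, fun i hi => ?_⟩
    · rw [polySection_pt]; exact e.map_target h3
    · exact polySection_deriv he _ h3 ⟨i, Nat.lt_succ_of_le hi⟩
  right_inv' := by
    intro z hz
    have hz' : (z.1, z.2 0) ∈ e.target := hz
    simp only [hz', dif_pos]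
    rw [jetCoord_jet he]
    · exact Prod.ext rfl (funext fun i => polySection_deriv he z hz' i)
    · rw [polySection_pt]; exact e.map_target hz'

theorem jetChart_symm_trans_source {e e' : OpenPartialHomeomorph E (ℝ × Fib n)}
    (he : IsAdapted π e) (he' : IsAdapted π e') {m : ℕ} (y₀ y₀' : Jet π m) :
    ((jetChart he y₀).symm.trans (jetChart he' y₀')).source
      = {z | (z.1, z.2 0) ∈ e.target ∩ e.symm ⁻¹' e'.source} := by
  ext z
  rw [PartialEquiv.trans_source]
  by_cases hz : (z.1, z.2 0) ∈ e.target
  · simp [jetChart, hz, Jet.pt_jet, polySection_pt]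
  · simp [jetChart, hz]

theorem isOpen_jetChart_symm_trans_source {e e' : OpenPartialHomeomorph E (ℝ × Fib n)}
    (he : IsAdapted π e) (he' : IsAdapted π e') {m : ℕ} (y₀ y₀' : Jet π m) :
    IsOpen ((jetChart he y₀).symm.trans (jetChart he' y₀')).source := by
  rw [jetChart_symm_trans_source]
  have h : IsOpen (e.target ∩ e.symm ⁻¹' e'.source) :=
    e.symm.isOpen_inter_preimage e'.open_source
  exact h.preimage (by fun_prop : Continuous fun z : JetCoord n m => (z.1, z.2 0))

theorem contDiffOn_jetChart_symm_trans {e e' : OpenPartialHomeomorph E (ℝ × Fib n)}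
    (he : IsAdapted π e) (he' : IsAdapted π e') {m : ℕ} (y₀ y₀' : Jet π m) :
    ContDiffOn ℝ ∞ ((jetChart he y₀).symm.trans (jetChart he' y₀'))
      ((jetChart he y₀).symm.trans (jetChart he' y₀')).source := by
  set W : Set (ℝ × Fib n) := e.target ∩ e.symm ⁻¹' e'.source with hW
  have hWo : IsOpen W := e.symm.isOpen_inter_preimage e'.open_source
  let T : JetCoord n m × ℝ → ℝ × Fib n := fun p => (p.2, taylorPoly p.1.1 p.1.2 p.2)
  have hT : ContDiff ℝ ∞ T := contDiff_snd.prodMk contDiff_taylorPoly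
  let G : JetCoord n m × ℝ → Fib n := fun p => (e' (e.symm (T p))).2
  have hG : ContDiffOn ℝ ∞ G (T ⁻¹' W) := by
    intro p hp
    have h1 := (he.contMDiffOn_symm.contMDiffAt (e.open_target.mem_nhds hp.1))
    have h2 := (he'.contMDiffOn.contMDiffAt (e'.open_source.mem_nhds hp.2))
    have h3 : ContDiffAt ℝ ∞ (fun z => e' (e.symm z)) (T p) := (h2.comp (T p) h1).contDiffAt
    have h4 : ContDiffAt ℝ ∞ (fun p => e' (e.symm (T p))) p :=
      ContDiffAt.comp (g := fun z => e' (e.symm z)) (f := T) p h3 hT.contDiffAt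
    exact h4.snd.contDiffWithinAt
  rw [jetChart_symm_trans_source]
  have hmem : ∀ z : JetCoord n m, (z.1, z.2 0) ∈ W → (z, z.1) ∈ T ⁻¹' W := by
    intro z hz
    show (z.1, taylorPoly z.1 z.2 z.1) ∈ W
    rwa [taylorPoly_self]
  have hD : ContDiffOn ℝ ∞ (fun z : JetCoord n m => ((z.1, fun i : Fin (m + 1) =>
      iteratedDeriv i (fun r => G (z, r)) z.1) : JetCoord n m)) {z | (z.1, z.2 0) ∈ W} := by
    refine contDiffOn_fst.prodMk (contDiffOn_pi.2 fun i => ?_)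
    have h5 : ContDiff ℝ ∞ (fun z : JetCoord n m => (z, z.1)) := contDiff_id.prodMk contDiff_fst
    exact ContDiffOn.comp (g := fun p : JetCoord n m × ℝ =>
      iteratedDeriv i (fun r => G (p.1, r)) p.2) (f := fun z : JetCoord n m => (z, z.1))
      (contDiffOn_iteratedDeriv_param (hWo.preimage hT.continuous) hG i) h5.contDiffOn hmem
  refine hD.congr fun z hz => ?_
  have hz1 : (z.1, z.2 0) ∈ e.target := hz.1
  have hz2 : e.symm (z.1, z.2 0) ∈ e'.source := hz.2
  simp only [PartialEquiv.coe_trans, Function.comp_apply, jetChart, PartialEquiv.symm, hz1, dif_pos]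
  rw [jetCoord_jet he']
  · rfl
  · rwa [polySection_pt]

/-- The atlas of natural charts of `J^m π`. -/
def jetCore (π : FibreBundle n E) (m : ℕ) : ChartedSpaceCore (JetCoord n m) (Jet π m) where
  atlas := {c | ∃ (e : OpenPartialHomeomorph E (ℝ × Fib n)) (he : IsAdapted π e) (y₀ : Jet π m),
    c = jetChart he y₀}
  chartAt y := jetChart (chartE_adapted y.pt) y
  mem_chart_source y := mem_chartE_source y.pt
  chart_mem_atlas y := ⟨_, _, _, rfl⟩
  open_source := by
    rintro _ _ ⟨e, he, y, rfl⟩ ⟨e', he', y', rfl⟩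
    exact isOpen_jetChart_symm_trans_source he he' y y'
  continuousOn_toFun := by
    rintro _ _ ⟨e, he, y, rfl⟩ ⟨e', he', y', rfl⟩
    exact (contDiffOn_jetChart_symm_trans he he' y y').continuousOn

instance (m : ℕ) : TopologicalSpace (Jet π m) := (jetCore π m).toTopologicalSpace

instance (m : ℕ) : ChartedSpace (JetCoord n m) (Jet π m) := (jetCore π m).toChartedSpace

instance (m : ℕ) : IsManifold 𝓘(ℝ, JetCoord n m) ∞ (Jet π m) := by
  apply isManifold_of_contDiffOn
  intro c c' hc hc'
  obtain ⟨_, ⟨b, rfl⟩, _, ⟨⟨e, he, y, rfl⟩, rfl⟩, h⟩ := hc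
  obtain ⟨_, ⟨b', rfl⟩, _, ⟨⟨e', he', y', rfl⟩, rfl⟩, h'⟩ := hc'
  rw [mem_singleton_iff] at h h'
  subst h h'
  have := contDiffOn_jetChart_symm_trans he he' y y'
  simp only [modelWithCornersSelf_coe, modelWithCornersSelf_coe_symm, Function.comp_id,
    Function.id_comp, range_id, inter_univ, preimage_id]
  exact this

end JetCharts

/-! ### The restricted jet-momentum bundle -/

section Momenta

variable [IsManifold 𝓘(ℝ, ℝ × Fib n) ∞ E]

/-- The form `dt` on `J^m π` at `y`: the pull-back of the volume form of `ℝ`. -/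
def Jet.dt {m : ℕ} (y : Jet π m) : TangentSpace 𝓘(ℝ, JetCoord n m) y →L[ℝ] ℝ :=
  mfderiv 𝓘(ℝ, JetCoord n m) 𝓘(ℝ, ℝ) Jet.base y

/-- The fibre at `y` of `(J^m π)* = T*(J^m π) / (T*ℝ pulled back)`. -/
abbrev RedCot {m : ℕ} (y : Jet π m) : Type :=
  (TangentSpace 𝓘(ℝ, JetCoord n m) y →L[ℝ] ℝ) ⧸
    Submodule.span ℝ {(Jet.dt y : TangentSpace 𝓘(ℝ, JetCoord n m) y →L[ℝ] ℝ)}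

/-- The class of a covector. -/
def RedCot.mk {m : ℕ} {y : Jet π m} (α : TangentSpace 𝓘(ℝ, JetCoord n m) y →L[ℝ] ℝ) : RedCot y :=
  Submodule.Quotient.mk α

/-- A covector in a given class. -/
def RedCot.rep {m : ℕ} {y : Jet π m} (p : RedCot y) :
    TangentSpace 𝓘(ℝ, JetCoord n m) y →L[ℝ] ℝ :=
  Quotient.out p

theorem RedCot.mk_rep {m : ℕ} {y : Jet π m} (p : RedCot y) : RedCot.mk p.rep = p :=
  Quotient.out_eq p

theorem RedCot.mk_eq {m : ℕ} {y : Jet π m}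
    {α β : TangentSpace 𝓘(ℝ, JetCoord n m) y →L[ℝ] ℝ} :
    RedCot.mk α = RedCot.mk β ↔ ∃ c : ℝ, α - β = c • Jet.dt y := by
  unfold RedCot.mk
  rw [Submodule.Quotient.eq, Submodule.mem_span_singleton]
  exact ⟨fun ⟨c, h⟩ => ⟨c, h.symm⟩, fun ⟨c, h⟩ => ⟨c, h.symm⟩⟩

/-- The differential at `y` of the natural coordinates. -/
def jetCoordDeriv (e : OpenPartialHomeomorph E (ℝ × Fib n)) {m : ℕ} (y : Jet π m) :
    TangentSpace 𝓘(ℝ, JetCoord n m) y →L[ℝ] JetCoord n m :=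
  mfderiv 𝓘(ℝ, JetCoord n m) 𝓘(ℝ, JetCoord n m) (jetCoord e m) y

/-- The momenta `p_A^i = ⟨p, ∂/∂q_i^A⟩`, as a linear functional on `(q_i^A)`. -/
def momCoord (e : OpenPartialHomeomorph E (ℝ × Fib n)) {m : ℕ} {y : Jet π m} (p : RedCot y) :
    (Fin (m + 1) → Fib n) →L[ℝ] ℝ :=
  p.rep ∘L (jetCoordDeriv e y).inverse ∘L ContinuousLinearMap.inr ℝ ℝ (Fin (m + 1) → Fib n)

/-- The class of `p_A^i dq_i^A`. -/
def momOf (e : OpenPartialHomeomorph E (ℝ × Fib n)) {m : ℕ} (y : Jet π m)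
    (β : (Fin (m + 1) → Fib n) →L[ℝ] ℝ) : RedCot y :=
  RedCot.mk (β ∘L ContinuousLinearMap.snd ℝ ℝ (Fin (m + 1) → Fib n) ∘L jetCoordDeriv e y)

/-- Natural charts of `J^m π`, as homeomorphisms. -/
def jetHomeo {e : OpenPartialHomeomorph E (ℝ × Fib n)} (he : IsAdapted π e) {m : ℕ} (y₀ : Jet π m) :
    OpenPartialHomeomorph (Jet π m) (JetCoord n m) :=
  (jetCore π m).openPartialHomeomorph (jetChart he y₀) ⟨e, he, y₀, rfl⟩

theorem jetHomeo_mem_atlas {e : OpenPartialHomeomorph E (ℝ × Fib n)} (he : IsAdapted π e) {m : ℕ}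
    (y₀ : Jet π m) : jetHomeo he y₀ ∈ atlas (JetCoord n m) (Jet π m) :=
  mem_iUnion.2 ⟨jetChart he y₀, mem_iUnion.2 ⟨⟨e, he, y₀, rfl⟩, rfl⟩⟩

theorem jetHomeo_mdifferentiable {e : OpenPartialHomeomorph E (ℝ × Fib n)} (he : IsAdapted π e)
    {m : ℕ} (y₀ : Jet π m) :
    (jetHomeo he y₀).MDifferentiable 𝓘(ℝ, JetCoord n m) 𝓘(ℝ, JetCoord n m) :=
  mdifferentiable_of_mem_atlas (jetHomeo_mem_atlas he y₀)

theorem jetCoordDeriv_isInvertible {e : OpenPartialHomeomorph E (ℝ × Fib n)} (he : IsAdapted π e)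
    {m : ℕ} (y : Jet π m) (hy : y.pt ∈ e.source) : (jetCoordDeriv e y).IsInvertible :=
  ⟨(jetHomeo_mdifferentiable he y).mfderiv (x := y) hy, rfl⟩

theorem mdifferentiableAt_jetCoord {e : OpenPartialHomeomorph E (ℝ × Fib n)} (he : IsAdapted π e)
    {m : ℕ} (y : Jet π m) (hy : y.pt ∈ e.source) :
    MDifferentiableAt 𝓘(ℝ, JetCoord n m) 𝓘(ℝ, JetCoord n m) (jetCoord e m) y :=
  (jetHomeo_mdifferentiable he y).mdifferentiableAt (x := y) hy

theorem dt_eq {e : OpenPartialHomeomorph E (ℝ × Fib n)} (he : IsAdapted π e)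
    {m : ℕ} (y : Jet π m) (hy : y.pt ∈ e.source) :
    Jet.dt y = ContinuousLinearMap.fst ℝ ℝ (Fin (m + 1) → Fib n) ∘L jetCoordDeriv e y := by
  have h1 := (mdifferentiableAt_jetCoord he y hy).hasMFDerivAt
  have h2 : HasMFDerivAt 𝓘(ℝ, JetCoord n m) 𝓘(ℝ, ℝ) (Prod.fst : JetCoord n m → ℝ)
      (jetCoord e m y) (ContinuousLinearMap.fst ℝ ℝ (Fin (m + 1) → Fib n)) :=
    hasFDerivAt_fst.hasMFDerivAt
  exact (h2.comp y h1).mfderiv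

theorem momCoord_mk {e : OpenPartialHomeomorph E (ℝ × Fib n)} (he : IsAdapted π e)
    {m : ℕ} (y : Jet π m) (hy : y.pt ∈ e.source)
    (α : TangentSpace 𝓘(ℝ, JetCoord n m) y →L[ℝ] ℝ) :
    momCoord e (RedCot.mk α) = α ∘L (jetCoordDeriv e y).inverse ∘L
      ContinuousLinearMap.inr ℝ ℝ (Fin (m + 1) → Fib n) := by
  obtain ⟨c, hc⟩ := RedCot.mk_eq.1 (RedCot.mk_rep (RedCot.mk α))
  have hI := jetCoordDeriv_isInvertible he y hy
  ext q
  have h1 : (RedCot.mk α).rep = α + c • Jet.dt y := by rw [← hc]; abel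
  simp only [momCoord, h1, dt_eq he y hy]
  have h2 : jetCoordDeriv e y ((jetCoordDeriv e y).inverse ((0 : ℝ), q)) = ((0 : ℝ), q) :=
    hI.self_apply_inverse _
  simp [h2]

theorem momCoord_momOf {e : OpenPartialHomeomorph E (ℝ × Fib n)} (he : IsAdapted π e)
    {m : ℕ} (y : Jet π m) (hy : y.pt ∈ e.source) (β : (Fin (m + 1) → Fib n) →L[ℝ] ℝ) :
    momCoord e (momOf e y β) = β := by
  rw [momOf, momCoord_mk he y hy]
  have hI := jetCoordDeriv_isInvertible he y hy
  ext q
  have h2 : jetCoordDeriv e y ((jetCoordDeriv e y).inverse ((0 : ℝ), q)) = ((0 : ℝ), q) :=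
    hI.self_apply_inverse _
  simp [h2]

theorem momOf_momCoord {e : OpenPartialHomeomorph E (ℝ × Fib n)} (he : IsAdapted π e)
    {m : ℕ} (y : Jet π m) (hy : y.pt ∈ e.source) (p : RedCot y) :
    momOf e y (momCoord e p) = p := by
  conv_rhs => rw [← RedCot.mk_rep p]
  refine RedCot.mk_eq.2 ⟨-(p.rep ((jetCoordDeriv e y).inverse (1, 0))), ?_⟩
  have hI := jetCoordDeriv_isInvertible he y hy
  ext v
  have h1 : v = (jetCoordDeriv e y).inverse (jetCoordDeriv e y v) := (hI.inverse_apply_self v).symm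
  have h2 : jetCoordDeriv e y v = (jetCoordDeriv e y v).1 • ((1 : ℝ), (0 : Fin (m + 1) → Fib n))
      + ((0 : ℝ), (jetCoordDeriv e y v).2) := by
    ext1 <;> simp
  have h3 : p.rep v = (jetCoordDeriv e y v).1 * p.rep ((jetCoordDeriv e y).inverse (1, 0))
      + p.rep ((jetCoordDeriv e y).inverse (0, (jetCoordDeriv e y v).2)) := by
    conv_lhs => rw [h1, h2, map_add, map_add, map_smul, map_smul]
    rfl
  have h4 : Jet.dt y v = (jetCoordDeriv e y v).1 := by rw [dt_eq he y hy]; rfl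
  show p.rep ((jetCoordDeriv e y).inverse (0, (jetCoordDeriv e y v).2)) - p.rep v
    = -(p.rep ((jetCoordDeriv e y).inverse (1, 0))) * Jet.dt y v
  rw [h3, h4]
  ring

/-- Restriction of natural coordinates from `J^m π` to `J^r π`. -/
def truncCoord {m : ℕ} (r : ℕ) (h : r ≤ m) (z : JetCoord n m) : JetCoord n r :=
  (z.1, fun i => z.2 (Fin.castLE (Nat.succ_le_succ h) i))

theorem jetCoord_proj {e : OpenPartialHomeomorph E (ℝ × Fib n)} (he : IsAdapted π e) {m : ℕ}
    (r : ℕ) (h : r ≤ m) (y : Jet π m) (hy : y.pt ∈ e.source) :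
    jetCoord e r (y.proj r h) = truncCoord r h (jetCoord e m y) := by
  unfold Jet.proj
  rw [jetCoord_jet he r y.rep hy]
  rfl

theorem fderiv_jetChart_symm_trans {e e' : OpenPartialHomeomorph E (ℝ × Fib n)}
    (he : IsAdapted π e) (he' : IsAdapted π e') {m : ℕ} (y₀ y₀' y : Jet π m)
    (hy : y.pt ∈ e.source) (hy' : y.pt ∈ e'.source) :
    fderiv ℝ ((jetChart he' y₀').symm.trans (jetChart he y₀)) (jetCoord e' m y)
      = (jetCoordDeriv e y ∘L (jetCoordDeriv e' y).inverse : JetCoord n m →L[ℝ] JetCoord n m) := by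
  set τ := (jetChart he' y₀').symm.trans (jetChart he y₀) with hτ
  have hl : (jetChart he' y₀').symm (jetCoord e' m y) = y := (jetChart he' y₀').left_inv hy'
  have hmem : jetCoord e' m y ∈ τ.source := by
    rw [hτ, PartialEquiv.trans_source]
    refine ⟨(jetChart he' y₀').map_source hy', ?_⟩
    show (jetChart he' y₀').symm (jetCoord e' m y) ∈ (jetChart he y₀).source
    rw [hl]; exact hy
  have hd : HasFDerivAt τ (fderiv ℝ τ (jetCoord e' m y)) (jetCoord e' m y) :=
    (((contDiffOn_jetChart_symm_trans he' he y₀' y₀).contDiffAt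
      ((isOpen_jetChart_symm_trans_source he' he y₀' y₀).mem_nhds hmem)).differentiableAt
      (by simp)).hasFDerivAt
  have h1 := hd.hasMFDerivAt.comp y (mdifferentiableAt_jetCoord he' y hy').hasMFDerivAt
  have hev : jetCoord e m =ᶠ[𝓝 y] τ ∘ jetCoord e' m := by
    have ho : (jetHomeo he' y₀').source ∈ 𝓝 y := (jetHomeo he' y₀').open_source.mem_nhds hy'
    filter_upwards [ho] with y1 h1
    show jetCoord e m y1 = jetCoord e m ((jetChart he' y₀').symm (jetCoord e' m y1))
    have : (jetChart he' y₀').symm (jetCoord e' m y1) = y1 := (jetChart he' y₀').left_inv h1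
    rw [this]
  have h2 : jetCoordDeriv e y
      = (fderiv ℝ τ (jetCoord e' m y) ∘L jetCoordDeriv e' y) :=
    (h1.congr_of_eventuallyEq hev).mfderiv
  have hI := jetCoordDeriv_isInvertible he' y hy'
  refine ContinuousLinearMap.ext fun v => ?_
  have h3 := congrArg (fun A => A ((jetCoordDeriv e' y).inverse v)) h2
  have h4 : jetCoordDeriv e' y ((jetCoordDeriv e' y).inverse v) = v := hI.self_apply_inverse v
  have h5 : jetCoordDeriv e y ((jetCoordDeriv e' y).inverse v)
      = fderiv ℝ τ (jetCoord e' m y) (jetCoordDeriv e' y ((jetCoordDeriv e' y).inverse v)) := h3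
  rw [h4] at h5
  exact h5.symm

end Momenta

section PhaseSpace

variable [IsManifold 𝓘(ℝ, ℝ × Fib n) ∞ E]

variable (π) in
/-- The restricted jet-momentum bundle `W_r = J^{2k-1}π ×_{J^{k-1}π} (J^{k-1}π)*`. -/
@[ext] structure Phase (k : ℕ) : Type u where
  jet : Jet π (2 * k - 1)
  mom : RedCot (jet.proj (k - 1) (by omega))

/-- Natural coordinates `((t, q₀, …, q_{2k-1}), (p⁰, …, p^{k-1}))`. -/
abbrev PhaseCoord (n k : ℕ) : Type :=
  JetCoord n (2 * k - 1) × ((Fin (k - 1 + 1) → Fib n) →L[ℝ] ℝ)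

namespace Phase

/-- The projection of `W_r` onto `ℝ`. -/
def base {k : ℕ} (w : Phase π k) : ℝ := w.jet.base

/-- The projection of `W_r` onto `J^{k-1}π`. -/
def toJet {k : ℕ} (w : Phase π k) : Jet π (k - 1) := w.jet.proj (k - 1) (by omega)

/-- The point over `y` with given momenta. -/
def ofMom (e : OpenPartialHomeomorph E (ℝ × Fib n)) {k : ℕ} (y : Jet π (2 * k - 1))
    (β : (Fin (k - 1 + 1) → Fib n) →L[ℝ] ℝ) : Phase π k :=
  ⟨y, momOf e _ β⟩

end Phase

/-- The natural chart of `W_r` induced by adapted coordinates `e` on `E`. -/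
def phaseChart {e : OpenPartialHomeomorph E (ℝ × Fib n)} (he : IsAdapted π e) {k : ℕ}
    (w₀ : Phase π k) : PartialEquiv (Phase π k) (PhaseCoord n k) where
  toFun w := (jetCoord e _ w.jet, momCoord e w.mom)
  invFun c := Phase.ofMom e ((jetChart he w₀.jet).symm c.1) c.2
  source := {w | w.jet.pt ∈ e.source}
  target := {c | (c.1.1, c.1.2 0) ∈ e.target}
  map_source' w hw := (jetChart he w₀.jet).map_source hw
  map_target' c hc := (jetChart he w₀.jet).map_target hc
  left_inv' w hw := by
    have h : (jetChart he w₀.jet).symm (jetCoord e _ w.jet) = w.jet :=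
      (jetChart he w₀.jet).left_inv hw
    show Phase.ofMom e ((jetChart he w₀.jet).symm (jetCoord e _ w.jet)) (momCoord e w.mom) = w
    rw [h]
    cases w with
    | mk y p =>
      have : momOf e _ (momCoord e p) = p := momOf_momCoord he _ (by rw [proj_pt]; exact hw) p
      simp only [Phase.ofMom, this]
  right_inv' c hc := by
    refine Prod.ext ((jetChart he w₀.jet).right_inv hc) ?_
    refine momCoord_momOf he _ ?_ c.2
    rw [proj_pt]
    exact (jetChart he w₀.jet).map_target hc

theorem phaseChart_symm_trans_source {e e' : OpenPartialHomeomorph E (ℝ × Fib n)}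
    (he : IsAdapted π e) (he' : IsAdapted π e') {k : ℕ} (w₀ w₀' : Phase π k) :
    ((phaseChart he w₀).symm.trans (phaseChart he' w₀')).source
      = {c | c.1 ∈ ((jetChart he w₀.jet).symm.trans (jetChart he' w₀'.jet)).source} := rfl

theorem isOpen_phaseChart_symm_trans_source {e e' : OpenPartialHomeomorph E (ℝ × Fib n)}
    (he : IsAdapted π e) (he' : IsAdapted π e') {k : ℕ} (w₀ w₀' : Phase π k) :
    IsOpen ((phaseChart he w₀).symm.trans (phaseChart he' w₀')).source := by
  rw [phaseChart_symm_trans_source]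
  exact (isOpen_jetChart_symm_trans_source he he' _ _).preimage continuous_fst

theorem contDiffOn_phaseChart_symm_trans {e e' : OpenPartialHomeomorph E (ℝ × Fib n)}
    (he : IsAdapted π e) (he' : IsAdapted π e') {k : ℕ} (w₀ w₀' : Phase π k) :
    ContDiffOn ℝ ∞ ((phaseChart he w₀).symm.trans (phaseChart he' w₀'))
      ((phaseChart he w₀).symm.trans (phaseChart he' w₀')).source := by
  set T := (jetChart he w₀.jet).symm.trans (jetChart he' w₀'.jet) with hT
  set τ := (jetChart he' w₀.toJet).symm.trans (jetChart he w₀.toJet) with hτ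
  have hfst : ContDiffOn ℝ ∞ (fun c : PhaseCoord n k => T c.1) {c | c.1 ∈ T.source} :=
    (contDiffOn_jetChart_symm_trans he he' w₀.jet w₀'.jet).comp contDiffOn_fst (fun c hc => hc)
  have htr : ContDiff ℝ ∞ (truncCoord (n := n) (k - 1) (by omega : k - 1 ≤ 2 * k - 1)) := by
    refine contDiff_fst.prodMk (contDiff_pi.2 fun i => ?_)
    exact (contDiff_apply ℝ (Fib n) _).comp contDiff_snd
  have hpt : ∀ c : PhaseCoord n k, c.1 ∈ T.source →
      ((jetChart he w₀.jet).symm c.1).pt ∈ e.source ∧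
      ((jetChart he w₀.jet).symm c.1).pt ∈ e'.source := by
    intro c hc
    rw [hT, PartialEquiv.trans_source] at hc
    exact ⟨(jetChart he w₀.jet).map_target hc.1, hc.2⟩
  have hco : ∀ c : PhaseCoord n k, c.1 ∈ T.source →
      truncCoord (k - 1) (by omega) (T c.1)
        = jetCoord e' (k - 1) (((jetChart he w₀.jet).symm c.1).proj (k - 1) (by omega)) := by
    intro c hc
    rw [jetCoord_proj he' _ _ _ (hpt c hc).2]
    rfl
  have hmem : ∀ c : PhaseCoord n k, c.1 ∈ T.source →
      truncCoord (k - 1) (by omega) (T c.1) ∈ τ.source := by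
    intro c hc
    have h1 := (proj_pt (k - 1) (by omega) ((jetChart he w₀.jet).symm c.1))
    have hs' : ((jetChart he w₀.jet).symm c.1).proj (k - 1) (by omega)
        ∈ (jetChart he' w₀.toJet).source := by
      show Jet.pt _ ∈ e'.source
      rw [h1]; exact (hpt c hc).2
    rw [hco c hc, hτ, PartialEquiv.trans_source]
    refine ⟨(jetChart he' w₀.toJet).map_source hs', ?_⟩
    show (jetChart he' w₀.toJet).symm (jetChart he' w₀.toJet _) ∈ (jetChart he w₀.toJet).source
    rw [(jetChart he' w₀.toJet).left_inv hs']
    show Jet.pt _ ∈ e.source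
    rw [h1]; exact (hpt c hc).1
  have hτ' : ContDiffOn ℝ ∞ (fderiv ℝ τ) τ.source :=
    (contDiffOn_jetChart_symm_trans he' he _ _).fderiv_of_isOpen
      (isOpen_jetChart_symm_trans_source he' he _ _) (by simp)
  have hA : ContDiffOn ℝ ∞ (fun c : PhaseCoord n k =>
      fderiv ℝ τ (truncCoord (k - 1) (by omega) (T c.1))) {c | c.1 ∈ T.source} :=
    hτ'.comp (htr.comp_contDiffOn hfst) hmem
  have hsnd : ContDiffOn ℝ ∞ (fun c : PhaseCoord n k => c.2 ∘L
      (ContinuousLinearMap.snd ℝ ℝ (Fin (k - 1 + 1) → Fib n) ∘L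
        (fderiv ℝ τ (truncCoord (k - 1) (by omega) (T c.1)) ∘L
          ContinuousLinearMap.inr ℝ ℝ (Fin (k - 1 + 1) → Fib n)))) {c | c.1 ∈ T.source} :=
    contDiffOn_snd.clm_comp (contDiffOn_const.clm_comp (hA.clm_comp contDiffOn_const))
  rw [phaseChart_symm_trans_source]
  refine (hfst.prodMk hsnd).congr fun c hc => Prod.ext rfl ?_
  have h1 := (proj_pt (k - 1) (by omega) ((jetChart he w₀.jet).symm c.1))
  show momCoord e' (momOf e (((jetChart he w₀.jet).symm c.1).proj (k - 1) _) c.2) = _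
  rw [momOf, momCoord_mk he' _ (by rw [h1]; exact (hpt c hc).2)]
  simp only [hco c hc]
  rw [hτ, fderiv_jetChart_symm_trans he he' _ _ _ (by rw [h1]; exact (hpt c hc).1)
    (by rw [h1]; exact (hpt c hc).2)]
  rfl

variable (π) in
/-- The atlas of natural charts of `W_r`. -/
def phaseCore (k : ℕ) : ChartedSpaceCore (PhaseCoord n k) (Phase π k) where
  atlas := {c | ∃ (e : OpenPartialHomeomorph E (ℝ × Fib n)) (he : IsAdapted π e) (w₀ : Phase π k),
    c = phaseChart he w₀}
  chartAt w := phaseChart (chartE_adapted w.jet.pt) w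
  mem_chart_source w := mem_chartE_source w.jet.pt
  chart_mem_atlas w := ⟨_, _, _, rfl⟩
  open_source := by
    rintro _ _ ⟨e, he, y, rfl⟩ ⟨e', he', y', rfl⟩
    exact isOpen_phaseChart_symm_trans_source he he' y y'
  continuousOn_toFun := by
    rintro _ _ ⟨e, he, y, rfl⟩ ⟨e', he', y', rfl⟩
    exact (contDiffOn_phaseChart_symm_trans he he' y y').continuousOn

instance (k : ℕ) : TopologicalSpace (Phase π k) := (phaseCore π k).toTopologicalSpace

instance (k : ℕ) : ChartedSpace (PhaseCoord n k) (Phase π k) := (phaseCore π k).toChartedSpace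

instance (k : ℕ) : IsManifold 𝓘(ℝ, PhaseCoord n k) ∞ (Phase π k) := by
  apply isManifold_of_contDiffOn
  intro c c' hc hc'
  obtain ⟨_, ⟨b, rfl⟩, _, ⟨⟨e, he, y, rfl⟩, rfl⟩, h⟩ := hc
  obtain ⟨_, ⟨b', rfl⟩, _, ⟨⟨e', he', y', rfl⟩, rfl⟩, h'⟩ := hc'
  rw [mem_singleton_iff] at h h'
  subst h h'
  have := contDiffOn_phaseChart_symm_trans he he' y y'
  simp only [modelWithCornersSelf_coe, modelWithCornersSelf_coe_symm, Function.comp_id,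
    Function.id_comp, range_id, inter_univ, preimage_id]
  exact this

end PhaseSpace

/-! ### Sections, holonomy -/

section Sections

variable (π) in
/-- Global sections of `π`. -/
structure Sec where
  toFun : ℝ → E
  smooth : ContMDiff 𝓘(ℝ, ℝ) 𝓘(ℝ, ℝ × Fib n) ∞ toFun
  isSection : ∀ t, π.toFun (toFun t) = t

/-- A global section near the instant `t`. -/
def Sec.germ (φ : Sec π) (t : ℝ) : LocalSection π where
  base := t
  map := φ.toFun
  smooth := Eventually.of_forall fun s => φ.smooth s
  isSection := Eventually.of_forall fun s => φ.isSection s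

/-- The lifting `j^m φ` of `φ` to `J^m π`. -/
def Sec.jet (m : ℕ) (φ : Sec π) (t : ℝ) : Jet π m := (φ.germ t).jet m

/-- A section of `J^m π → ℝ` is holonomic if it is `j^m φ`, where `φ` is its projection to `E`. -/
def IsHolonomic {m : ℕ} (σ : ℝ → Jet π m) : Prop :=
  ∃ φ : Sec π, (∀ t, φ.toFun t = (σ t).pt) ∧ ∀ t, φ.jet m t = σ t

open Classical in
/-- The lifting `s ↦ j^m f (s)` of a local section, near its base instant (the value at instants
around which `f` is not a smooth section is irrelevant). -/
def LocalSection.prolong (m : ℕ) (f : LocalSection π) (s : ℝ) : Jet π m :=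
  if h : (∀ᶠ r in 𝓝 s, ContMDiffAt 𝓘(ℝ, ℝ) 𝓘(ℝ, ℝ × Fib n) ∞ f.map r) ∧
      ∀ᶠ r in 𝓝 s, π.toFun (f.map r) = r
  then LocalSection.jet m ⟨s, f.map, h.1, h.2⟩ else f.jet m

end Sections

/-- Smooth sections of a map `ρ : M → ℝ`. -/
def IsSmoothSection {H M : Type*} [NormedAddCommGroup H] [NormedSpace ℝ H] [TopologicalSpace M]
    [ChartedSpace H M] (ρ : M → ℝ) (γ : ℝ → M) : Prop :=
  ContMDiff 𝓘(ℝ, ℝ) 𝓘(ℝ, H) ∞ γ ∧ ∀ t, ρ (γ t) = t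

/-! ### Variations -/

section Variations

variable {H M : Type*} [NormedAddCommGroup H] [NormedSpace ℝ H] [TopologicalSpace M]
  [ChartedSpace H M] [IsManifold 𝓘(ℝ, H) ∞ M]

/-- `Z` is a smooth, `ρ`-vertical, compactly supported vector field whose support lies over `V`. -/
structure IsVariationField (ρ : M → ℝ) (V : Set ℝ) (Z : ∀ x : M, TangentSpace 𝓘(ℝ, H) x) :
    Prop where
  smooth : ContMDiff 𝓘(ℝ, H) 𝓘(ℝ, H).tangent ∞ (fun x => (⟨x, Z x⟩ : TangentBundle 𝓘(ℝ, H) M))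
  vertical : ∀ x, mfderiv 𝓘(ℝ, H) 𝓘(ℝ, ℝ) ρ x (Z x) = 0
  compact : IsCompact (closure {x | Z x ≠ 0})
  support_subset : ρ '' closure {x | Z x ≠ 0} ⊆ V

/-- `σ` is a local one-parameter group of `Z`, for parameters in `(-ε, ε)`. -/
structure IsLocalFlow (Z : ∀ x : M, TangentSpace 𝓘(ℝ, H) x) (ε : ℝ) (σ : ℝ → M → M) : Prop where
  pos : 0 < ε
  smooth : ContMDiffOn (𝓘(ℝ, ℝ).prod 𝓘(ℝ, H)) 𝓘(ℝ, H) ∞ (fun p : ℝ × M => σ p.1 p.2)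
    (Ioo (-ε) ε ×ˢ univ)
  zero : ∀ x, σ 0 x = x
  integral : ∀ x, IsMIntegralCurveOn (fun s => σ s x) Z (Ioo (-ε) ε)

/-- The coefficient of `dt` in the pull-back of the `1`-form `θ` by the curve `γ`. -/
def pullCurve (θ : ∀ x : M, TangentSpace 𝓘(ℝ, H) x →L[ℝ] ℝ) (γ : ℝ → M) (t : ℝ) : ℝ :=
  θ (γ t) (mfderiv 𝓘(ℝ, ℝ) 𝓘(ℝ, H) γ t (1 : ℝ))

end Variations

/-! ### The unified formalism -/

section Unified

variable [IsManifold 𝓘(ℝ, ℝ × Fib n) ∞ E] {k : ℕ}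

variable (π k) in
/-- The extended jet-momentum bundle `W = J^{2k-1}π ×_{J^{k-1}π} T*(J^{k-1}π)`. -/
structure ExtPhase : Type u where
  jet : Jet π (2 * k - 1)
  cov : TangentSpace 𝓘(ℝ, JetCoord n (k - 1)) (jet.proj (k - 1) (by omega) : Jet π (k - 1)) →L[ℝ] ℝ

/-- The quotient map `W → W_r`. -/
def ExtPhase.toPhase (w : ExtPhase π k) : Phase π k := ⟨w.jet, RedCot.mk w.cov⟩

/-- The velocity at `y` of `j^r φ`, for a section `φ` representing `y`. -/
def Jet.velocity {m : ℕ} (r : ℕ) (h : r ≤ m) (y : Jet π m) :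
    TangentSpace 𝓘(ℝ, JetCoord n r) (y.proj r h) :=
  (mfderiv 𝓘(ℝ, ℝ) 𝓘(ℝ, JetCoord n r) (y.rep.prolong r) y.base (1 : ℝ) : JetCoord n r)

/-- The coupling function: the coupling form is `w ↦ ⟨α, T(j^{k-1}φ ∘ ρ)⟩ = coupling w • dt`. -/
def ExtPhase.coupling (w : ExtPhase π k) : ℝ := w.cov (w.jet.velocity (k - 1) (by omega))

theorem le_two_mul_sub_one (k : ℕ) [NeZero k] : k ≤ 2 * k - 1 := by
  have := NeZero.pos k
  omega

variable [NeZero k]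

/-- The Lagrangian function on `J^{2k-1}π`. -/
def lagrHat (L : Jet π k → ℝ) (y : Jet π (2 * k - 1)) : ℝ := L (y.proj k (le_two_mul_sub_one k))

/-- The Hamiltonian section of `W → W_r`: its value at `w` is the only point
over `w` (note that `dt` takes the value `1` on the velocity) at which the coupling function equals
the Lagrangian function. -/
def hamSection (L : Jet π k → ℝ) (w : Phase π k) : ExtPhase π k where
  jet := w.jet
  cov := w.mom.rep +
    (lagrHat L w.jet - (⟨w.jet, w.mom.rep⟩ : ExtPhase π k).coupling) • Jet.dt _

/-- The form `Θ_r` on `W_r`: the pull-back by the Hamiltonian section of the canonical `1`-form of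
`T*(J^{k-1}π)`, that is, `u ↦ ⟨α, Tρ(u)⟩` with `α` the covector of the Hamiltonian section and `ρ`
the projection onto `J^{k-1}π`. -/
def thetaR (L : Jet π k → ℝ) (w : Phase π k) :
    TangentSpace 𝓘(ℝ, PhaseCoord n k) w →L[ℝ] ℝ :=
  (hamSection L w).cov ∘L
    mfderiv 𝓘(ℝ, PhaseCoord n k) 𝓘(ℝ, JetCoord n (k - 1)) Phase.toJet w

/-- `ψ` is critical for `ψ ↦ ∫_V ψ*Θ_r` under the variations `σ_s ∘ ψ`, with `σ_s` the local
one-parameter groups of compactly supported vertical vector fields with support over `V`; the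
convergence of the integral at `ψ` is part of the condition. -/
def IsCriticalLH (L : Jet π k → ℝ) (V : Set ℝ) (ψ : ℝ → Phase π k) : Prop :=
  IntegrableOn (pullCurve (thetaR L) ψ) V ∧
  ∀ Z : ∀ w : Phase π k, TangentSpace 𝓘(ℝ, PhaseCoord n k) w,
    IsVariationField Phase.base V Z →
    ∀ (ε : ℝ) (σ : ℝ → Phase π k → Phase π k), IsLocalFlow Z ε σ →
      HasDerivAt (fun s => ∫ t in V, pullCurve (thetaR L) (fun r => σ s (ψ r)) t) 0 0

/-- Solutions of the Lagrangian-Hamiltonian variational problem over `V`: the critical holonomic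
sections of `W_r → ℝ`. -/
structure IsSolutionLH (L : Jet π k → ℝ) (V : Set ℝ) (ψ : ℝ → Phase π k) : Prop where
  isSection : IsSmoothSection (H := PhaseCoord n k) Phase.base ψ
  holonomic : IsHolonomic fun t => (ψ t).jet
  critical : IsCriticalLH L V ψ

end Unified

/-! ### The Legendre-Ostrogradsky map and the Lagrangian formalism -/

section Lagrangian

/-- The total derivative `d_T F = ∂F/∂t + q_{j+1} ∂F/∂q_j`. -/
def totalDeriv {G : Type*} [NormedAddCommGroup G] [NormedSpace ℝ G] {m : ℕ}
    (F : JetCoord n m → G) (z : JetCoord n (m + 1)) : G :=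
  fderiv ℝ F (truncCoord m (Nat.le_succ m) z) (1, fun j => z.2 j.succ)

/-- The iterated total derivative `d_T^i F`. -/
def iterTotalDeriv {G : Type*} [NormedAddCommGroup G] [NormedSpace ℝ G] {m : ℕ}
    (F : JetCoord n m → G) : (i : ℕ) → JetCoord n (m + i) → G
  | 0 => F
  | i + 1 => totalDeriv (iterTotalDeriv F i)

variable [IsManifold 𝓘(ℝ, ℝ × Fib n) ∞ E] {k : ℕ}

/-- `∂L/∂q_i` in natural coordinates, as a function with values in the dual of `ℝⁿ`. -/
def partialL {e : OpenPartialHomeomorph E (ℝ × Fib n)} (he : IsAdapted π e) (y₀ : Jet π k)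
    (L : Jet π k → ℝ) (i : Fin (k + 1)) (z : JetCoord n k) : Fib n →L[ℝ] ℝ :=
  fderiv ℝ (fun z => L ((jetChart he y₀).symm z)) z ∘L
    ContinuousLinearMap.inr ℝ ℝ (Fin (k + 1) → Fib n) ∘L
    ContinuousLinearMap.single ℝ (fun _ => Fib n) i

variable [NeZero k]

/-- The Legendre-Ostrogradsky momenta
`p^r = ∑_{i=0}^{k-1-r} (-1)^i d_T^i (∂L/∂q_{r+1+i})`, for `0 ≤ r ≤ k - 1`. -/
def legendreMom {e : OpenPartialHomeomorph E (ℝ × Fib n)} (he : IsAdapted π e) (y₀ : Jet π k)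
    (L : Jet π k → ℝ) (z : JetCoord n (2 * k - 1)) (r : Fin (k - 1 + 1)) : Fib n →L[ℝ] ℝ :=
  ∑ i : Fin (k - r), (-1 : ℝ) ^ (i : ℕ) •
    iterTotalDeriv (partialL he y₀ L ⟨r + 1 + i, by omega⟩) i (truncCoord (k + i) (by omega) z)

/-- The restricted Legendre-Ostrogradsky map `FL : J^{2k-1}π → (J^{k-1}π)*`, over `J^{k-1}π`; it is
given by the above momenta in natural coordinates around the point. -/
def legendre (L : Jet π k → ℝ) (y : Jet π (2 * k - 1)) :
    RedCot (y.proj (k - 1) (by omega)) :=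
  momOf (chartE π y.pt) _ (∑ r, legendreMom (chartE_adapted y.pt)
    (y.proj k (le_two_mul_sub_one k)) L (jetCoord (chartE π y.pt) _ y) r ∘L
      ContinuousLinearMap.proj r)

/-- The map `y ↦ (y, FL(y))` of `J^{2k-1}π` onto the graph `W_L ⊆ W_r`. -/
def legendreGraph (L : Jet π k → ℝ) (y : Jet π (2 * k - 1)) : Phase π k := ⟨y, legendre L y⟩

/-- The Poincaré-Cartan form `Θ_L`: the pull-back of `Θ_r` by `y ↦ (y, FL(y))`. -/
def thetaL (L : Jet π k → ℝ) (y : Jet π (2 * k - 1)) :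
    TangentSpace 𝓘(ℝ, JetCoord n (2 * k - 1)) y →L[ℝ] ℝ :=
  thetaR L (legendreGraph L y) ∘L
    mfderiv 𝓘(ℝ, JetCoord n (2 * k - 1)) 𝓘(ℝ, PhaseCoord n k) (legendreGraph L) y

/-- `φ` is critical for `φ ↦ ∫_V (j^{2k-1}φ)*Θ_L` under the variations `φ_s = σ_s ∘ φ`, with `σ_s`
the local one-parameter groups of compactly supported vertical vector fields on `E` with support
over `V`; the convergence of the integral at `φ` is part of the condition. -/
def IsCriticalL (L : Jet π k → ℝ) (V : Set ℝ) (φ : Sec π) : Prop :=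
  IntegrableOn (pullCurve (thetaL L) (φ.jet (2 * k - 1))) V ∧
  ∀ Z : ∀ x : E, TangentSpace 𝓘(ℝ, ℝ × Fib n) x, IsVariationField π.toFun V Z →
    ∀ (ε : ℝ) (σ : ℝ → E → E), IsLocalFlow Z ε σ →
    ∀ Φ : ℝ → Sec π, (∀ s ∈ Ioo (-ε) ε, ∀ t, (Φ s).toFun t = σ s (φ.toFun t)) →
      HasDerivAt (fun s => ∫ t in V, pullCurve (thetaL L) ((Φ s).jet (2 * k - 1)) t) 0 0

/-- The `k`-th order Euler-Lagrange equations over `V`, in all natural coordinates. -/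
def SatisfiesEulerLagrange (L : Jet π k → ℝ) (V : Set ℝ) (φ : Sec π) : Prop :=
  ∀ (e : OpenPartialHomeomorph E (ℝ × Fib n)) (he : IsAdapted π e), ∀ t ∈ V,
    φ.toFun t ∈ e.source → ∀ A : Fin n,
      ∑ i : Fin (k + 1), (-1 : ℝ) ^ (i : ℕ) * iteratedDeriv i (fun s =>
        partialL he (φ.jet k t) L i (jetCoord e k (φ.jet k s)) (EuclideanSpace.single A 1)) t = 0

end Lagrangian

end Jets

end HOMech

end

open HOMech

/-! Both variational problems are equivalent to the Euler–Lagrange equations of φ over V, and each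
half of the theorem passes through these equations.

Let ψ lie over j^{2k-1}φ and take a compactly supported variation of it (`PhaseVariation`). In
natural coordinates the integrand of the unified action is L + p^i (dq_i/dt − q_{i+1})
(`pullCurve_thetaR`). Holonomy of ψ makes the factor of p vanish at s = 0, so the variation of the
momenta does not contribute. Subtracting the total derivative of p^i δq_i leaves the residual ∑_j
(∂L/∂q_j − p^{j−1} − dp^j/dt) δq_j (`deriv_unifiedIntegrand_sub`, `elResidual`). The boundary term
p^i δq_i has a coordinate-free meaning, so it is a compactly supported function of t even when the
variation crosses several charts, and the derivative of the action is the integral of the residual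
(`PhaseVariation.hasDerivAt_action`).

If ψ is critical, the positions q_0, …, q_{2k−1} vary independently, so every component of the
residual vanishes over V. The components j = k, …, 1 force the p^i to be the Legendre–Ostrogradsky
momenta, and the component j = 0 is then the Euler–Lagrange equation
(`altSum_eq_zero_of_elResidual`). If φ is critical, its variations lift to the Legendre graph, where
the residual telescopes to the Euler–Lagrange covector applied to δq_0 (`elResidual_of_altSum`).
Conversely, under the Euler–Lagrange equations the residual vanishes for every variation of the
Legendre lift, which gives both kinds of criticality (`PhaseVariation.hasDerivAt_action_zero`).
Convergence passes between the problems because on holonomic sections both integrands equal L ∘ j^kφ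
(`pullCurve_thetaR_holonomic`).

Two further points carry weight. First, the Legendre map is defined through a preferred chart at
each point, and its momenta must be shown not to depend on it. Along a curve, d/dt (p · j^{k−1}η) =
dL · j^kη − EL · η (`deriv_legendreFun_derivs`). The dL terms agree in any two charts, so the
difference of the two momenta is a functional of the derivatives of η whose total derivative has
order zero in η; such a functional is zero (`eventually_eq_zero_of_deriv_order_zero`,
`legendreFun_trans`). Second, the fundamental lemma needs genuine vector fields with smooth local
flows. They come from an explicit flow on the line (`lineFlow`), placed in a chart by
`exists_chart_variation` and supported where the coefficient to be killed has constant sign. -/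

noncomputable section

namespace HOMech

universe u

/-! ### An explicit smooth flow on the line, supported in [−1, 1] -/

section LineFlow

/-- `e^{-1/(2(1+x))}`, extended by `0` to the left of `-1`. -/
def flatL (x : ℝ) : ℝ := expNegInvGlue (2 * (1 + x))

/-- `e^{-1/(2(1-x))}`, extended by `0` to the right of `1`. -/
def flatR (x : ℝ) : ℝ := expNegInvGlue (2 * (1 - x))

theorem contDiff_flatL : ContDiff ℝ ∞ flatL :=
  expNegInvGlue.contDiff.comp (by fun_prop)

theorem contDiff_flatR : ContDiff ℝ ∞ flatR :=
  expNegInvGlue.contDiff.comp (by fun_prop)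

theorem flatL_nonneg (x : ℝ) : 0 ≤ flatL x := expNegInvGlue.nonneg _

theorem flatR_nonneg (x : ℝ) : 0 ≤ flatR x := expNegInvGlue.nonneg _

theorem flat_sq_add_pos (x : ℝ) : 0 < flatL x ^ 2 + flatR x ^ 2 := by
  rcases le_or_gt 0 x with h | h
  · have : 0 < flatL x := expNegInvGlue.pos_of_pos (by linarith)
    positivity
  · have : 0 < flatR x := expNegInvGlue.pos_of_pos (by linarith)
    positivity

theorem flat_mul_eq_zero {x : ℝ} (h : 1 ≤ |x|) : flatL x * flatR x = 0 := by
  rcases le_abs.1 h with h | h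
  · rw [show flatR x = 0 from expNegInvGlue.zero_of_nonpos (by linarith), mul_zero]
  · rw [show flatL x = 0 from expNegInvGlue.zero_of_nonpos (by linarith), zero_mul]

/-- The exponents −1/(2(1+x)) and −1/(2(1−x)) differ by x/(1−x²). Thus an exponential that is
singular at ±1 becomes a quotient of functions smooth on the whole line, and all formulas of the
flow are written homogeneously in these two functions. -/
theorem flatL_div_flatR {x : ℝ} (h : |x| < 1) :
    0 < flatL x ∧ 0 < flatR x ∧ flatL x / flatR x = Real.exp (x / (1 - x ^ 2)) := by
  obtain ⟨h1, h2⟩ := abs_lt.1 h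
  refine ⟨expNegInvGlue.pos_of_pos (by linarith), expNegInvGlue.pos_of_pos (by linarith), ?_⟩
  unfold flatL flatR expNegInvGlue
  rw [if_neg (by linarith), if_neg (by linarith), ← Real.exp_sub]
  congr 1
  have h3 : 1 + x ≠ 0 := by linarith
  have h4 : 1 - x ≠ 0 := by linarith
  rw [show 1 - x ^ 2 = (1 + x) * (1 - x) by ring]
  field_simp
  ring

/-- The discriminant root in the explicit line flow. -/
def flowRoot (p : ℝ × ℝ) : ℝ :=
  √((flatL p.2 ^ 2 - flatR p.2 ^ 2 + p.1 * (2 * (flatL p.2 * flatR p.2))) ^ 2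
    + (2 * (flatL p.2 * flatR p.2)) ^ 2)

/-- The exponential of the displacement in the coordinate `x / (1 - x²)`. -/
def flowRatio (p : ℝ × ℝ) : ℝ :=
  (flatL p.2 ^ 2 + flatR p.2 ^ 2 + p.1 * (2 * (flatL p.2 * flatR p.2)) + flowRoot p) /
    (flatL p.2 ^ 2 + flatR p.2 ^ 2 - p.1 * (2 * (flatL p.2 * flatR p.2)) + flowRoot p)

/-- The position numerator of the explicit line flow. -/
def flowPos (p : ℝ × ℝ) : ℝ := p.2 + Real.log (flowRatio p) * (1 - p.2 ^ 2)

/-- An explicit flow on the line, which is the translation by `s` in the coordinate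
`sinh (x / (1 - x²))` of `(-1, 1)` and the identity outside. -/
def lineFlow (p : ℝ × ℝ) : ℝ :=
  2 * flowPos p / (1 - p.2 ^ 2 + √((1 - p.2 ^ 2) ^ 2 + 4 * flowPos p ^ 2))

/-- The generator of `lineFlow`. -/
def lineField (x : ℝ) : ℝ :=
  (1 - x ^ 2) ^ 2 / (1 + x ^ 2) * (2 * (flatL x * flatR x) / (flatL x ^ 2 + flatR x ^ 2))

theorem contDiff_lineField : ContDiff ℝ ∞ lineField := by
  have hA := contDiff_flatL
  have hC := contDiff_flatR
  unfold lineField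
  refine ContDiff.mul (ContDiff.div (by fun_prop) (by fun_prop) fun x => by positivity)
    (ContDiff.div (by fun_prop) (by fun_prop) fun x => (flat_sq_add_pos x).ne')

theorem lineField_nonneg (x : ℝ) : 0 ≤ lineField x := by
  have := flatL_nonneg x
  have := flatR_nonneg x
  unfold lineField
  positivity

theorem lineField_zero_pos : 0 < lineField 0 := by
  obtain ⟨h1, h2, -⟩ := flatL_div_flatR (x := 0) (by simp)
  unfold lineField
  positivity

theorem lineField_eq_zero {x : ℝ} (h : 1 ≤ |x|) : lineField x = 0 := by
  rw [lineField, flat_mul_eq_zero h]; simp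

theorem flowRoot_arg_pos (p : ℝ × ℝ) :
    0 < (flatL p.2 ^ 2 - flatR p.2 ^ 2 + p.1 * (2 * (flatL p.2 * flatR p.2))) ^ 2
    + (2 * (flatL p.2 * flatR p.2)) ^ 2 := by
  by_cases h : flatL p.2 * flatR p.2 = 0
  · rw [h]
    have := flat_sq_add_pos p.2
    rcases mul_eq_zero.1 h with h | h <;> rw [h] at this ⊢ <;> simp at this ⊢ <;> positivity
  · positivity

/-- By the inequality A² + C² ≥ 2AC and |s| < 1 the terms without the root are nonnegative, while
the root is positive. This is the source of the bound on the time parameter. -/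
theorem flow_terms_pos {p : ℝ × ℝ} (hp : p.1 ∈ Ioo (-1 : ℝ) 1) :
    0 < flatL p.2 ^ 2 + flatR p.2 ^ 2 + p.1 * (2 * (flatL p.2 * flatR p.2)) + flowRoot p ∧
    0 < flatL p.2 ^ 2 + flatR p.2 ^ 2 - p.1 * (2 * (flatL p.2 * flatR p.2)) + flowRoot p := by
  have h0 := flatL_nonneg p.2
  have h1 := flatR_nonneg p.2
  have h3 : 0 < flowRoot p := Real.sqrt_pos.2 (flowRoot_arg_pos p)
  have h4 := mul_nonneg h0 h1
  obtain ⟨h5, h6⟩ := hp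
  constructor <;> nlinarith [sq_nonneg (flatL p.2 - flatR p.2)]

theorem flowRatio_pos {p : ℝ × ℝ} (hp : p.1 ∈ Ioo (-1 : ℝ) 1) : 0 < flowRatio p :=
  div_pos (flow_terms_pos hp).1 (flow_terms_pos hp).2

/-- Off (−1, 1) the product of the two flat functions is zero, so numerator and denominator of
`flowRatio` coincide and the logarithm vanishes. -/
theorem flowPos_eq {p : ℝ × ℝ} (hp : p.1 ∈ Ioo (-1 : ℝ) 1) (h : 1 ≤ |p.2|) : flowPos p = p.2 := by
  have h1 := flow_terms_pos hp
  unfold flowPos flowRatio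
  rw [flat_mul_eq_zero h] at h1 ⊢
  simp only [mul_zero, add_zero, sub_zero] at h1 ⊢
  rw [div_self h1.1.ne', Real.log_one]
  ring

theorem sqrt_outside (x : ℝ) : √((1 - x ^ 2) ^ 2 + 4 * x ^ 2) = 1 + x ^ 2 := by
  rw [show (1 - x ^ 2) ^ 2 + 4 * x ^ 2 = (1 + x ^ 2) ^ 2 by ring]
  exact Real.sqrt_sq (by positivity)

theorem lineFlow_eq_self {p : ℝ × ℝ} (hp : p.1 ∈ Ioo (-1 : ℝ) 1) (h : 1 ≤ |p.2|) :
    lineFlow p = p.2 := by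
  unfold lineFlow
  rw [flowPos_eq hp h, sqrt_outside]
  ring_nf

theorem lineFlow_denom_pos {p : ℝ × ℝ} (hp : p.1 ∈ Ioo (-1 : ℝ) 1) :
    0 < (1 - p.2 ^ 2) ^ 2 + 4 * flowPos p ^ 2 ∧
    0 < 1 - p.2 ^ 2 + √((1 - p.2 ^ 2) ^ 2 + 4 * flowPos p ^ 2) := by
  rcases lt_or_ge |p.2| 1 with h | h
  · have h1 : 0 < 1 - p.2 ^ 2 := by
      have := (sq_lt_one_iff_abs_lt_one p.2).2 h
      linarith
    constructor <;> positivity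
  · rw [flowPos_eq hp h, sqrt_outside]
    have h2 : 0 < p.2 ^ 2 := by
      have : p.2 ≠ 0 := by rintro h0; rw [h0] at h; norm_num at h
      positivity
    constructor <;> nlinarith [sq_nonneg (1 - p.2 ^ 2)]

theorem contDiffOn_lineFlow : ContDiffOn ℝ ∞ lineFlow (Ioo (-1 : ℝ) 1 ×ˢ univ) := by
  have hA : ContDiff ℝ ∞ fun p : ℝ × ℝ => flatL p.2 := contDiff_flatL.comp contDiff_snd
  have hC : ContDiff ℝ ∞ fun p : ℝ × ℝ => flatR p.2 := contDiff_flatR.comp contDiff_snd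
  rintro p ⟨hp, -⟩
  refine ContDiffAt.contDiffWithinAt ?_
  have hR : ContDiffAt ℝ ∞ flowRoot p :=
    ContDiffAt.sqrt (ContDiff.contDiffAt (by fun_prop)) (flowRoot_arg_pos p).ne'
  have hA' := hA.contDiffAt (x := p)
  have hC' := hC.contDiffAt (x := p)
  have hQ : ContDiffAt ℝ ∞ flowRatio p := by
    refine ContDiffAt.div ?_ ?_ (flow_terms_pos hp).2.ne'
    · fun_prop
    · fun_prop
  have hP : ContDiffAt ℝ ∞ flowPos p := by
    have := hQ.log (flowRatio_pos hp).ne'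
    unfold flowPos
    fun_prop
  have hS : ContDiffAt ℝ ∞ (fun p : ℝ × ℝ => √((1 - p.2 ^ 2) ^ 2 + 4 * flowPos p ^ 2)) p :=
    ContDiffAt.sqrt (by fun_prop) (lineFlow_denom_pos hp).1.ne'
  unfold lineFlow
  exact ContDiffAt.div (by fun_prop) (by fun_prop) (lineFlow_denom_pos hp).2.ne'

/-- The root in (−1, 1) of y/(1−y²) = W is y = 2W/(1 + √(1+4W²)). Multiplying numerator and
denominator by 1−x² gives `lineFlow`, in a form that still makes sense for |x| ≥ 1. -/
theorem lineFlow_inside {p : ℝ × ℝ} (h : |p.2| < 1) :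
    |lineFlow p| < 1 ∧ lineFlow p / (1 - lineFlow p ^ 2)
      = p.2 / (1 - p.2 ^ 2) + Real.log (flowRatio p) := by
  have hm : 0 < 1 - p.2 ^ 2 := by
    have := (sq_lt_one_iff_abs_lt_one p.2).2 h
    linarith
  set W := p.2 / (1 - p.2 ^ 2) + Real.log (flowRatio p) with hW
  have h1 : flowPos p = (1 - p.2 ^ 2) * W := by
    rw [hW, flowPos]; field_simp
  set r := √(1 + 4 * W ^ 2) with hr
  have hr2 : r ^ 2 = 1 + 4 * W ^ 2 := Real.sq_sqrt (by positivity)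
  have hr0 : 0 ≤ r := Real.sqrt_nonneg _
  have h2 : lineFlow p = 2 * W / (1 + r) := by
    unfold lineFlow
    rw [h1, show (1 - p.2 ^ 2) ^ 2 + 4 * ((1 - p.2 ^ 2) * W) ^ 2
      = (1 - p.2 ^ 2) ^ 2 * (1 + 4 * W ^ 2) by ring, Real.sqrt_mul (by positivity),
      Real.sqrt_sq hm.le, ← hr]
    field_simp
  have h3 : 1 - lineFlow p ^ 2 = 2 / (1 + r) := by
    rw [h2]
    field_simp
    linear_combination hr2
  constructor
  · rw [← sq_lt_one_iff_abs_lt_one]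
    have : 0 < 2 / (1 + r) := by positivity
    linarith
  · rw [h3, h2]
    field_simp

theorem lineFlow_zero (x : ℝ) : lineFlow (0, x) = x := by
  have h : flowPos (0, x) = x := by
    have h1 := (flow_terms_pos (p := (0, x)) (by simp)).1
    unfold flowPos flowRatio
    simp only [zero_mul, add_zero, sub_zero] at h1 ⊢
    rw [div_self h1.ne', Real.log_one]
    ring
  unfold lineFlow
  rw [h, sqrt_outside]
  ring_nf

theorem sinh_lineFlow {p : ℝ × ℝ} (hp : p.1 ∈ Ioo (-1 : ℝ) 1) (h : |p.2| < 1) :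
    Real.sinh (lineFlow p / (1 - lineFlow p ^ 2)) = Real.sinh (p.2 / (1 - p.2 ^ 2)) + p.1 := by
  rw [(lineFlow_inside h).2]
  obtain ⟨hA, hC, hw⟩ := flatL_div_flatR h
  obtain ⟨hU, hD⟩ := flow_terms_pos hp
  have hR2 : flowRoot p ^ 2 = _ := Real.sq_sqrt (flowRoot_arg_pos p).le
  rw [Real.sinh_eq, Real.sinh_eq, Real.exp_neg, Real.exp_neg, Real.exp_add,
    Real.exp_log (flowRatio_pos hp), ← hw]
  unfold flowRatio
  set A := flatL p.2
  set C := flatR p.2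
  set R := flowRoot p
  set s := p.1
  obtain ⟨U, hUe⟩ : ∃ U, U = A ^ 2 + C ^ 2 + s * (2 * (A * C)) + R := ⟨_, rfl⟩
  obtain ⟨D, hDe⟩ : ∃ D, D = A ^ 2 + C ^ 2 - s * (2 * (A * C)) + R := ⟨_, rfl⟩
  -- With e^W = A/C and e^{W'} = (A/C)(U/D), this is the equation sinh W' = sinh W + s with
  -- denominators cleared.
  have key : A ^ 2 * U ^ 2 - C ^ 2 * D ^ 2 = (A ^ 2 - C ^ 2 + 2 * s * (A * C)) * (U * D) := by
    rw [hUe, hDe]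
    linear_combination (-2 * s * A * C) * hR2
  rw [← hUe] at hU ⊢
  rw [← hDe] at hD ⊢
  field_simp
  linear_combination key

/-- Differentiating sinh(y/(1−y²)) = const + s gives y' as the reciprocal of cosh(y/(1−y²))
(1+y²)/(1−y²)². In terms of the flat functions the hyperbolic cosine is (A²+C²)/(2AC), so this
reciprocal is `lineField`. -/
theorem hasDerivAt_lineFlow {s : ℝ} (hs : s ∈ Ioo (-1 : ℝ) 1) (x : ℝ) :
    HasDerivAt (fun s => lineFlow (s, x)) (lineField (lineFlow (s, x))) s := by
  rcases lt_or_ge |x| 1 with h | h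
  · have hd : DifferentiableAt ℝ (fun s => lineFlow (s, x)) s := by
      have h1 : DifferentiableAt ℝ lineFlow (s, x) :=
        (contDiffOn_lineFlow.contDiffAt ((isOpen_Ioo.prod isOpen_univ).mem_nhds
          ⟨hs, mem_univ x⟩)).differentiableAt (by simp)
      exact DifferentiableAt.comp (g := lineFlow) (f := fun s => (s, x)) s h1 (by fun_prop)
    have h1 := (lineFlow_inside (p := (s, x)) h).1
    set y := lineFlow (s, x) with hy
    have hm : 0 < 1 - y ^ 2 := by
      have := (sq_lt_one_iff_abs_lt_one y).2 h1
      linarith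
    obtain ⟨hA, hC, hw⟩ := flatL_div_flatR h1
    have hK : HasDerivAt (fun y : ℝ => Real.sinh (y / (1 - y ^ 2)))
        (Real.cosh (y / (1 - y ^ 2)) * ((1 * (1 - y ^ 2) - y * (-(2 * y))) / (1 - y ^ 2) ^ 2)) y := by
      refine HasDerivAt.sinh ((hasDerivAt_id y).fun_div ?_ hm.ne')
      simpa using (hasDerivAt_pow 2 y).const_sub 1
    have h2 := HasDerivAt.comp s hK hd.hasDerivAt
    have h3 : HasDerivAt (fun s : ℝ => Real.sinh (x / (1 - x ^ 2)) + s) 1 s :=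
      (hasDerivAt_id s).const_add _
    have h4 : (fun s : ℝ => Real.sinh (x / (1 - x ^ 2)) + s) =ᶠ[𝓝 s]
        (fun y : ℝ => Real.sinh (y / (1 - y ^ 2))) ∘ fun s => lineFlow (s, x) := by
      filter_upwards [isOpen_Ioo.mem_nhds hs] with r hr
      exact (sinh_lineFlow (p := (r, x)) hr h).symm
    have h5 := h2.unique (h3.congr_of_eventuallyEq h4.symm)
    have h6 := hd.hasDerivAt
    suffices h8 : lineField y = deriv (fun s => lineFlow (s, x)) s by rwa [h8]
    rw [Real.cosh_eq, Real.exp_neg, ← hw] at h5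
    unfold lineField
    set d := deriv (fun s => lineFlow (s, x)) s
    have h7 := flat_sq_add_pos y
    field_simp at h5 ⊢
    linear_combination -h5
  · have h1 : lineFlow (s, x) = x := lineFlow_eq_self (p := (s, x)) hs h
    rw [h1, lineField_eq_zero h]
    refine (hasDerivAt_const s x).congr_of_eventuallyEq ?_
    filter_upwards [isOpen_Ioo.mem_nhds hs] with r hr
    exact lineFlow_eq_self (p := (r, x)) hr h

end LineFlow

/-! ### Variation fields with explicit flows in a chart -/

section ChartVariation

/-- The displacement along a line `z + ℝ v` in a normed space of the flow of a compactly supported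
vector field parallel to `v`. -/
theorem exists_line_displacement {H : Type*} [NormedAddCommGroup H] [NormedSpace ℝ H]
    [FiniteDimensional ℝ H] (z₀ v : H) (hv : v ≠ 0) {O : Set H} (hO : O ∈ 𝓝 z₀) :
    ∃ (F : ℝ × H → ℝ) (w : H → ℝ) (K : Set H), IsCompact K ∧ K ⊆ O ∧
      ContDiffOn ℝ ∞ F (Ioo (-1 : ℝ) 1 ×ˢ univ) ∧ ContDiff ℝ ∞ w ∧ (∀ z, 0 ≤ w z) ∧ 0 < w z₀ ∧
      (∀ z, F (0, z) = 0) ∧ (∀ z ∉ K, w z = 0) ∧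
      (∀ s ∈ Ioo (-1 : ℝ) 1, ∀ z ∉ K, F (s, z) = 0) ∧
      (∀ s ∈ Ioo (-1 : ℝ) 1, ∀ z ∈ K, z + F (s, z) • v ∈ K) ∧
      ∀ s ∈ Ioo (-1 : ℝ) 1, ∀ z, HasDerivAt (fun s => F (s, z)) (w (z + F (s, z) • v)) s := by
  obtain ⟨ℓ, hℓ⟩ : ∃ ℓ : H →L[ℝ] ℝ, ℓ v = 1 := by
    obtain ⟨f, hf⟩ := SeparatingDual.exists_ne_zero (R := ℝ) hv
    exact ⟨(f v)⁻¹ • f, by simp [hf]⟩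
  obtain ⟨R, hR, hRO⟩ := Metric.nhds_basis_closedBall.mem_iff.1 hO
  -- This radius makes the cylinder `K` below fit into the ball of radius R: a point of it is at
  -- distance at most r + r‖v‖ from z₀.
  set r := R / (1 + ‖v‖) with hr
  have hv0 : 0 < 1 + ‖v‖ := by positivity
  have hr0 : 0 < r := by positivity
  have hrR : r * (1 + ‖v‖) = R := by rw [hr]; field_simp
  -- The projection along v. A cutoff depending on z through `pr` is constant on each line parallel
  -- to v, so it merely rescales the time of the one-dimensional flow on that line and the flow
  -- property survives.
  let pr : H → H := fun z => z - ℓ z • v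
  have hpr : ContDiff ℝ ∞ pr := by fun_prop
  let B : ContDiffBump (pr z₀) := ⟨r / 2, r, by positivity, by linarith⟩
  let b : H → ℝ := fun z => B (pr z)
  have hb : ContDiff ℝ ∞ b := B.contDiff.comp hpr
  have hb0 : ∀ z, 0 ≤ b z := fun z => B.nonneg
  have hb1 : ∀ z, b z ≤ 1 := fun z => B.le_one
  let x : H → ℝ := fun z => (ℓ z - ℓ z₀) / r
  have hx : ContDiff ℝ ∞ x := by fun_prop
  let F : ℝ × H → ℝ := fun p => r * (lineFlow (p.1 * b p.2, x p.2) - x p.2)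
  let w : H → ℝ := fun z => r * (b z * lineField (x z))
  let K : Set H := {z | dist (pr z) (pr z₀) ≤ r ∧ |x z| ≤ 1}
  have hsb : ∀ s ∈ Ioo (-1 : ℝ) 1, ∀ z, s * b z ∈ Ioo (-1 : ℝ) 1 := by
    intro s hs z
    rw [mem_Ioo, ← abs_lt] at hs ⊢
    rw [abs_mul, abs_of_nonneg (hb0 z)]
    nlinarith [abs_nonneg s, hb0 z, hb1 z]
  have hprF : ∀ z (a : ℝ), pr (z + a • v) = pr z := by
    intro z a
    simp only [pr, map_add, map_smul, hℓ, smul_eq_mul, mul_one, add_smul]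
    abel
  have hxF : ∀ p : ℝ × H, x (p.2 + F p • v) = lineFlow (p.1 * b p.2, x p.2) := by
    intro p
    simp only [x, F, map_add, map_smul, hℓ, smul_eq_mul, mul_one]
    field_simp
    ring
  have hKc : IsClosed K := by
    have h1 : IsClosed {z | dist (pr z) (pr z₀) ≤ r} :=
      isClosed_le (hpr.continuous.dist continuous_const) continuous_const
    have h2 : IsClosed {z | |x z| ≤ 1} := isClosed_le hx.continuous.abs continuous_const
    exact h1.inter h2
  have hKb : K ⊆ Metric.closedBall z₀ R := by
    rintro z ⟨h1, h2⟩
    rw [Metric.mem_closedBall, dist_eq_norm]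
    rw [dist_eq_norm] at h1
    have h3 : z - z₀ = (pr z - pr z₀) + (r * x z) • v := by
      have : r * x z = ℓ z - ℓ z₀ := by simp only [x]; field_simp
      rw [this, sub_smul]
      simp only [pr]
      abel
    rw [h3, ← hrR]
    refine (norm_add_le _ _).trans ?_
    rw [norm_smul, Real.norm_eq_abs, abs_mul, abs_of_pos hr0]
    have : r * |x z| * ‖v‖ ≤ r * 1 * ‖v‖ := by gcongr
    linarith
  have hout : ∀ z ∉ K, b z = 0 ∨ 1 ≤ |x z| := by
    intro z hz
    by_cases h : dist (pr z) (pr z₀) ≤ r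
    · right
      by_contra! h2
      exact hz ⟨h, h2.le⟩
    · left
      exact B.zero_of_le_dist (not_le.1 h).le
  refine ⟨F, w, K, (isCompact_closedBall z₀ R).of_isClosed_subset hKc hKb, hKb.trans hRO, ?_, ?_,
    ?_, ?_, ?_, ?_, ?_, ?_, ?_⟩
  · have h1 : ContDiff ℝ ∞ fun p : ℝ × H => (p.1 * b p.2, x p.2) :=
      (contDiff_fst.mul (hb.comp contDiff_snd)).prodMk (hx.comp contDiff_snd)
    have h2 : ContDiffOn ℝ ∞ (fun p : ℝ × H => lineFlow (p.1 * b p.2, x p.2))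
        (Ioo (-1 : ℝ) 1 ×ˢ univ) :=
      contDiffOn_lineFlow.comp h1.contDiffOn fun p hp => ⟨hsb p.1 hp.1 p.2, mem_univ _⟩
    exact contDiffOn_const.mul (h2.sub (hx.comp contDiff_snd).contDiffOn)
  · exact contDiff_const.mul (hb.mul (contDiff_lineField.comp hx))
  · intro z
    exact mul_nonneg hr0.le (mul_nonneg (hb0 z) (lineField_nonneg _))
  · have h1 : b z₀ = 1 := B.one_of_mem_closedBall (Metric.mem_closedBall_self (by positivity))
    have h2 : x z₀ = 0 := by simp [x]
    show 0 < r * (b z₀ * lineField (x z₀))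
    rw [h1, h2, one_mul]
    exact mul_pos hr0 lineField_zero_pos
  · intro z
    simp [F, lineFlow_zero]
  · intro z hz
    show r * (b z * lineField (x z)) = 0
    rcases hout z hz with h | h
    · rw [h]; simp
    · rw [lineField_eq_zero h]; simp
  · intro s hs z hz
    show r * (lineFlow (s * b z, x z) - x z) = 0
    rcases hout z hz with h | h
    · rw [h, mul_zero, lineFlow_zero]; simp
    · rw [lineFlow_eq_self (p := (s * b z, x z)) (hsb s hs z) h]; simp
  · rintro s hs z ⟨h1, h2⟩
    refine ⟨by rwa [hprF], ?_⟩
    rw [hxF (s, z)]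
    rcases lt_or_ge |x z| 1 with h | h
    · exact (lineFlow_inside (p := (s * b z, x z)) h).1.le
    · rwa [lineFlow_eq_self (p := (s * b z, x z)) (hsb s hs z) h]
  · intro s hs z
    have h1 : w (z + F (s, z) • v) = r * (b z * lineField (lineFlow (s * b z, x z))) := by
      simp only [w, hxF (s, z)]
      simp only [b, hprF]
    rw [h1]
    have h2 := HasDerivAt.comp (h₂ := fun s => lineFlow (s, x z)) (h := fun s => s * b z) s
      (hasDerivAt_lineFlow (hsb s hs z) (x z)) ((hasDerivAt_id s).mul_const (b z))
    have h3 : r * (b z * lineField (lineFlow (s * b z, x z)))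
        = r * (lineField (lineFlow (s * b z, x z)) * (1 * b z)) := by ring
    rw [h3]
    exact (h2.sub_const (x z)).const_mul r

variable {H M : Type*} [NormedAddCommGroup H] [NormedSpace ℝ H] [FiniteDimensional ℝ H]
  [TopologicalSpace M] [T2Space M] [ChartedSpace H M] [IsManifold 𝓘(ℝ, H) ∞ M]

/-- In any smooth chart there are variation fields with an explicit local flow, parallel to a given
direction and supported near a given point. -/
theorem exists_chart_variation (c : OpenPartialHomeomorph M H)
    (hc : ContMDiffOn 𝓘(ℝ, H) 𝓘(ℝ, H) ∞ c c.source)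
    (hc' : ContMDiffOn 𝓘(ℝ, H) 𝓘(ℝ, H) ∞ c.symm c.target) {ρ : M → ℝ} {ℓ : H →L[ℝ] ℝ}
    (hρ : ∀ x ∈ c.source, ρ x = ℓ (c x)) {V : Set ℝ} {x₀ : M} (hx₀ : x₀ ∈ c.source)
    {N : Set M} (hN : N ∈ 𝓝 x₀) (hNV : ρ '' N ⊆ V) {v : H} (hv : v ≠ 0) (hℓv : ℓ v = 0) :
    ∃ (Z : ∀ x : M, TangentSpace 𝓘(ℝ, H) x) (σ : ℝ → M → M) (F : ℝ × H → ℝ) (w : H → ℝ),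
      IsVariationField ρ V Z ∧ closure {x | Z x ≠ 0} ⊆ N ∧ IsLocalFlow Z 1 σ ∧
      ContDiffOn ℝ ∞ F (Ioo (-1 : ℝ) 1 ×ˢ univ) ∧ ContDiff ℝ ∞ w ∧ (∀ z, 0 ≤ w z) ∧
      0 < w (c x₀) ∧ (∀ x ∈ c.source \ N, w (c x) = 0) ∧
      (∀ z, F (0, z) = 0) ∧ (∀ z, HasDerivAt (fun s => F (s, z)) (w z) 0) ∧
      ∀ s ∈ Ioo (-1 : ℝ) 1, ∀ x ∈ c.source, σ s x ∈ c.source ∧ c (σ s x) = c x + F (s, c x) • v := by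
  classical
  have hO : c.target ∩ c.symm ⁻¹' N ∈ 𝓝 (c x₀) := by
    refine inter_mem (c.open_target.mem_nhds (c.map_source hx₀)) ?_
    refine (c.continuousAt_symm (c.map_source hx₀)).preimage_mem_nhds ?_
    rwa [c.left_inv hx₀]
  obtain ⟨F, w, K, hKc, hKO, hF, hw, hw0, hwp, hF0, hwK, hFK, hKK, hFd⟩ :=
    exists_line_displacement (c x₀) v hv hO
  have hmd : c.MDifferentiable 𝓘(ℝ, H) 𝓘(ℝ, H) :=
    ⟨hc.mdifferentiableOn (by simp), hc'.mdifferentiableOn (by simp)⟩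
  set K' : Set M := c.symm '' K with hK'
  have hK'c : IsCompact K' := hKc.image_of_continuousOn
    (c.continuousOn_symm.mono fun z hz => (hKO hz).1)
  have hK's : K' ⊆ c.source := by
    rintro _ ⟨z, hz, rfl⟩; exact c.map_target (hKO hz).1
  have hK'N : K' ⊆ N := by
    rintro _ ⟨z, hz, rfl⟩; exact (hKO hz).2
  have hmemK : ∀ x ∈ c.source, x ∉ K' → c x ∉ K := fun x hx hxK h => hxK ⟨c x, h, c.left_inv hx⟩
  let W : ∀ z : H, TangentSpace 𝓘(ℝ, H) z := fun z => w z • v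
  -- The field and its flow are transported by the chart and extended by zero and by the identity.
  -- The extensions are smooth because both are trivial off K', which is closed, being compact in a
  -- Hausdorff space.
  let Z : ∀ x : M, TangentSpace 𝓘(ℝ, H) x := fun x =>
    if x ∈ c.source then VectorField.mpullback 𝓘(ℝ, H) 𝓘(ℝ, H) c W x else 0
  let σ : ℝ → M → M := fun s x => if x ∈ c.source then c.symm (c x + F (s, c x) • v) else x
  have hZ0 : ∀ x ∉ K', Z x = 0 := by
    intro x hx
    by_cases h : x ∈ c.source
    · have h0 : W (c x) = 0 := by
        show w (c x) • v = 0
        rw [hwK _ (hmemK x h hx), zero_smul]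
      simp only [Z, if_pos h, VectorField.mpullback_apply, h0, map_zero]
    · simp only [Z, if_neg h]
  have htarget : ∀ s ∈ Ioo (-1 : ℝ) 1, ∀ z ∈ c.target, z + F (s, z) • v ∈ c.target := by
    intro s hs z hz
    by_cases h : z ∈ K
    · exact (hKO (hKK s hs z h)).1
    · rw [hFK s hs z h, zero_smul, add_zero]; exact hz
  have hσs : ∀ s ∈ Ioo (-1 : ℝ) 1, ∀ x ∈ c.source,
      σ s x ∈ c.source ∧ c (σ s x) = c x + F (s, c x) • v := by
    intro s hs x hx
    have h := htarget s hs _ (c.map_source hx)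
    simp only [σ, if_pos hx]
    exact ⟨c.map_target h, c.right_inv h⟩
  have hσK : ∀ s ∈ Ioo (-1 : ℝ) 1, ∀ x ∉ K', σ s x = x := by
    intro s hs x hx
    by_cases h : x ∈ c.source
    · simp only [σ, if_pos h]
      rw [hFK s hs _ (hmemK x h hx), zero_smul, add_zero, c.left_inv h]
    · simp only [σ, if_neg h]
  have hclos : closure {x | Z x ≠ 0} ⊆ K' :=
    closure_minimal (fun x hx => by by_contra h; exact hx (hZ0 x h)) hK'c.isClosed
  have hinv : ∀ x ∈ c.source, (mfderiv 𝓘(ℝ, H) 𝓘(ℝ, H) c x).IsInvertible := fun x hx =>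
    ⟨hmd.mfderiv hx, rfl⟩
  refine ⟨Z, σ, F, w, ⟨?_, ?_, ?_, ?_⟩, hclos.trans hK'N, ⟨one_pos, ?_, ?_, ?_⟩, hF, hw, hw0, hwp,
    ?_, hF0, ?_, hσs⟩
  · intro x
    by_cases hx : x ∈ c.source
    · have hW : ContMDiffAt 𝓘(ℝ, H) 𝓘(ℝ, H).tangent ∞
          (fun z => (⟨z, W z⟩ : TangentBundle 𝓘(ℝ, H) H)) (c x) :=
        contMDiffAt_vectorSpace_iff_contDiffAt.2 (hw.smul contDiff_const).contDiffAt
      have := hW.mpullback_vectorField_preimage (hc.contMDiffAt (c.open_source.mem_nhds hx))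
        (hinv x hx) (by simp)
      refine this.congr_of_eventuallyEq ?_
      filter_upwards [c.open_source.mem_nhds hx] with y hy
      simp only [Z, if_pos hy]
    · have h0 := Bundle.contMDiff_zeroSection ℝ (TangentSpace 𝓘(ℝ, H) : M → Type _) (n := ∞)
        (IB := 𝓘(ℝ, H)) (F := H) x
      refine h0.congr_of_eventuallyEq ?_
      filter_upwards [hK'c.isClosed.isOpen_compl.mem_nhds fun h => hx (hK's h)] with y hy
      rw [hZ0 y hy]
      rfl
  · intro x
    by_cases hx : x ∈ c.source
    · have h1 : HasMFDerivAt 𝓘(ℝ, H) 𝓘(ℝ, ℝ) ℓ (c x) ℓ := ℓ.hasFDerivAt.hasMFDerivAt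
      have h2 := h1.comp x (hmd.mdifferentiableAt hx).hasMFDerivAt
      have h3 : ρ =ᶠ[𝓝 x] ℓ ∘ c := by
        filter_upwards [c.open_source.mem_nhds hx] with y hy using hρ y hy
      rw [(h2.congr_of_eventuallyEq h3).mfderiv]
      show ℓ (mfderiv 𝓘(ℝ, H) 𝓘(ℝ, H) c x (Z x)) = 0
      have h4 : mfderiv 𝓘(ℝ, H) 𝓘(ℝ, H) c x (Z x) = w (c x) • v := by
        simp only [Z, if_pos hx, VectorField.mpullback_apply]
        exact (hinv x hx).self_apply_inverse _
      rw [h4, map_smul, hℓv, smul_zero]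
    · simp only [Z, if_neg hx, map_zero]
  · exact hK'c.of_isClosed_subset isClosed_closure hclos
  · exact (image_mono (hclos.trans hK'N)).trans hNV
  · rintro ⟨s, x⟩ ⟨hs, -⟩
    refine ContMDiffAt.contMDiffWithinAt ?_
    have hs' : ∀ᶠ p : ℝ × M in 𝓝 (s, x), p.1 ∈ Ioo (-1 : ℝ) 1 :=
      continuous_fst.continuousAt.eventually (isOpen_Ioo.mem_nhds hs)
    by_cases hx : x ∈ c.source
    · have hc1 : ContMDiffAt (𝓘(ℝ, ℝ).prod 𝓘(ℝ, H)) 𝓘(ℝ, H) ∞ (fun p : ℝ × M => c p.2) (s, x) :=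
        (hc.contMDiffAt (c.open_source.mem_nhds hx)).comp (s, x) contMDiffAt_snd
      have hc2 : ContMDiffAt (𝓘(ℝ, ℝ).prod 𝓘(ℝ, H)) 𝓘(ℝ, ℝ × H) ∞
          (fun p : ℝ × M => (p.1, c p.2)) (s, x) := contMDiffAt_fst.prodMk_space hc1
      have hG : ContDiffAt ℝ ∞ (fun p : ℝ × H => p.2 + F p • v) (s, c x) :=
        contDiffAt_snd.add ((hF.contDiffAt ((isOpen_Ioo.prod isOpen_univ).mem_nhds
          ⟨hs, mem_univ _⟩)).smul contDiffAt_const)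
      have h3 := ContMDiffAt.comp (g := fun p : ℝ × H => p.2 + F p • v)
        (f := fun p : ℝ × M => (p.1, c p.2)) (s, x) hG.contMDiffAt hc2
      have h4 := hc'.contMDiffAt (c.open_target.mem_nhds (htarget s hs _ (c.map_source hx)))
      have h5 := ContMDiffAt.comp (g := c.symm)
        (f := (fun p : ℝ × H => p.2 + F p • v) ∘ fun p : ℝ × M => (p.1, c p.2)) (s, x) h4 h3
      refine h5.congr_of_eventuallyEq ?_
      have hx' : ∀ᶠ p : ℝ × M in 𝓝 (s, x), p.2 ∈ c.source :=
        continuous_snd.continuousAt.eventually (c.open_source.mem_nhds hx)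
      filter_upwards [hx'] with p hp
      simp only [σ, if_pos hp, Function.comp]
    · refine (contMDiffAt_snd (I := 𝓘(ℝ, ℝ)) (J := 𝓘(ℝ, H))).congr_of_eventuallyEq ?_
      have hx' : ∀ᶠ p : ℝ × M in 𝓝 (s, x), p.2 ∈ K'ᶜ :=
        continuous_snd.continuousAt.eventually
          (hK'c.isClosed.isOpen_compl.mem_nhds fun h => hx (hK's h))
      filter_upwards [hx', hs'] with p hp hps
      exact hσK p.1 hps p.2 hp
  · intro x
    by_cases hx : x ∈ c.source
    · simp only [σ, if_pos hx, hF0, zero_smul, add_zero, c.left_inv hx]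
    · simp only [σ, if_neg hx]
  · intro x s hs
    by_cases hx : x ∈ c.source
    · set z := c x + F (s, c x) • v with hz
      have hzt : z ∈ c.target := htarget s hs _ (c.map_source hx)
      have h1 : HasDerivAt (fun s => c x + F (s, c x) • v) (w z • v) s :=
        ((hFd s hs (c x)).smul_const v).const_add _
      have h2 := (hmd.mdifferentiableAt_symm hzt).hasMFDerivAt.comp s h1.hasFDerivAt.hasMFDerivAt
      have h3 : (fun s => σ s x) = c.symm ∘ fun s => c x + F (s, c x) • v := by
        funext r; simp only [σ, if_pos hx, Function.comp]
      have h4 : σ s x = c.symm z := by simp only [σ, if_pos hx, hz]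
      refine HasMFDerivAt.hasMFDerivWithinAt ?_
      rw [h3]
      refine h2.congr_mfderiv ?_
      refine Eq.symm (ContinuousLinearMap.ext (R₁ := ℝ) (R₂ := ℝ) (M₁ := ℝ) (M₂ := H) fun a => ?_)
      show a • Z ((c.symm ∘ fun s => c x + F (s, c x) • v) s)
        = mfderiv 𝓘(ℝ, H) 𝓘(ℝ, H) c.symm z (a • (w z • v))
      refine Eq.trans ?_ (ContinuousLinearMap.map_smul
        (mfderiv 𝓘(ℝ, H) 𝓘(ℝ, H) c.symm z : H →L[ℝ] H) a (w z • v)).symm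
      refine congrArg (fun u : H => a • u) ?_
      have h5 : Z (c.symm z) = mfderiv 𝓘(ℝ, H) 𝓘(ℝ, H) c.symm z (w z • v) := by
        have h6 := hmd.comp_symm_deriv hzt
        have h7 := hinv _ (c.map_target hzt)
        have h9 : Z (c.symm z) = (mfderiv 𝓘(ℝ, H) 𝓘(ℝ, H) c (c.symm z)).inverse
            (w (c (c.symm z)) • v : H) := by
          simp only [Z, if_pos (c.map_target hzt)]
          rfl
        have h8 : mfderiv 𝓘(ℝ, H) 𝓘(ℝ, H) c (c.symm z)
            (mfderiv 𝓘(ℝ, H) 𝓘(ℝ, H) c.symm z (w z • v : H)) = (w z • v : H) :=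
          congrArg (fun A => A (w z • v : H)) h6
        have h10 : (w (c (c.symm z)) • v : H) = mfderiv 𝓘(ℝ, H) 𝓘(ℝ, H) c (c.symm z)
            (mfderiv 𝓘(ℝ, H) 𝓘(ℝ, H) c.symm z (w z • v : H)) := by
          refine Eq.trans ?_ h8.symm
          exact congrArg (fun a => (w a • v : H)) (c.right_inv hzt)
        exact h9.trans ((congrArg _ h10).trans (h7.inverse_apply_self _))
      exact h5
    · have h1 : (fun s => σ s x) = fun _ => x := by
        funext r; simp only [σ, if_neg hx]
      rw [h1]
      refine HasMFDerivAt.hasMFDerivWithinAt ?_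
      have h2 : Z x = 0 := by simp only [Z, if_neg hx]
      have h3 := hasMFDerivAt_const (I := 𝓘(ℝ, ℝ)) (I' := 𝓘(ℝ, H)) x s
      refine h3.congr_mfderiv ?_
      refine Eq.symm (ContinuousLinearMap.ext (R₁ := ℝ) (R₂ := ℝ) (M₁ := ℝ) (M₂ := H) fun a => ?_)
      show a • Z x = 0
      rw [h2, smul_zero]
  · rintro x ⟨hx, hxN⟩
    exact hwK _ (hmemK x hx fun h => hxN (hK'N h))
  · intro z
    have := hFd 0 (by simp) z
    rwa [hF0, zero_smul, add_zero] at this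

end ChartVariation

/-! ### Derivatives along curves and total derivatives -/

section JetCalculus

variable {Y G : Type*} [NormedAddCommGroup Y] [NormedSpace ℝ Y] [NormedAddCommGroup G]
  [NormedSpace ℝ G]

theorem contDiffAt_iteratedDeriv {q : ℝ → Y} {t : ℝ} (h : ContDiffAt ℝ ∞ q t) (i : ℕ) :
    ContDiffAt ℝ ∞ (iteratedDeriv i q) t := by
  induction i with
  | zero => simpa using h
  | succ i ih => rw [iteratedDeriv_succ]; exact contDiffAt_deriv_of ih

theorem hasDerivAt_iteratedDeriv {q : ℝ → Y} {t : ℝ} (h : ContDiffAt ℝ ∞ q t) (i : ℕ) :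
    HasDerivAt (iteratedDeriv i q) (iteratedDeriv (i + 1) q t) t := by
  rw [iteratedDeriv_succ]
  exact ((contDiffAt_iteratedDeriv h i).differentiableAt (by simp)).hasDerivAt

/-- Restriction of tuples to the first entries. -/
def restr (Y : Type*) [NormedAddCommGroup Y] [NormedSpace ℝ Y] {M N : ℕ} (h : N ≤ M) :
    (Fin (M + 1) → Y) →L[ℝ] (Fin (N + 1) → Y) :=
  ContinuousLinearMap.pi fun i => ContinuousLinearMap.proj (Fin.castLE (Nat.succ_le_succ h) i)

/-- Left shift of tuples. -/
def shift (Y : Type*) [NormedAddCommGroup Y] [NormedSpace ℝ Y] {M N : ℕ} (h : N + 1 ≤ M) :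
    (Fin (M + 1) → Y) →L[ℝ] (Fin (N + 1) → Y) :=
  ContinuousLinearMap.pi fun i => ContinuousLinearMap.proj ⟨i + 1, by omega⟩

/-- The tuple of derivatives of a curve up to order `m`. -/
def derivs (m : ℕ) (q : ℝ → Y) (t : ℝ) : Fin (m + 1) → Y := fun i => iteratedDeriv i q t

theorem restr_derivs {M N : ℕ} (h : N ≤ M) (q : ℝ → Y) (t : ℝ) :
    restr Y h (derivs M q t) = derivs N q t := rfl

theorem contDiffAt_derivs (m : ℕ) {q : ℝ → Y} {t : ℝ} (h : ContDiffAt ℝ ∞ q t) :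
    ContDiffAt ℝ ∞ (derivs m q) t :=
  contDiffAt_pi.2 fun i => contDiffAt_iteratedDeriv h i

theorem hasDerivAt_derivs {M N : ℕ} (h : N + 1 ≤ M) {q : ℝ → Y} {t : ℝ}
    (hq : ContDiffAt ℝ ∞ q t) : HasDerivAt (derivs N q) (shift Y h (derivs M q t)) t :=
  hasDerivAt_pi.2 fun i => hasDerivAt_iteratedDeriv hq i

/-- Every tuple consists of the derivatives at t of a globally smooth curve, so identities between
functionals of tuples may be tested on curves. -/
theorem derivs_taylorPoly {m : ℕ} (t : ℝ) (u : Fin (m + 1) → Y) :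
    derivs m (taylorPoly t u) t = u :=
  funext fun i => iteratedDeriv_taylorPoly t u i

theorem contDiff_taylorPoly_const {m : ℕ} (t : ℝ) (u : Fin (m + 1) → Y) :
    ContDiff ℝ ∞ (taylorPoly t u) :=
  contDiff_snd.comp (contDiff_graph_taylorPoly t u)

/-- The first derivative in a parameter commutes with iterated derivatives in another one. -/
theorem deriv_iteratedDeriv_comm {U : Set (ℝ × ℝ)} (hU : IsOpen U) {g : ℝ × ℝ → Y}
    (hg : ContDiffOn ℝ ∞ g U) (i : ℕ) : ∀ p ∈ U,
    deriv (fun s => iteratedDeriv i (fun r => g (s, r)) p.2) p.1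
      = iteratedDeriv i (fun r => deriv (fun s => g (s, r)) p.1) p.2 := by
  induction i with
  | zero => intro p _; simp
  | succ i ih =>
    intro p hp
    -- With h the i-th derivative in the second variable, the induction hypothesis turns the two
    -- sides into the mixed second derivatives of h, which agree by symmetry.
    let h : ℝ × ℝ → Y := fun p => iteratedDeriv i (fun r => g (p.1, r)) p.2
    have hh : ContDiffOn ℝ ∞ h U := contDiffOn_iteratedDeriv_param hU hg i
    have hat : ∀ p ∈ U, ContDiffAt ℝ ∞ h p := fun p hp => hh.contDiffAt (hU.mem_nhds hp)
    have hfst : ∀ p ∈ U, HasDerivAt (fun s => h (s, p.2)) (fderiv ℝ h p (1, 0)) p.1 := by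
      intro p hp
      exact HasFDerivAt.comp_hasDerivAt (x := p.1) (f := fun s : ℝ => (s, p.2))
        ((hat p hp).differentiableAt (by simp)).hasFDerivAt
        ((hasDerivAt_id _).prodMk (hasDerivAt_const _ _))
    have hsnd : ∀ p ∈ U, HasDerivAt (fun r => h (p.1, r)) (fderiv ℝ h p (0, 1)) p.2 := by
      intro p hp
      exact HasFDerivAt.comp_hasDerivAt (x := p.2) (f := fun r : ℝ => (p.1, r))
        ((hat p hp).differentiableAt (by simp)).hasFDerivAt
        ((hasDerivAt_const _ _).prodMk (hasDerivAt_id _))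
    have hd2 : DifferentiableAt ℝ (fderiv ℝ h) p :=
      ((hat p hp).fderiv_right (m := ∞) (by simp)).differentiableAt (by simp)
    have hsymm := (hat p hp).isSymmSndFDerivAt (by simpa using WithTop.coe_le_coe.2 (le_top : (2 : ℕ∞) ≤ ⊤))
    have ev1 : ∀ᶠ s in 𝓝 p.1, (s, p.2) ∈ U :=
      (Continuous.continuousAt (f := fun s : ℝ => (s, p.2)) (by fun_prop)).eventually
        (hU.mem_nhds hp)
    have ev2 : ∀ᶠ r in 𝓝 p.2, (p.1, r) ∈ U :=
      (Continuous.continuousAt (f := fun r : ℝ => (p.1, r)) (by fun_prop)).eventually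
        (hU.mem_nhds hp)
    have e1 : (fun s => iteratedDeriv (i + 1) (fun r => g (s, r)) p.2)
        =ᶠ[𝓝 p.1] fun s => fderiv ℝ h (s, p.2) (0, 1) := by
      filter_upwards [ev1] with s hs
      rw [iteratedDeriv_succ]
      exact (hsnd (s, p.2) hs).deriv
    have e2 : iteratedDeriv i (fun r => deriv (fun s => g (s, r)) p.1)
        =ᶠ[𝓝 p.2] fun r => fderiv ℝ h (p.1, r) (1, 0) := by
      filter_upwards [ev2] with r hr
      rw [← ih (p.1, r) hr]
      exact (hfst (p.1, r) hr).deriv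
    rw [e1.deriv_eq, iteratedDeriv_succ, e2.deriv_eq]
    have d1 : HasDerivAt (fun s => fderiv ℝ h (s, p.2) (0, 1))
        (fderiv ℝ (fderiv ℝ h) p (1, 0) (0, 1)) p.1 := by
      have := HasFDerivAt.comp_hasDerivAt (x := p.1) (f := fun s : ℝ => (s, p.2))
        (l := fderiv ℝ h) hd2.hasFDerivAt ((hasDerivAt_id _).prodMk (hasDerivAt_const _ _))
      exact this.clm_apply (hasDerivAt_const _ _) |>.congr_deriv (by simp)
    have d2 : HasDerivAt (fun r => fderiv ℝ h (p.1, r) (1, 0))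
        (fderiv ℝ (fderiv ℝ h) p (0, 1) (1, 0)) p.2 := by
      have := HasFDerivAt.comp_hasDerivAt (x := p.2) (f := fun r : ℝ => (p.1, r))
        (l := fderiv ℝ h) hd2.hasFDerivAt ((hasDerivAt_const _ _).prodMk (hasDerivAt_id _))
      exact this.clm_apply (hasDerivAt_const _ _) |>.congr_deriv (by simp)
    rw [d1.deriv, d2.deriv]
    exact hsymm _ _

variable {n : ℕ}

/-- The natural coordinates of the jet prolongation of a curve. -/
def jetCurve (m : ℕ) (q : ℝ → Fib n) (t : ℝ) : JetCoord n m := (t, derivs m q t)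

theorem contDiffAt_jetCurve (m : ℕ) {q : ℝ → Fib n} {t : ℝ} (h : ContDiffAt ℝ ∞ q t) :
    ContDiffAt ℝ ∞ (jetCurve m q) t :=
  contDiffAt_id.prodMk (contDiffAt_derivs m h)

theorem hasDerivAt_jetCurve {M N : ℕ} (h : N + 1 ≤ M) {q : ℝ → Fib n} {t : ℝ}
    (hq : ContDiffAt ℝ ∞ q t) :
    HasDerivAt (jetCurve N q) (1, shift (Fib n) h (derivs M q t)) t :=
  (hasDerivAt_id t).prodMk (hasDerivAt_derivs h hq)

theorem contDiff_truncCoord {M N : ℕ} (h : N ≤ M) :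
    ContDiff ℝ ∞ (truncCoord (n := n) N h) :=
  contDiff_fst.prodMk ((restr (Fib n) h).contDiff.comp contDiff_snd)

/-- The chain rule: the vector (1, q_1, q_2, …) in the definition of the total derivative is the
velocity of the prolonged curve. -/
theorem totalDeriv_jetCurve {m : ℕ} {F : JetCoord n m → G} {q : ℝ → Fib n} {t : ℝ}
    (hq : ContDiffAt ℝ ∞ q t) (hF : DifferentiableAt ℝ F (jetCurve m q t)) :
    totalDeriv F (jetCurve (m + 1) q t) = deriv (fun s => F (jetCurve m q s)) t :=
  (HasFDerivAt.comp_hasDerivAt t hF.hasFDerivAt (hasDerivAt_jetCurve le_rfl hq)).deriv.symm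

theorem contDiffOn_totalDeriv {m : ℕ} {F : JetCoord n m → G} {O : Set (JetCoord n m)}
    (hO : IsOpen O) (hF : ContDiffOn ℝ ∞ F O) :
    ContDiffOn ℝ ∞ (totalDeriv F) (truncCoord m (Nat.le_succ m) ⁻¹' O) := by
  have h1 : ContDiffOn ℝ ∞ (fun z : JetCoord n (m + 1) =>
      fderiv ℝ F (truncCoord m (Nat.le_succ m) z)) (truncCoord m (Nat.le_succ m) ⁻¹' O) :=
    (hF.fderiv_of_isOpen hO (by simp)).comp (contDiff_truncCoord _).contDiffOn fun z hz => hz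
  refine h1.clm_apply (ContDiff.contDiffOn ?_)
  exact contDiff_const.prodMk ((shift (Fib n) le_rfl).contDiff.comp contDiff_snd)

theorem contDiffOn_iterTotalDeriv {m : ℕ} {F : JetCoord n m → G} {O : Set (JetCoord n m)}
    (hO : IsOpen O) (hF : ContDiffOn ℝ ∞ F O) (i : ℕ) :
    ContDiffOn ℝ ∞ (iterTotalDeriv F i) (truncCoord m (Nat.le_add_right m i) ⁻¹' O) := by
  induction i with
  | zero => exact hF
  | succ i ih =>
    exact contDiffOn_totalDeriv (hO.preimage (contDiff_truncCoord _).continuous) ih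

theorem iterTotalDeriv_jetCurve {m : ℕ} {F : JetCoord n m → G} {O : Set (JetCoord n m)}
    (hO : IsOpen O) (hF : ContDiffOn ℝ ∞ F O) {q : ℝ → Fib n} (i : ℕ) : ∀ {t : ℝ},
    (∀ᶠ s in 𝓝 t, ContDiffAt ℝ ∞ q s) → jetCurve m q t ∈ O →
    iterTotalDeriv F i (jetCurve (m + i) q t)
      = iteratedDeriv i (fun s => F (jetCurve m q s)) t := by
  induction i with
  | zero => intro t _ _; rfl
  | succ i ih =>
    intro t hq ht
    have h1 : DifferentiableAt ℝ (iterTotalDeriv F i) (jetCurve (m + i) q t) :=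
      ((contDiffOn_iterTotalDeriv hO hF i).contDiffAt
        ((hO.preimage (contDiff_truncCoord _).continuous).mem_nhds ht)).differentiableAt (by simp)
    have h2 : totalDeriv (iterTotalDeriv F i) (jetCurve (m + i + 1) q t) = _ :=
      totalDeriv_jetCurve hq.self_of_nhds h1
    refine h2.trans ?_
    rw [iteratedDeriv_succ]
    refine Filter.EventuallyEq.deriv_eq ?_
    have hc : ContinuousAt (jetCurve m q) t :=
      (contDiffAt_jetCurve m hq.self_of_nhds).continuousAt
    filter_upwards [hq.eventually_nhds, hc.eventually (hO.mem_nhds ht)] with s hs hsO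
    exact ih hs hsO

end JetCalculus

/-! ### Algebra of the Ostrogradsky momenta and of the first variation -/

section Momenta

variable {Y G : Type*} [NormedAddCommGroup Y] [NormedSpace ℝ Y] [NormedAddCommGroup G]
  [NormedSpace ℝ G]

/-- The alternating sum `∑_{i < m} (-1)^i (d/dt)^i Λ_{r+i}`. -/
def altSum (Λ : ℕ → ℝ → G) (m r : ℕ) (t : ℝ) : G :=
  ∑ i ∈ Finset.range m, (-1 : ℝ) ^ i • iteratedDeriv i (Λ (r + i)) t

theorem contDiffAt_altSum {Λ : ℕ → ℝ → G} {t : ℝ} (h : ∀ r, ContDiffAt ℝ ∞ (Λ r) t) (m r : ℕ) :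
    ContDiffAt ℝ ∞ (altSum Λ m r) t := by
  refine ContDiffAt.sum fun i _ => ?_
  exact contDiffAt_const.smul (contDiffAt_iteratedDeriv (h _) i)

/-- Split off the term i = 0 and shift the index. With m = k − r terms starting at r + 1 the sum is
the momentum p^r, so this contains both the recursion p^r = ∂L/∂q_{r+1} − dp^{r+1}/dt and, for k + 1
terms starting at 0, the Euler–Lagrange expression ∂L/∂q_0 − dp^0/dt. -/
theorem altSum_succ {Λ : ℕ → ℝ → G} {t : ℝ} (h : ∀ r, ContDiffAt ℝ ∞ (Λ r) t) (m r : ℕ) :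
    altSum Λ (m + 1) r t = Λ r t - deriv (altSum Λ m (r + 1)) t := by
  have h1 : HasDerivAt (altSum Λ m (r + 1))
      (∑ i ∈ Finset.range m, (-1 : ℝ) ^ i • iteratedDeriv (i + 1) (Λ (r + 1 + i)) t) t :=
    HasDerivAt.fun_sum fun i _ => (hasDerivAt_iteratedDeriv (h _) i).const_smul ((-1 : ℝ) ^ i)
  rw [h1.deriv, altSum, Finset.sum_range_succ', sub_eq_add_neg, ← Finset.sum_neg_distrib, add_comm]
  congr 1
  · simp
  · refine Finset.sum_congr rfl fun i _ => ?_
    rw [pow_succ, mul_neg_one, neg_smul, show r + (i + 1) = r + 1 + i by omega]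

variable {k : ℕ}

/-- The components of a functional on tuples, indexed by all natural numbers. -/
def comps {N : ℕ} (Λ : (Fin N → Y) →L[ℝ] ℝ) (r : ℕ) : Y →L[ℝ] ℝ :=
  if h : r < N then Λ ∘L ContinuousLinearMap.single ℝ (fun _ => Y) ⟨r, h⟩ else 0

/-- The entries of a tuple, indexed by all natural numbers. -/
def entries {N : ℕ} (u : Fin N → Y) (r : ℕ) : Y := if h : r < N then u ⟨r, h⟩ else 0

theorem apply_eq_sum_comps {N : ℕ} (Λ : (Fin N → Y) →L[ℝ] ℝ) (u : Fin N → Y) :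
    Λ u = ∑ r ∈ Finset.range N, comps Λ r (entries u r) := by
  rw [← Fin.sum_univ_eq_sum_range]
  conv_lhs => rw [← Finset.univ_sum_single u, map_sum]
  refine Finset.sum_congr rfl fun i _ => ?_
  simp [comps, entries]

theorem comps_ext {N : ℕ} {Λ Λ' : (Fin N → Y) →L[ℝ] ℝ} (h : ∀ r < N, comps Λ r = comps Λ' r) :
    Λ = Λ' := by
  ext u
  rw [apply_eq_sum_comps, apply_eq_sum_comps]
  exact Finset.sum_congr rfl fun r hr => by rw [h r (Finset.mem_range.1 hr)]

theorem comps_apply {N : ℕ} (Λ : (Fin N → Y) →L[ℝ] ℝ) {r : ℕ} (h : r < N) (a : Y) :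
    comps Λ r a = Λ (Pi.single ⟨r, h⟩ a) := by
  simp [comps, h]

/-- `comps` as a linear map. -/
def compsL (Y : Type*) [NormedAddCommGroup Y] [NormedSpace ℝ Y] (N r : ℕ) :
    ((Fin N → Y) →L[ℝ] ℝ) →L[ℝ] (Y →L[ℝ] ℝ) :=
  if h : r < N then
    (ContinuousLinearMap.compL ℝ Y (Fin N → Y) ℝ).flip
      (ContinuousLinearMap.single ℝ (fun _ => Y) ⟨r, h⟩)
  else 0

theorem compsL_apply {N r : ℕ} (Λ : (Fin N → Y) →L[ℝ] ℝ) : compsL Y N r Λ = comps Λ r := by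
  unfold compsL comps
  split_ifs <;> rfl

theorem contDiffAt_comps {N : ℕ} {Λ : ℝ → (Fin N → Y) →L[ℝ] ℝ} {t : ℝ} (h : ContDiffAt ℝ ∞ Λ t)
    (r : ℕ) : ContDiffAt ℝ ∞ (fun s => comps (Λ s) r) t := by
  simp only [← compsL_apply]
  exact (compsL Y N r).contDiff.contDiffAt.comp t h

theorem deriv_comps {N : ℕ} {Λ : ℝ → (Fin N → Y) →L[ℝ] ℝ} {t : ℝ} (h : DifferentiableAt ℝ Λ t)
    (r : ℕ) : deriv (fun s => comps (Λ s) r) t = comps (deriv Λ t) r := by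
  simp only [← compsL_apply]
  exact ((compsL Y N r).hasFDerivAt.comp_hasDerivAt t h.hasDerivAt).deriv

/-- The first variation residual `∑_j (∂L/∂q_j - p^{j-1} - dp^j/dt) u_j` for the differential `dL`
of a Lagrangian, momenta `β` and their derivatives `β'`. -/
def elResidual [NeZero k] (dL : (Fin (k + 1) → Y) →L[ℝ] ℝ)
    (β β' : (Fin (k - 1 + 1) → Y) →L[ℝ] ℝ) : (Fin (2 * k - 1 + 1) → Y) →L[ℝ] ℝ :=
  dL ∘L restr Y (le_two_mul_sub_one k)
    - β ∘L shift Y (by have := NeZero.pos k; omega) - β' ∘L restr Y (by omega)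

theorem elResidual_apply [NeZero k] (dL : (Fin (k + 1) → Y) →L[ℝ] ℝ)
    (β β' : (Fin (k - 1 + 1) → Y) →L[ℝ] ℝ) (u : Fin (2 * k - 1 + 1) → Y) :
    elResidual dL β β' u = ∑ j ∈ Finset.range (k + 1), comps dL j (entries u j)
      - ∑ j ∈ Finset.range k, comps β j (entries u (j + 1))
      - ∑ j ∈ Finset.range k, comps β' j (entries u j) := by
  have hk := NeZero.pos k
  unfold elResidual
  simp only [sub_apply, ContinuousLinearMap.comp_apply]
  rw [apply_eq_sum_comps dL, apply_eq_sum_comps β, apply_eq_sum_comps β',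
    show Finset.range (k - 1 + 1) = Finset.range k by congr 1; omega]
  congr 1
  congr 1
  all_goals
    refine Finset.sum_congr rfl fun j hj => ?_
    have hj := Finset.mem_range.1 hj
    congr 1
    simp only [entries]
    rw [dif_pos (by omega), dif_pos (by omega)]
    rfl

/-- With Legendre-Ostrogradsky momenta, only the Euler-Lagrange term is left of the residual. -/
theorem elResidual_of_altSum [NeZero k] {Λ : ℝ → (Fin (k + 1) → Y) →L[ℝ] ℝ}
    {β : ℝ → (Fin (k - 1 + 1) → Y) →L[ℝ] ℝ} {t : ℝ} (hΛ : ContDiffAt ℝ ∞ Λ t)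
    (hβd : DifferentiableAt ℝ β t)
    (hβ : ∀ᶠ s in 𝓝 t, ∀ r < k, comps (β s) r = altSum (fun j s => comps (Λ s) j) (k - r) (r + 1) s)
    (u : Fin (2 * k - 1 + 1) → Y) :
    elResidual (Λ t) (β t) (deriv β t) u
      = altSum (fun j s => comps (Λ s) j) (k + 1) 0 t (u 0) := by
  have hk := NeZero.pos k
  have hΛc : ∀ r, ContDiffAt ℝ ∞ (fun s => comps (Λ s) r) t := contDiffAt_comps hΛ
  set a : ℕ → ℝ → Y →L[ℝ] ℝ := fun j s => comps (Λ s) j with ha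
  -- The momenta, continued to r = k, where the sum is empty; the value 0 there lets the recursion
  -- hold for r = k − 1 as well.
  let m : ℕ → ℝ → Y →L[ℝ] ℝ := fun r => altSum a (k - r) (r + 1)
  have h1 : ∀ r < k, comps (Λ t) (r + 1) = comps (β t) r + deriv (m (r + 1)) t := by
    intro r hr
    rw [hβ.self_of_nhds r hr, show k - r = k - (r + 1) + 1 by omega, altSum_succ hΛc]
    abel_nf
    simp [ha, m]
  have h2 : ∀ r < k, comps (deriv β t) r = deriv (m r) t := by
    intro r hr
    rw [← deriv_comps hβd]
    refine Filter.EventuallyEq.deriv_eq ?_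
    filter_upwards [hβ] with s hs using hs r hr
  have h3 : deriv (m k) t = 0 := by
    have : m k = fun _ => 0 := by
      funext s; simp [m, altSum]
    rw [this]; simp
  have h0 : entries u 0 = u 0 := by
    rw [entries, dif_pos (by omega)]; rfl
  rw [elResidual_apply, altSum_succ hΛc, Finset.sum_range_succ', ← h0]
  -- The sum of the terms (dp^j/dt) u_j over j ≤ k, split at its two ends. The term j = k is zero,
  -- so the shifted and the unshifted sums differ only by (dp^0/dt) u_0.
  have h4 := Finset.sum_range_succ' (fun j => deriv (m j) t (entries u j)) k
  rw [Finset.sum_range_succ, h3, zero_apply, add_zero] at h4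
  have h5 : ∑ j ∈ Finset.range k, comps (deriv β t) j (entries u j)
      = ∑ j ∈ Finset.range k, deriv (m j) t (entries u j) :=
    Finset.sum_congr rfl fun j hj => by rw [h2 j (Finset.mem_range.1 hj)]
  have h6 : ∑ j ∈ Finset.range k, comps (Λ t) (j + 1) (entries u (j + 1))
      = ∑ j ∈ Finset.range k, comps (β t) j (entries u (j + 1))
        + ∑ j ∈ Finset.range k, deriv (m (j + 1)) t (entries u (j + 1)) := by
    rw [← Finset.sum_add_distrib]
    refine Finset.sum_congr rfl fun j hj => ?_
    rw [h1 j (Finset.mem_range.1 hj), add_apply]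
  rw [h5, h6, h4, sub_apply]
  have h7 : m 0 = altSum a k (0 + 1) := rfl
  rw [h7]
  show _ = (comps (Λ t) 0) (entries u 0) - _
  ring

/-- If the residual vanishes, then the momenta are the Legendre-Ostrogradsky momenta, and the
Euler-Lagrange equations hold. -/
theorem altSum_eq_zero_of_elResidual [NeZero k] {Λ : ℝ → (Fin (k + 1) → Y) →L[ℝ] ℝ}
    {β : ℝ → (Fin (k - 1 + 1) → Y) →L[ℝ] ℝ} {t : ℝ} (hΛ : ∀ᶠ s in 𝓝 t, ContDiffAt ℝ ∞ Λ s)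
    (hβd : ∀ᶠ s in 𝓝 t, DifferentiableAt ℝ β s)
    (h : ∀ᶠ s in 𝓝 t, elResidual (Λ s) (β s) (deriv β s) = 0) :
    altSum (fun j s => comps (Λ s) j) (k + 1) 0 t = 0 := by
  have hk := NeZero.pos k
  -- Descending induction from r = k − 1. The component r + 1 of the residual reads ∂L/∂q_{r+1} −
  -- p^r − dp^{r+1}/dt = 0, without the last term when r = k − 1. The identities are kept on a
  -- neighbourhood because the following step differentiates them.
  have key : ∀ d, ∀ r, r + d + 1 = k →
      ∀ᶠ s in 𝓝 t, comps (β s) r = altSum (fun j s => comps (Λ s) j) (k - r) (r + 1) s := by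
    intro d
    induction d with
    | zero =>
      intro r hr
      filter_upwards [h, hΛ] with s hs hΛs
      ext a
      have h1 := congrArg (fun A => A (Pi.single ⟨r + 1, by omega⟩ a)) hs
      simp only [elResidual_apply, zero_apply] at h1
      have he : ∀ j, entries (Pi.single ⟨r + 1, by omega⟩ a : Fin (2 * k - 1 + 1) → Y) j
          = if j = r + 1 then a else 0 := by
        intro j
        unfold entries
        split_ifs with h2 h3 h3
        · subst h3; simp
        · rw [Pi.single_eq_of_ne]; simp [Fin.ext_iff, h3]
        · omega
        · rfl
      simp only [he, apply_ite, map_zero] at h1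
      have hj : ∀ j, (j + 1 = r + 1) = (j = r) := by intro j; simp
      simp only [hj, Finset.sum_ite_eq', Finset.mem_range] at h1
      rw [if_pos (by omega), if_pos (by omega), if_neg (by omega)] at h1
      rw [show k - r = 0 + 1 by omega, altSum_succ (contDiffAt_comps hΛs)]
      have : altSum (fun j s => comps (Λ s) j) 0 (r + 1 + 1) = fun _ => 0 := by
        funext s; simp [altSum]
      rw [this]
      simp
      linarith
    | succ d ih =>
      intro r hr
      have ih' := ih (r + 1) (by omega)
      filter_upwards [h, hΛ, ih'.eventually_nhds, hβd] with s hs hΛs ihs hβs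
      ext a
      have h1 := congrArg (fun A => A (Pi.single ⟨r + 1, by omega⟩ a)) hs
      simp only [elResidual_apply, zero_apply] at h1
      have he : ∀ j, entries (Pi.single ⟨r + 1, by omega⟩ a : Fin (2 * k - 1 + 1) → Y) j
          = if j = r + 1 then a else 0 := by
        intro j
        unfold entries
        split_ifs with h2 h3 h3
        · subst h3; simp
        · rw [Pi.single_eq_of_ne]; simp [Fin.ext_iff, h3]
        · omega
        · rfl
      simp only [he, apply_ite, map_zero] at h1
      have hj : ∀ j, (j + 1 = r + 1) = (j = r) := by intro j; simp
      simp only [hj, Finset.sum_ite_eq', Finset.mem_range] at h1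
      rw [if_pos (by omega), if_pos (by omega), if_pos (by omega)] at h1
      rw [show k - r = k - (r + 1) + 1 by omega, altSum_succ (contDiffAt_comps hΛs),
        ← Filter.EventuallyEq.deriv_eq ihs, deriv_comps hβs, sub_apply]
      linarith
  have hall : ∀ᶠ s in 𝓝 t, ∀ r < k,
      comps (β s) r = altSum (fun j s => comps (Λ s) j) (k - r) (r + 1) s := by
    have : ∀ r : Fin k, ∀ᶠ s in 𝓝 t,
        comps (β s) r = altSum (fun j s => comps (Λ s) j) (k - r) (r + 1) s :=
      fun r => key (k - r - 1) r (by omega)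
    filter_upwards [Filter.eventually_all.2 this] with s hs r hr using hs ⟨r, hr⟩
  ext a
  -- Once the momenta are identified, the residual sees only the entry of index 0, so any tuple
  -- starting with a will do.
  have h1 := elResidual_of_altSum hΛ.self_of_nhds hβd.self_of_nhds hall (fun _ => a)
  rw [h.self_of_nhds] at h1
  exact h1.symm

/-- A functional of the derivatives of curves up to order `N` whose total derivative is of order
zero vanishes. -/
theorem eventually_eq_zero_of_deriv_order_zero {N : ℕ} {C : ℝ → (Fin (N + 1) → Y) →L[ℝ] ℝ}
    {ε : ℝ → Y → ℝ} {t : ℝ} (hε : ∀ s, ε s 0 = 0) (hC : ∀ᶠ s in 𝓝 t, DifferentiableAt ℝ C s)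
    (h : ∀ᶠ s in 𝓝 t, ∀ η : ℝ → Y, ContDiff ℝ ∞ η →
      deriv (fun r => C r (derivs N η r)) s = ε s (η s)) : ∀ᶠ s in 𝓝 t, C s = 0 := by
  -- Taylor polynomials realise an arbitrary tuple of derivatives at s, one order higher than C
  -- takes, so the hypothesis becomes an identity in a free tuple u.
  have h1 : ∀ᶠ s in 𝓝 t, ∀ u : Fin (N + 1 + 1) → Y,
      deriv C s (restr Y (Nat.le_succ N) u) + C s (shift Y le_rfl u) = ε s (u 0) := by
    filter_upwards [h, hC] with s hs hCs u
    have hη := contDiff_taylorPoly_const s u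
    have h2 := hs _ hη
    rw [(hCs.hasDerivAt.clm_apply (hasDerivAt_derivs le_rfl hη.contDiffAt)).deriv,
      derivs_taylorPoly, ← restr_derivs (Nat.le_succ N), derivs_taylorPoly, taylorPoly_self] at h2
    exact h2
  -- A tuple concentrated at index r + 1 has zero entry at index 0, so the right-hand side vanishes
  -- and C_r = −dC_{r+1}/dt, with no right-hand side at the top order r = N. The vanishing thus
  -- descends from the top.
  have key : ∀ d r, r + d = N → ∀ᶠ s in 𝓝 t, comps (C s) r = 0 := by
    intro d
    induction d with
    | zero =>
      intro r hr
      filter_upwards [h1] with s hs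
      ext a
      have h2 := hs (Pi.single ⟨r + 1, by omega⟩ a)
      have e1 : restr Y (Nat.le_succ N) (Pi.single ⟨r + 1, by omega⟩ a) = 0 := by
        funext i
        show Pi.single (M := fun _ => Y) (⟨r + 1, _⟩ : Fin (N + 1 + 1)) a _ = 0
        rw [Pi.single_eq_of_ne]
        intro h3
        have h4 := congrArg Fin.val h3
        simp at h4
        omega
      have e2 : shift Y le_rfl (Pi.single (⟨r + 1, by omega⟩ : Fin (N + 1 + 1)) a)
          = Pi.single (⟨r, by omega⟩ : Fin (N + 1)) a := by
        funext i
        show Pi.single (M := fun _ => Y) (⟨r + 1, _⟩ : Fin (N + 1 + 1)) a ⟨i + 1, _⟩ = _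
        simp [Pi.single_apply, Fin.ext_iff]
      have e3 : (Pi.single (⟨r + 1, by omega⟩ : Fin (N + 1 + 1)) a : Fin (N + 1 + 1) → Y) 0 = 0 := by
        rw [Pi.single_eq_of_ne]; simp [Fin.ext_iff]
      rw [e1, e2, e3, hε, map_zero, zero_add] at h2
      rw [comps_apply _ (by omega), h2]
      rfl
    | succ d ih =>
      intro r hr
      filter_upwards [h1, (ih (r + 1) (by omega)).eventually_nhds, hC] with s hs ihs hCs
      ext a
      have h2 := hs (Pi.single ⟨r + 1, by omega⟩ a)
      have e1 : restr Y (Nat.le_succ N) (Pi.single ⟨r + 1, by omega⟩ a)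
          = Pi.single (⟨r + 1, by omega⟩ : Fin (N + 1)) a := by
        funext i
        show Pi.single (M := fun _ => Y) (⟨r + 1, _⟩ : Fin (N + 1 + 1)) a (Fin.castLE _ i) = _
        simp [Pi.single_apply, Fin.ext_iff]
      have e2 : shift Y le_rfl (Pi.single (⟨r + 1, by omega⟩ : Fin (N + 1 + 1)) a)
          = Pi.single (⟨r, by omega⟩ : Fin (N + 1)) a := by
        funext i
        show Pi.single (M := fun _ => Y) (⟨r + 1, _⟩ : Fin (N + 1 + 1)) a ⟨i + 1, _⟩ = _
        simp [Pi.single_apply, Fin.ext_iff]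
      have e3 : (Pi.single (⟨r + 1, by omega⟩ : Fin (N + 1 + 1)) a : Fin (N + 1 + 1) → Y) 0 = 0 := by
        rw [Pi.single_eq_of_ne]; simp [Fin.ext_iff]
      have e4 : comps (deriv C s) (r + 1) = 0 := by
        rw [← deriv_comps hCs, Filter.EventuallyEq.deriv_eq (f := fun _ => 0) ihs]
        simp
      rw [e1, e2, e3, hε, ← comps_apply _ (by omega), e4, zero_apply,
        zero_add] at h2
      rw [comps_apply _ (by omega), h2]
      rfl
  have : ∀ r : Fin (N + 1), ∀ᶠ s in 𝓝 t, comps (C s) r = 0 := fun r => key (N - r) r (by omega)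
  filter_upwards [Filter.eventually_all.2 this] with s hs
  refine comps_ext fun r hr => ?_
  rw [hs ⟨r, hr⟩]
  unfold comps
  split_ifs
  simp

end Momenta

/-! ### Smoothness in jet and momentum bundles; the form Θ_r along curves -/

section Prolong

variable {n : ℕ} {E : Type u} [TopologicalSpace E] [ChartedSpace (ℝ × Fib n) E]
  {π : FibreBundle n E}

theorem prolong_base {m r : ℕ} (h : r ≤ m) (y : Jet π m) :
    y.rep.prolong r y.base = y.proj r h := by
  unfold LocalSection.prolong
  rw [dif_pos ⟨y.rep.smooth, y.rep.isSection⟩]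
  rfl

end Prolong

section JetManifold

variable {n : ℕ} {E : Type u} [TopologicalSpace E] [ChartedSpace (ℝ × Fib n) E]
  {π : FibreBundle n E} [IsManifold 𝓘(ℝ, ℝ × Fib n) ∞ E]
  {e : OpenPartialHomeomorph E (ℝ × Fib n)}

theorem contMDiffOn_jetHomeo (he : IsAdapted π e) {m : ℕ} (y₀ : Jet π m) :
    ContMDiffOn 𝓘(ℝ, JetCoord n m) 𝓘(ℝ, JetCoord n m) ∞ (jetHomeo he y₀) (jetHomeo he y₀).source :=
  contMDiffOn_of_mem_maximalAtlas
    (IsManifold.subset_maximalAtlas (jetHomeo_mem_atlas he y₀))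

theorem contMDiffOn_jetHomeo_symm (he : IsAdapted π e) {m : ℕ} (y₀ : Jet π m) :
    ContMDiffOn 𝓘(ℝ, JetCoord n m) 𝓘(ℝ, JetCoord n m) ∞ (jetHomeo he y₀).symm
      (jetHomeo he y₀).target :=
  contMDiffOn_symm_of_mem_maximalAtlas
    (IsManifold.subset_maximalAtlas (jetHomeo_mem_atlas he y₀))

theorem contMDiffAt_jetCoord (he : IsAdapted π e) {m : ℕ} {y : Jet π m} (hy : y.pt ∈ e.source) :
    ContMDiffAt 𝓘(ℝ, JetCoord n m) 𝓘(ℝ, JetCoord n m) ∞ (jetCoord e m) y :=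
  (contMDiffOn_jetHomeo he y).contMDiffAt ((jetHomeo he y).open_source.mem_nhds hy)

theorem continuous_jet_pt {m : ℕ} : Continuous (Jet.pt : Jet π m → E) := by
  rw [continuous_iff_continuousAt]
  intro y
  have he := chartE_adapted (π := π) y.pt
  have hy := mem_chartE_source (π := π) y.pt
  set e := chartE π y.pt
  have h1 : ContinuousAt (fun y' : Jet π m =>
      e.symm ((jetCoord e m y').1, (jetCoord e m y').2 0)) y := by
    have h2 : ContinuousAt (jetCoord e m) y := (contMDiffAt_jetCoord he hy).continuousAt
    have h3 : ContinuousAt (fun y' : Jet π m =>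
        ((jetCoord e m y').1, (jetCoord e m y').2 0)) y :=
      ContinuousAt.comp (g := fun z : JetCoord n m => (z.1, z.2 0))
        (Continuous.continuousAt (by fun_prop)) h2
    refine ContinuousAt.comp (g := e.symm) ?_ h3
    rw [jetCoord_fst he y hy]
    exact e.continuousAt_symm (e.map_source hy)
  refine h1.congr ?_
  filter_upwards [(jetHomeo he y).open_source.mem_nhds hy] with y' hy'
  have hy'' : y'.pt ∈ e.source := hy'
  rw [jetCoord_fst he y' hy'', e.left_inv hy'']

section Criterion

variable {X H N : Type*} [NormedAddCommGroup X] [NormedSpace ℝ X] [TopologicalSpace H]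
  {I : ModelWithCorners ℝ X H} [TopologicalSpace N] [ChartedSpace H N]

/-- A map into a jet manifold is smooth if its natural coordinates are smooth. -/
theorem contMDiffAt_jet_of_coord (he : IsAdapted π e) {m : ℕ} {f : N → Jet π m} {x : N}
    (hs : ∀ᶠ x' in 𝓝 x, (f x').pt ∈ e.source)
    (hc : ContMDiffAt I 𝓘(ℝ, JetCoord n m) ∞ (fun x' => jetCoord e m (f x')) x) :
    ContMDiffAt I 𝓘(ℝ, JetCoord n m) ∞ f x := by
  have ht : jetCoord e m (f x) ∈ (jetHomeo he (f x)).target :=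
    (jetHomeo he (f x)).map_source hs.self_of_nhds
  have h1 := ContMDiffAt.comp (g := (jetHomeo he (f x)).symm)
    (f := fun x' => jetCoord e m (f x')) x
    ((contMDiffOn_jetHomeo_symm he (f x)).contMDiffAt
      ((jetHomeo he (f x)).open_target.mem_nhds ht)) hc
  refine h1.congr_of_eventuallyEq ?_
  filter_upwards [hs] with x' hx'
  exact ((jetHomeo he (f x)).left_inv (x := f x') hx').symm

end Criterion

theorem contMDiff_jet_base {m : ℕ} :
    ContMDiff 𝓘(ℝ, JetCoord n m) 𝓘(ℝ, ℝ) ∞ (Jet.base : Jet π m → ℝ) := by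
  intro y
  have he := chartE_adapted (π := π) y.pt
  have hy := mem_chartE_source (π := π) y.pt
  exact ContMDiffAt.comp (g := (Prod.fst : JetCoord n m → ℝ)) y
    contDiff_fst.contMDiff.contMDiffAt (contMDiffAt_jetCoord he hy)

theorem contMDiff_jet_proj {m r : ℕ} (h : r ≤ m) :
    ContMDiff 𝓘(ℝ, JetCoord n m) 𝓘(ℝ, JetCoord n r) ∞ (Jet.proj r h : Jet π m → Jet π r) := by
  intro y
  have he := chartE_adapted (π := π) y.pt
  have hy := mem_chartE_source (π := π) y.pt
  set e := chartE π y.pt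
  have hs : ∀ᶠ y' : Jet π m in 𝓝 y, y'.pt ∈ e.source :=
    (continuous_jet_pt.tendsto y).eventually (e.open_source.mem_nhds hy)
  refine contMDiffAt_jet_of_coord he ?_ ?_
  · filter_upwards [hs] with y' hy'
    rwa [proj_pt]
  · have h1 := ContMDiffAt.comp (g := truncCoord r h) y
      (contDiff_truncCoord (n := n) h).contMDiff.contMDiffAt (contMDiffAt_jetCoord he hy)
    refine h1.congr_of_eventuallyEq ?_
    filter_upwards [hs] with y' hy'
    exact jetCoord_proj he r h y' hy'

/-- Natural charts of `W_r`, as homeomorphisms. -/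
def phaseHomeo (he : IsAdapted π e) {k : ℕ} (w₀ : Phase π k) :
    OpenPartialHomeomorph (Phase π k) (PhaseCoord n k) :=
  (phaseCore π k).openPartialHomeomorph (phaseChart he w₀) ⟨e, he, w₀, rfl⟩

theorem phaseHomeo_mem_atlas (he : IsAdapted π e) {k : ℕ} (w₀ : Phase π k) :
    phaseHomeo he w₀ ∈ atlas (PhaseCoord n k) (Phase π k) :=
  mem_iUnion.2 ⟨phaseChart he w₀, mem_iUnion.2 ⟨⟨e, he, w₀, rfl⟩, rfl⟩⟩

theorem contMDiffOn_phaseHomeo (he : IsAdapted π e) {k : ℕ} (w₀ : Phase π k) :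
    ContMDiffOn 𝓘(ℝ, PhaseCoord n k) 𝓘(ℝ, PhaseCoord n k) ∞ (phaseHomeo he w₀)
      (phaseHomeo he w₀).source :=
  contMDiffOn_of_mem_maximalAtlas
    (IsManifold.subset_maximalAtlas (phaseHomeo_mem_atlas he w₀))

theorem contMDiffOn_phaseHomeo_symm (he : IsAdapted π e) {k : ℕ} (w₀ : Phase π k) :
    ContMDiffOn 𝓘(ℝ, PhaseCoord n k) 𝓘(ℝ, PhaseCoord n k) ∞ (phaseHomeo he w₀).symm
      (phaseHomeo he w₀).target :=
  contMDiffOn_symm_of_mem_maximalAtlas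
    (IsManifold.subset_maximalAtlas (phaseHomeo_mem_atlas he w₀))

/-- The natural coordinates on `W_r`. -/
def phaseCoord (e : OpenPartialHomeomorph E (ℝ × Fib n)) {k : ℕ} (w : Phase π k) :
    PhaseCoord n k := (jetCoord e _ w.jet, momCoord e w.mom)

theorem contMDiffAt_phaseCoord (he : IsAdapted π e) {k : ℕ} {w : Phase π k}
    (hw : w.jet.pt ∈ e.source) :
    ContMDiffAt 𝓘(ℝ, PhaseCoord n k) 𝓘(ℝ, PhaseCoord n k) ∞ (phaseCoord e) w :=
  (contMDiffOn_phaseHomeo he w).contMDiffAt ((phaseHomeo he w).open_source.mem_nhds hw)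

theorem contMDiff_phase_jet {k : ℕ} :
    ContMDiff 𝓘(ℝ, PhaseCoord n k) 𝓘(ℝ, JetCoord n (2 * k - 1)) ∞
      (Phase.jet : Phase π k → Jet π (2 * k - 1)) := by
  intro w
  have he := chartE_adapted (π := π) w.jet.pt
  have hw := mem_chartE_source (π := π) w.jet.pt
  refine contMDiffAt_jet_of_coord he ?_ ?_
  · exact (phaseHomeo he w).open_source.mem_nhds hw
  · exact ContMDiffAt.comp (g := (Prod.fst : PhaseCoord n k → _)) w
      contDiff_fst.contMDiff.contMDiffAt (contMDiffAt_phaseCoord he hw)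

theorem continuous_phase_pt {k : ℕ} : Continuous fun w : Phase π k => w.jet.pt :=
  continuous_jet_pt.comp contMDiff_phase_jet.continuous

theorem contMDiff_phase_base {k : ℕ} :
    ContMDiff 𝓘(ℝ, PhaseCoord n k) 𝓘(ℝ, ℝ) ∞ (Phase.base : Phase π k → ℝ) :=
  contMDiff_jet_base.comp contMDiff_phase_jet

theorem contMDiff_phase_toJet {k : ℕ} :
    ContMDiff 𝓘(ℝ, PhaseCoord n k) 𝓘(ℝ, JetCoord n (k - 1)) ∞
      (Phase.toJet : Phase π k → Jet π (k - 1)) :=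
  (contMDiff_jet_proj _).comp contMDiff_phase_jet

/-- Points over the same point of E share a natural chart and are separated there; the others are
separated already in E. Hausdorffness is what makes compact supports closed and integral curves
unique. -/
instance {k : ℕ} [T2Space E] : T2Space (Phase π k) := by
  refine ⟨fun w w' hne => ?_⟩
  by_cases hp : w.jet.pt = w'.jet.pt
  · have he := chartE_adapted (π := π) w.jet.pt
    have hw := mem_chartE_source (π := π) w.jet.pt
    set c := phaseHomeo he w
    have h1 : w ∈ c.source := hw
    have h2 : w' ∈ c.source := by
      show w'.jet.pt ∈ (chartE π w.jet.pt).source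
      rw [← hp]; exact hw
    obtain ⟨U, U', hU, hU', hwU, hwU', hd⟩ := t2_separation fun h => hne (c.injOn h1 h2 h)
    exact ⟨c.source ∩ c ⁻¹' U, c.source ∩ c ⁻¹' U', c.isOpen_inter_preimage hU,
      c.isOpen_inter_preimage hU', ⟨h1, hwU⟩, ⟨h2, hwU'⟩,
      (hd.preimage c).mono inter_subset_right inter_subset_right⟩
  · obtain ⟨U, U', hU, hU', hwU, hwU', hd⟩ := t2_separation hp
    exact ⟨_, _, hU.preimage continuous_phase_pt, hU'.preimage continuous_phase_pt, hwU, hwU',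
      hd.preimage _⟩

section Criterion

variable {X H N : Type*} [NormedAddCommGroup X] [NormedSpace ℝ X] [TopologicalSpace H]
  {I : ModelWithCorners ℝ X H} [TopologicalSpace N] [ChartedSpace H N]

/-- A map into `W_r` is smooth if its natural coordinates are smooth. -/
theorem contMDiffAt_phase_of_coord (he : IsAdapted π e) {k : ℕ} {f : N → Phase π k} {x : N}
    (hs : ∀ᶠ x' in 𝓝 x, (f x').jet.pt ∈ e.source)
    (hc : ContMDiffAt I 𝓘(ℝ, PhaseCoord n k) ∞ (fun x' => phaseCoord e (f x')) x) :
    ContMDiffAt I 𝓘(ℝ, PhaseCoord n k) ∞ f x := by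
  have ht : phaseCoord e (f x) ∈ (phaseHomeo he (f x)).target :=
    (phaseHomeo he (f x)).map_source hs.self_of_nhds
  have h1 := ContMDiffAt.comp (g := (phaseHomeo he (f x)).symm)
    (f := fun x' => phaseCoord e (f x')) x
    ((contMDiffOn_phaseHomeo_symm he (f x)).contMDiffAt
      ((phaseHomeo he (f x)).open_target.mem_nhds ht)) hc
  refine h1.congr_of_eventuallyEq ?_
  filter_upwards [hs] with x' hx'
  exact ((phaseHomeo he (f x)).left_inv (x := f x') hx').symm

end Criterion

/-- The natural coordinates of the velocity of a curve of jets. -/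
theorem jetCoordDeriv_mfderiv (he : IsAdapted π e) {m : ℕ} {f : ℝ → Jet π m} {t : ℝ}
    (hf : MDifferentiableAt 𝓘(ℝ, ℝ) 𝓘(ℝ, JetCoord n m) f t) (hs : (f t).pt ∈ e.source) :
    HasDerivAt (fun s => jetCoord e m (f s))
      (jetCoordDeriv e (f t) (mfderiv 𝓘(ℝ, ℝ) 𝓘(ℝ, JetCoord n m) f t (1 : ℝ))) t := by
  have h1 := (mdifferentiableAt_jetCoord he (f t) hs).hasMFDerivAt.comp t hf.hasMFDerivAt
  have h2 : HasFDerivAt (fun s => jetCoord e m (f s)) ((jetCoordDeriv e (f t) :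
      JetCoord n m →L[ℝ] JetCoord n m) ∘L (mfderiv 𝓘(ℝ, ℝ) 𝓘(ℝ, JetCoord n m) f t :
      ℝ →L[ℝ] JetCoord n m)) t := hasMFDerivAt_iff_hasFDerivAt.1 h1
  exact h2.hasDerivAt

/-- The velocity of the r-th prolongation involves derivatives up to order r + 1 ≤ m only, so the
jet determines it and the chosen representative is immaterial. -/
theorem jetCoordDeriv_velocity (he : IsAdapted π e) {m r : ℕ} (h : r + 1 ≤ m) (y : Jet π m)
    (hy : y.pt ∈ e.source) :
    jetCoordDeriv e (y.proj r (Nat.le_of_succ_le h)) (y.velocity r (Nat.le_of_succ_le h))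
      = ((1 : ℝ), shift (Fib n) h (jetCoord e m y).2) := by
  set f := y.rep with hf
  let q : ℝ → Fib n := fun s => (e (f.map s)).2
  have hsm := f.smooth_chart he.contMDiffOn hy
  have hq : ContDiffAt ℝ ∞ q f.base := hsm.1.self_of_nhds.snd
  have hev : ∀ᶠ s in 𝓝 f.base, (f.prolong r s).pt ∈ e.source ∧
      jetCoord e r (f.prolong r s) = jetCurve r q s := by
    filter_upwards [f.smooth.eventually_nhds, f.isSection.eventually_nhds, hsm.2] with s h1 h2 h3
    unfold LocalSection.prolong
    rw [dif_pos ⟨h1, h2⟩, Jet.pt_jet, jetCoord_jet he r _ h3]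
    exact ⟨h3, rfl⟩
  have hsmooth : ContMDiffAt 𝓘(ℝ, ℝ) 𝓘(ℝ, JetCoord n r) ∞ (f.prolong r) f.base :=
    contMDiffAt_jet_of_coord he (hev.mono fun s hs => hs.1)
      ((contDiffAt_jetCurve r hq).contMDiffAt.congr_of_eventuallyEq (hev.mono fun s hs => hs.2))
  have h1 := jetCoordDeriv_mfderiv he (hsmooth.mdifferentiableAt (by simp)) hev.self_of_nhds.1
  have h2 := (hasDerivAt_jetCurve h hq).congr_of_eventuallyEq (hev.mono fun s hs => hs.2)
  have h3 := h1.unique h2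
  -- The two base jets are equal, but not by definition; vectors are regarded in the model space in
  -- order to move along this equality.
  have key : ∀ (y' : Jet π r) (v : JetCoord n r), f.prolong r f.base = y' →
      (jetCoordDeriv e (f.prolong r f.base) : JetCoord n r →L[ℝ] JetCoord n r) v
        = (jetCoordDeriv e y' : JetCoord n r →L[ℝ] JetCoord n r) v := by
    rintro y' v rfl; rfl
  exact (key _ _ (prolong_base _ y)).symm.trans h3

/-- A covector given modulo dt has a well-defined value exactly on vectors annihilated by dt, and
the momenta compute it. It is applied to the difference of two velocities over the same instant and
to infinitesimal vertical variations. -/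
theorem rep_eq_momCoord (he : IsAdapted π e) {m : ℕ} {y : Jet π m} (hy : y.pt ∈ e.source)
    (p : RedCot y) {u : TangentSpace 𝓘(ℝ, JetCoord n m) y}
    (hu : (jetCoordDeriv e y u).1 = 0) : p.rep u = momCoord e p (jetCoordDeriv e y u).2 := by
  have h1 : u = (jetCoordDeriv e y).inverse (jetCoordDeriv e y u) :=
    ((jetCoordDeriv_isInvertible he y hy).inverse_apply_self _).symm
  conv_lhs => rw [h1]
  have h2 : jetCoordDeriv e y u = ((0 : ℝ), (jetCoordDeriv e y u).2) := Prod.ext hu rfl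
  rw [h2]
  rfl

variable {k : ℕ} [NeZero k]

theorem pred_succ_le (k : ℕ) [NeZero k] : k - 1 + 1 ≤ 2 * k - 1 := by
  have := NeZero.pos k; omega

/-- The pull-back of `Θ_r` by a curve, in natural coordinates:
`L + p^i (dq_i/dt - q_{i+1})`. -/
theorem pullCurve_thetaR (L : Jet π k → ℝ) (he : IsAdapted π e) {γ : ℝ → Phase π k} {t : ℝ}
    (hγ : MDifferentiableAt 𝓘(ℝ, ℝ) 𝓘(ℝ, PhaseCoord n k) γ t) (hs : (γ t).jet.pt ∈ e.source)
    (hb : ∀ᶠ r in 𝓝 t, (γ r).base = r) :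
    pullCurve (thetaR L) γ t = lagrHat L (γ t).jet + momCoord e (γ t).mom
      (restr (Fib n) (by omega) (deriv (fun r => (phaseCoord e (γ r)).1.2) t)
        - shift (Fib n) (pred_succ_le k) (phaseCoord e (γ t)).1.2) := by
  have hw := (contMDiff_phase_toJet (π := π) (k := k) (γ t)).mdifferentiableAt (by simp)
  have hf := hw.comp t hγ
  have hpt : (γ t).toJet.pt ∈ e.source := by
    unfold Phase.toJet; rwa [proj_pt]
  have hev : ∀ᶠ r in 𝓝 t, (γ r).jet.pt ∈ e.source :=
    ((continuous_phase_pt.tendsto _).comp hγ.continuousAt).eventually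
      (e.open_source.mem_nhds hs)
  set u : TangentSpace 𝓘(ℝ, JetCoord n (k - 1)) (γ t).toJet :=
    mfderiv 𝓘(ℝ, PhaseCoord n k) 𝓘(ℝ, JetCoord n (k - 1)) Phase.toJet (γ t)
      (mfderiv 𝓘(ℝ, ℝ) 𝓘(ℝ, PhaseCoord n k) γ t (1 : ℝ)) with hu
  have hu2 : mfderiv 𝓘(ℝ, ℝ) 𝓘(ℝ, JetCoord n (k - 1)) (Phase.toJet ∘ γ) t (1 : ℝ) = u := by
    rw [mfderiv_comp t hw hγ]; rfl
  have hQd : DifferentiableAt ℝ (fun r => phaseCoord e (γ r)) t :=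
    mdifferentiableAt_iff_differentiableAt.1
      (((contMDiffAt_phaseCoord he hs).mdifferentiableAt (by simp)).comp t hγ)
  have hQ2 : HasDerivAt (fun r => (phaseCoord e (γ r)).1.2)
      (deriv (fun r => (phaseCoord e (γ r)).1.2) t) t := (hQd.fst.snd).hasDerivAt
  have hcoord : (fun r => jetCoord e (k - 1) ((Phase.toJet ∘ γ) r)) =ᶠ[𝓝 t]
      fun r => (r, restr (Fib n) (by omega : k - 1 ≤ 2 * k - 1) (phaseCoord e (γ r)).1.2) := by
    filter_upwards [hev, hb] with r hr hrb
    show jetCoord e (k - 1) ((γ r).jet.proj (k - 1) (by omega)) = _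
    rw [jetCoord_proj he _ _ _ hr]
    exact Prod.ext hrb rfl
  have hderiv := (((hasDerivAt_id t).prodMk
    ((restr (Fib n) (by omega : k - 1 ≤ 2 * k - 1)).hasFDerivAt.comp_hasDerivAt t hQ2)
      ).congr_of_eventuallyEq hcoord)
  have hju : jetCoordDeriv e (γ t).toJet u
      = ((1 : ℝ), restr (Fib n) (by omega) (deriv (fun r => (phaseCoord e (γ r)).1.2) t)) := by
    rw [← hu2]
    exact (jetCoordDeriv_mfderiv he hf hpt).unique hderiv
  set y := (γ t).jet
  set vel : TangentSpace 𝓘(ℝ, JetCoord n (k - 1)) (γ t).toJet := y.velocity (k - 1) (by omega)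
    with hvel
  have hjv : jetCoordDeriv e (γ t).toJet vel
      = ((1 : ℝ), shift (Fib n) (pred_succ_le k) (phaseCoord e (γ t)).1.2) :=
    jetCoordDeriv_velocity he (pred_succ_le k) y hs
  have hdt : Jet.dt (γ t).toJet u = 1 := by
    rw [dt_eq he _ hpt]
    exact congrArg Prod.fst hju
  -- The velocity of the curve and the holonomic velocity both have dt-component 1. Their difference
  -- is vertical, and the representative of the momentum class drops out.
  have hsub : jetCoordDeriv e (γ t).toJet (u - vel) = ((0 : ℝ),
      restr (Fib n) (by omega) (deriv (fun r => (phaseCoord e (γ r)).1.2) t)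
        - shift (Fib n) (pred_succ_le k) (phaseCoord e (γ t)).1.2) := by
    rw [map_sub, hju, hjv]
    exact Prod.ext (sub_self _) rfl
  have hfin := rep_eq_momCoord he hpt (γ t).mom (u := u - vel) (congrArg Prod.fst hsub)
  rw [hsub, map_sub] at hfin
  show (γ t).mom.rep u + (lagrHat L y - (γ t).mom.rep vel) * Jet.dt (γ t).toJet u = _
  rw [hdt]
  show _ = lagrHat L y + momCoord e (γ t).mom ((0 : ℝ),
      restr (Fib n) (by omega) (deriv (fun r => (phaseCoord e (γ r)).1.2) t)
        - shift (Fib n) (pred_succ_le k) (phaseCoord e (γ t)).1.2).2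
  refine Eq.trans ?_ (congrArg (fun a => lagrHat L y + a) hfin)
  have aux : ∀ a b c : ℝ, a + (c - b) * 1 = c + (a - b) := fun a b c => by ring
  exact aux _ _ _

end JetManifold

/-! ### The Legendre–Ostrogradsky map: coordinate independence and smoothness -/

section Transition

variable {n : ℕ} {E : Type u} [TopologicalSpace E] [ChartedSpace (ℝ × Fib n) E]
  {π : FibreBundle n E} {e e' : OpenPartialHomeomorph E (ℝ × Fib n)}

/-- The vertical change of adapted coordinates. -/
def fibTrans (e e' : OpenPartialHomeomorph E (ℝ × Fib n)) (p : ℝ × Fib n) : Fib n :=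
  (e' (e.symm p)).2

theorem contDiffAt_fibTrans (he : IsAdapted π e) (he' : IsAdapted π e') {p : ℝ × Fib n}
    (hp : p ∈ e.target) (hp' : e.symm p ∈ e'.source) : ContDiffAt ℝ ∞ (fibTrans e e') p := by
  have h := comp_symm_smooth he.contMDiffOn_symm he'.contMDiffOn (e.map_target hp) hp'
  rw [e.right_inv hp] at h
  exact h.self_of_nhds.snd

end Transition

theorem eventually_mem_target {Y X : Type*} [NormedAddCommGroup Y] [TopologicalSpace X]
    {e : OpenPartialHomeomorph X (ℝ × Y)} {q : ℝ → Y} {t : ℝ} (hq : ContinuousAt q t)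
    (ht : (t, q t) ∈ e.target) : ∀ᶠ s in 𝓝 t, (s, q s) ∈ e.target :=
  (continuousAt_id.prodMk hq).eventually (e.open_target.mem_nhds ht)

section Legendre

variable {n : ℕ} {E : Type u} [TopologicalSpace E] [ChartedSpace (ℝ × Fib n) E]
  {π : FibreBundle n E} [IsManifold 𝓘(ℝ, ℝ × Fib n) ∞ E]
  {e e' : OpenPartialHomeomorph E (ℝ × Fib n)}

/-- The local section `s ↦ e⁻¹(s, q(s))`. -/
def curveSection (he : IsAdapted π e) {q : ℝ → Fib n} {t : ℝ}
    (hq : ∀ᶠ s in 𝓝 t, ContDiffAt ℝ ∞ q s) (ht : (t, q t) ∈ e.target) : LocalSection π where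
  base := t
  map := fun s => e.symm (s, q s)
  smooth := by
    have hc : ContinuousAt (fun s => (s, q s)) t :=
      continuousAt_id.prodMk hq.self_of_nhds.continuousAt
    filter_upwards [hq, hc.eventually (e.open_target.mem_nhds ht)] with s hs hst
    exact ContMDiffAt.comp (g := e.symm) (f := fun s : ℝ => (s, q s)) s
      (he.contMDiffOn_symm.contMDiffAt (e.open_target.mem_nhds hst))
      (contDiffAt_id.prodMk hs).contMDiffAt
  isSection := by
    have hc : ContinuousAt (fun s => (s, q s)) t :=
      continuousAt_id.prodMk hq.self_of_nhds.continuousAt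
    filter_upwards [hc.eventually (e.open_target.mem_nhds ht)] with s hs
    rw [← he.fst_eq _ (e.map_target hs), e.right_inv hs]

theorem jetCoord_curveSection (he : IsAdapted π e) {q : ℝ → Fib n} {t : ℝ}
    (hq : ∀ᶠ s in 𝓝 t, ContDiffAt ℝ ∞ q s) (ht : (t, q t) ∈ e.target) (m : ℕ) :
    jetCoord e m ((curveSection he hq ht).jet m) = jetCurve m q t := by
  rw [jetCoord_jet he m _ (e.map_target ht)]
  refine Prod.ext rfl (funext fun i => Filter.EventuallyEq.iteratedDeriv_eq _ ?_)
  have hc : ContinuousAt (fun s => (s, q s)) t :=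
    continuousAt_id.prodMk hq.self_of_nhds.continuousAt
  filter_upwards [hc.eventually (e.open_target.mem_nhds ht)] with s hs
  show (e (e.symm (s, q s))).2 = q s
  rw [e.right_inv hs]

theorem jetChart_symm_jetCoord (he : IsAdapted π e) {m : ℕ} (y₀ y : Jet π m)
    (hy : y.pt ∈ e.source) : (jetChart he y₀).symm (jetCoord e m y) = y :=
  (jetChart he y₀).left_inv hy

theorem isOpen_jetChart_target (he : IsAdapted π e) {m : ℕ} (y₀ : Jet π m) :
    IsOpen (jetChart he y₀).target := (jetHomeo he y₀).open_target

theorem jetCurve_mem_target (he : IsAdapted π e) {m : ℕ} (y₀ : Jet π m) {q : ℝ → Fib n} {t : ℝ}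
    (ht : (t, q t) ∈ e.target) : jetCurve m q t ∈ (jetChart he y₀).target := by
  show (t, iteratedDeriv 0 q t) ∈ e.target
  rwa [iteratedDeriv_zero]

/-- The transition maps of natural coordinates on prolongations of curves. -/
theorem jetTrans_jetCurve (he : IsAdapted π e) (he' : IsAdapted π e') {m : ℕ} (y₀ y₀' : Jet π m)
    {q : ℝ → Fib n} {t : ℝ} (hq : ∀ᶠ s in 𝓝 t, ContDiffAt ℝ ∞ q s) (ht : (t, q t) ∈ e.target)
    (ht' : e.symm (t, q t) ∈ e'.source) :
    ((jetChart he y₀).symm.trans (jetChart he' y₀')) (jetCurve m q t)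
      = jetCurve m (fun s => fibTrans e e' (s, q s)) t := by
  have h1 : (jetChart he y₀).symm (jetCurve m q t) = (curveSection he hq ht).jet m := by
    rw [← jetCoord_curveSection he hq ht m]
    refine jetChart_symm_jetCoord he _ _ ?_
    rw [Jet.pt_jet]
    exact e.map_target ht
  show jetCoord e' m ((jetChart he y₀).symm (jetCurve m q t)) = _
  rw [h1, jetCoord_jet he' m _ ht']
  rfl

theorem jetCurve_mem_trans_source (he : IsAdapted π e) (he' : IsAdapted π e') {m : ℕ}
    (y₀ y₀' : Jet π m) {q : ℝ → Fib n} {t : ℝ} (ht : (t, q t) ∈ e.target)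
    (ht' : e.symm (t, q t) ∈ e'.source) :
    jetCurve m q t ∈ ((jetChart he y₀).symm.trans (jetChart he' y₀')).source := by
  rw [jetChart_symm_trans_source]
  show (t, iteratedDeriv 0 q t) ∈ e.target ∩ e.symm ⁻¹' e'.source
  rw [iteratedDeriv_zero]
  exact ⟨ht, ht'⟩

/-- The transition maps of natural coordinates on prolongations of vertical variations. -/
theorem fderiv_jetTrans_jetCurve (he : IsAdapted π e) (he' : IsAdapted π e') {m : ℕ}
    (y₀ y₀' : Jet π m) {q η : ℝ → Fib n} {t : ℝ} (hq : ∀ᶠ s in 𝓝 t, ContDiffAt ℝ ∞ q s)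
    (hη : ContDiff ℝ ∞ η) (ht : (t, q t) ∈ e.target) (ht' : e.symm (t, q t) ∈ e'.source) :
    fderiv ℝ ((jetChart he y₀).symm.trans (jetChart he' y₀')) (jetCurve m q t)
        ((0 : ℝ), derivs m η t)
      = ((0 : ℝ), derivs m (fun s => fderiv ℝ (fibTrans e e') (s, q s) ((0 : ℝ), η s)) t) := by
  obtain ⟨O, hOq, hO, htO⟩ := eventually_nhds_iff.1 hq
  set τ := (jetChart he y₀).symm.trans (jetChart he' y₀') with hτ
  -- The prolongation of q + rη in the second chart is differentiated in r at 0 in two ways: by the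
  -- chain rule through the transition map, and entry by entry, exchanging the derivative in r with
  -- those in time.
  let c : ℝ × ℝ → ℝ × Fib n := fun p => (p.2, q p.2 + p.1 • η p.2)
  let W : Set (ℝ × Fib n) := e.target ∩ e.symm ⁻¹' e'.source
  have hW : IsOpen W := e.symm.isOpen_inter_preimage e'.open_source
  have hcs : ContDiffOn ℝ ∞ c (univ ×ˢ O) := by
    intro p hp
    have h1 : ContDiffAt ℝ ∞ (fun p : ℝ × ℝ => q p.2) p :=
      ContDiffAt.comp (g := q) p (hOq p.2 hp.2) contDiffAt_snd
    have h2 : ContDiffAt ℝ ∞ (fun p : ℝ × ℝ => η p.2) p := (hη.comp contDiff_snd).contDiffAt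
    exact (contDiffAt_snd.prodMk (h1.add (contDiffAt_fst.smul h2))).contDiffWithinAt
  let U : Set (ℝ × ℝ) := (univ ×ˢ O) ∩ c ⁻¹' W
  have hU : IsOpen U := hcs.continuousOn.isOpen_inter_preimage (isOpen_univ.prod hO) hW
  let g : ℝ × ℝ → Fib n := fun p => fibTrans e e' (c p)
  have hg : ContDiffOn ℝ ∞ g U := by
    intro p hp
    refine ContDiffAt.contDiffWithinAt (ContDiffAt.comp (g := fibTrans e e') p ?_ ?_)
    · exact contDiffAt_fibTrans he he' hp.2.1 hp.2.2
    · exact hcs.contDiffAt ((isOpen_univ.prod hO).mem_nhds hp.1)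
  have h0U : ((0 : ℝ), t) ∈ U := by
    refine ⟨⟨mem_univ _, htO⟩, ?_⟩
    show (t, q t + (0 : ℝ) • η t) ∈ W
    rw [zero_smul, add_zero]
    exact ⟨ht, ht'⟩
  have hqη : ∀ s ∈ O, ∀ r : ℝ, ContDiffAt ℝ ∞ (fun s => q s + r • η s) s := fun s hs r =>
    (hOq s hs).add (contDiffAt_const.fun_smul hη.contDiffAt)
  have hev : ∀ᶠ r : ℝ in 𝓝 0, (r, t) ∈ U :=
    (Continuous.continuousAt (f := fun r : ℝ => (r, t)) (by fun_prop)).eventually (hU.mem_nhds h0U)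
  have hL : (fun r : ℝ => τ (jetCurve m (fun s => q s + r • η s) t))
      =ᶠ[𝓝 0] fun r => ((t, fun i : Fin (m + 1) => iteratedDeriv i (fun s => g (r, s)) t) :
        JetCoord n m) := by
    filter_upwards [hev] with r hr
    rw [hτ, jetTrans_jetCurve he he' y₀ y₀' (eventually_nhds_iff.2 ⟨O, fun s hs => hqη s hs r, hO, htO⟩)
      hr.2.1 hr.2.2]
    rfl
  have hjc : ∀ r : ℝ, jetCurve m (fun s => q s + r • η s) t
      = jetCurve m q t + r • ((0 : ℝ), derivs m η t) := by
    intro r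
    refine Prod.ext (by simp [jetCurve]) (funext fun i => ?_)
    show iteratedDeriv i (fun s => q s + r • η s) t = iteratedDeriv i q t + r • iteratedDeriv i η t
    have hη' : ContDiffAt ℝ (i : ℕ) η t := hη.contDiffAt.of_le (by exact_mod_cast le_top)
    have hq' : ContDiffAt ℝ (i : ℕ) q t := hq.self_of_nhds.of_le (by exact_mod_cast le_top)
    rw [iteratedDeriv_fun_add hq' (hη'.const_smul r), iteratedDeriv_fun_const_smul_field]
  have hd1 : HasDerivAt (fun r : ℝ => τ (jetCurve m (fun s => q s + r • η s) t))
      (fderiv ℝ τ (jetCurve m q t) ((0 : ℝ), derivs m η t)) 0 := by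
    simp only [hjc]
    have hτd : DifferentiableAt ℝ τ (jetCurve m q t) :=
      ((contDiffOn_jetChart_symm_trans he he' y₀ y₀').contDiffAt
        ((isOpen_jetChart_symm_trans_source he he' y₀ y₀').mem_nhds
          (jetCurve_mem_trans_source he he' y₀ y₀' ht ht'))).differentiableAt (by simp)
    have h1 : HasDerivAt (fun r : ℝ => jetCurve m q t + r • (((0 : ℝ), derivs m η t) : JetCoord n m))
        ((0 : ℝ), derivs m η t) 0 := by
      have := ((hasDerivAt_id (0 : ℝ)).smul_const (((0 : ℝ), derivs m η t) : JetCoord n m)).const_add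
        (jetCurve m q t)
      simpa using this
    have h2 : jetCurve m q t + (0 : ℝ) • (((0 : ℝ), derivs m η t) : JetCoord n m) = jetCurve m q t := by
      simp
    refine HasFDerivAt.comp_hasDerivAt (x := (0 : ℝ)) (l := τ) ?_ h1
    rw [h2]
    exact hτd.hasFDerivAt
  have hη' : (fun s => deriv (fun r => g (r, s)) 0)
      =ᶠ[𝓝 t] fun s => fderiv ℝ (fibTrans e e') (s, q s) ((0 : ℝ), η s) := by
    have hev2 : ∀ᶠ s : ℝ in 𝓝 t, ((0 : ℝ), s) ∈ U :=
      (Continuous.continuousAt (f := fun s : ℝ => ((0 : ℝ), s)) (by fun_prop)).eventually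
        (hU.mem_nhds h0U)
    filter_upwards [hev2] with s hs
    have h1 : HasDerivAt (fun r : ℝ => c (r, s)) ((0 : ℝ), η s) 0 := by
      have := ((hasDerivAt_id (0 : ℝ)).smul_const (η s)).const_add (q s)
      simp only [one_smul] at this
      exact (hasDerivAt_const _ _).prodMk this
    have h2 : c (0, s) = (s, q s) := by simp [c]
    have h3 := (contDiffAt_fibTrans he he' hs.2.1 hs.2.2).differentiableAt (by simp)
    have h4 := HasFDerivAt.comp_hasDerivAt (x := (0 : ℝ)) (l := fibTrans e e')
      (f := fun r => c (r, s)) h3.hasFDerivAt h1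
    rw [h2] at h4
    exact h4.deriv
  have hd2 : HasDerivAt (fun r : ℝ => ((t, fun i : Fin (m + 1) =>
      iteratedDeriv i (fun s => g (r, s)) t) : JetCoord n m))
      ((0 : ℝ), derivs m (fun s => fderiv ℝ (fibTrans e e') (s, q s) ((0 : ℝ), η s)) t) 0 := by
    refine (hasDerivAt_const _ _).prodMk (hasDerivAt_pi.2 fun i => ?_)
    have h1 : DifferentiableAt ℝ (fun r : ℝ => iteratedDeriv i (fun s => g (r, s)) t) 0 := by
      have h2 : ContDiffAt ℝ ∞ (fun p : ℝ × ℝ => iteratedDeriv i (fun s => g (p.1, s)) p.2) (0, t) :=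
        (contDiffOn_iteratedDeriv_param hU hg i).contDiffAt (hU.mem_nhds h0U)
      exact DifferentiableAt.comp (g := fun p : ℝ × ℝ => iteratedDeriv i (fun s => g (p.1, s)) p.2)
        (f := fun r : ℝ => (r, t)) 0 (h2.differentiableAt (by simp)) (by fun_prop)
    have h3 := h1.hasDerivAt
    rw [deriv_iteratedDeriv_comm hU hg i (0, t) h0U, hη'.iteratedDeriv_eq] at h3
    exact h3
  exact hd1.unique (hd2.congr_of_eventuallyEq hL)

variable {k : ℕ}

/-- The Lagrangian function in natural coordinates. -/
def lagrCoord (he : IsAdapted π e) (y₀ : Jet π k) (L : Jet π k → ℝ) (z : JetCoord n k) : ℝ :=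
  L ((jetChart he y₀).symm z)

/-- The vertical differential of the Lagrangian function in natural coordinates. -/
def lagrDiff (he : IsAdapted π e) (y₀ : Jet π k) (L : Jet π k → ℝ) (z : JetCoord n k) :
    (Fin (k + 1) → Fib n) →L[ℝ] ℝ :=
  fderiv ℝ (lagrCoord he y₀ L) z ∘L ContinuousLinearMap.inr ℝ ℝ (Fin (k + 1) → Fib n)

theorem comps_lagrDiff (he : IsAdapted π e) (y₀ : Jet π k) (L : Jet π k → ℝ) (z : JetCoord n k)
    {j : ℕ} (hj : j < k + 1) : comps (lagrDiff he y₀ L z) j = partialL he y₀ L ⟨j, hj⟩ z := by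
  rw [comps, dif_pos hj]; rfl

variable {L : Jet π k → ℝ}

theorem contDiffOn_lagrCoord (hL : ContMDiff 𝓘(ℝ, JetCoord n k) 𝓘(ℝ, ℝ) ∞ L)
    (he : IsAdapted π e) (y₀ : Jet π k) :
    ContDiffOn ℝ ∞ (lagrCoord he y₀ L) (jetChart he y₀).target :=
  contMDiffOn_iff_contDiffOn.1 (hL.comp_contMDiffOn (contMDiffOn_jetHomeo_symm he y₀))

theorem contDiffOn_lagrDiff (hL : ContMDiff 𝓘(ℝ, JetCoord n k) 𝓘(ℝ, ℝ) ∞ L)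
    (he : IsAdapted π e) (y₀ : Jet π k) :
    ContDiffOn ℝ ∞ (lagrDiff he y₀ L) (jetChart he y₀).target :=
  ((contDiffOn_lagrCoord hL he y₀).fderiv_of_isOpen (isOpen_jetChart_target he y₀)
    (by simp)).clm_comp contDiffOn_const

theorem contDiffAt_lagrDiff_jetCurve (hL : ContMDiff 𝓘(ℝ, JetCoord n k) 𝓘(ℝ, ℝ) ∞ L)
    (he : IsAdapted π e) (y₀ : Jet π k) {q : ℝ → Fib n} {t : ℝ} (hq : ContDiffAt ℝ ∞ q t)
    (ht : (t, q t) ∈ e.target) :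
    ContDiffAt ℝ ∞ (fun s => lagrDiff he y₀ L (jetCurve k q s)) t :=
  ContDiffAt.comp (g := lagrDiff he y₀ L) t
    ((contDiffOn_lagrDiff hL he y₀).contDiffAt
      ((isOpen_jetChart_target he y₀).mem_nhds (jetCurve_mem_target he y₀ ht)))
    (contDiffAt_jetCurve k hq)

theorem lagrCoord_jetCoord (he : IsAdapted π e) (y₀ : Jet π k) (y : Jet π k)
    (hy : y.pt ∈ e.source) : lagrCoord he y₀ L (jetCoord e k y) = L y :=
  congrArg L (jetChart_symm_jetCoord he y₀ y hy)

/-- L is a function on the jet manifold, so the chain rule through the transition map applies; that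
map sends the prolongation of a vertical variation to the prolongation of its image. -/
theorem lagrDiff_derivs (hL : ContMDiff 𝓘(ℝ, JetCoord n k) 𝓘(ℝ, ℝ) ∞ L) (he : IsAdapted π e)
    (he' : IsAdapted π e') (y₀ y₀' : Jet π k) {q η : ℝ → Fib n} {t : ℝ}
    (hq : ∀ᶠ s in 𝓝 t, ContDiffAt ℝ ∞ q s) (hη : ContDiff ℝ ∞ η) (ht : (t, q t) ∈ e.target)
    (ht' : e.symm (t, q t) ∈ e'.source) :
    lagrDiff he y₀ L (jetCurve k q t) (derivs k η t)
      = lagrDiff he' y₀' L (jetCurve k (fun s => fibTrans e e' (s, q s)) t)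
          (derivs k (fun s => fderiv ℝ (fibTrans e e') (s, q s) ((0 : ℝ), η s)) t) := by
  set τ := (jetChart he y₀).symm.trans (jetChart he' y₀') with hτ
  have hsrc := jetCurve_mem_trans_source he he' y₀ y₀' (m := k) ht ht'
  have hopen := isOpen_jetChart_symm_trans_source he he' y₀ y₀'
  have hev : lagrCoord he y₀ L =ᶠ[𝓝 (jetCurve k q t)] fun z => lagrCoord he' y₀' L (τ z) := by
    filter_upwards [hopen.mem_nhds hsrc] with z hz
    rw [PartialEquiv.trans_source] at hz
    exact (lagrCoord_jetCoord he' y₀' _ hz.2).symm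
  have hτd : DifferentiableAt ℝ τ (jetCurve k q t) :=
    ((contDiffOn_jetChart_symm_trans he he' y₀ y₀').contDiffAt
      (hopen.mem_nhds hsrc)).differentiableAt (by simp)
  have hτe := jetTrans_jetCurve he he' y₀ y₀' (m := k) hq ht ht'
  have htgt : τ (jetCurve k q t) ∈ (jetChart he' y₀').target := τ.map_source hsrc |>.1
  have hLd : DifferentiableAt ℝ (lagrCoord he' y₀' L) (τ (jetCurve k q t)) :=
    ((contDiffOn_lagrCoord hL he' y₀').contDiffAt
      ((isOpen_jetChart_target he' y₀').mem_nhds htgt)).differentiableAt (by simp)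
  have h1 := (hLd.hasFDerivAt.comp (jetCurve k q t) hτd.hasFDerivAt).congr_of_eventuallyEq hev
  show fderiv ℝ (lagrCoord he y₀ L) (jetCurve k q t) ((0 : ℝ), derivs k η t) = _
  rw [h1.fderiv, ContinuousLinearMap.comp_apply, fderiv_jetTrans_jetCurve he he' y₀ y₀' hq hη ht ht',
    hτe]
  rfl

/-- The Legendre-Ostrogradsky momenta as a functional on `(q_0, …, q_{k-1})`. -/
def legendreFun (he : IsAdapted π e) (y₀ : Jet π k) (L : Jet π k → ℝ)
    (z : JetCoord n (2 * k - 1)) : (Fin (k - 1 + 1) → Fib n) →L[ℝ] ℝ :=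
  ∑ r, legendreMom he y₀ L z r ∘L ContinuousLinearMap.proj r

theorem contDiffOn_legendreFun (hL : ContMDiff 𝓘(ℝ, JetCoord n k) 𝓘(ℝ, ℝ) ∞ L)
    (he : IsAdapted π e) (y₀ : Jet π k) (y₁ : Jet π (2 * k - 1)) :
    ContDiffOn ℝ ∞ (legendreFun he y₀ L) (jetChart he y₁).target := by
  refine ContDiffOn.sum fun r _ => ContDiffOn.clm_comp ?_ contDiffOn_const
  refine ContDiffOn.sum fun i _ => contDiffOn_const.fun_smul ?_
  have h1 : ContDiffOn ℝ ∞ (partialL he y₀ L ⟨r + 1 + i, by omega⟩) (jetChart he y₀).target :=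
    (((contDiffOn_lagrCoord hL he y₀).fderiv_of_isOpen (isOpen_jetChart_target he y₀)
      (by simp)).clm_comp contDiffOn_const)
  exact (contDiffOn_iterTotalDeriv (isOpen_jetChart_target he y₀) h1 i).comp
    (contDiff_truncCoord _).contDiffOn fun z hz => hz

/-- Along a prolonged curve iterated total derivatives become time derivatives, which brings the
momenta into the form to which the algebra of `altSum` applies. -/
theorem comps_legendreFun_jetCurve (hL : ContMDiff 𝓘(ℝ, JetCoord n k) 𝓘(ℝ, ℝ) ∞ L)
    (he : IsAdapted π e) (y₀ : Jet π k) {q : ℝ → Fib n} {t : ℝ}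
    (hq : ∀ᶠ s in 𝓝 t, ContDiffAt ℝ ∞ q s) (ht : (t, q t) ∈ e.target) {r : ℕ} (hr : r < k) :
    comps (legendreFun he y₀ L (jetCurve (2 * k - 1) q t)) r
      = altSum (fun j s => comps (lagrDiff he y₀ L (jetCurve k q s)) j) (k - r) (r + 1) t := by
  have hr' : r < k - 1 + 1 := by omega
  have h1 : comps (legendreFun he y₀ L (jetCurve (2 * k - 1) q t)) r
      = legendreMom he y₀ L (jetCurve (2 * k - 1) q t) ⟨r, hr'⟩ := by
    ext a
    rw [comps_apply _ hr', legendreFun, sum_apply,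
      Finset.sum_eq_single ⟨r, hr'⟩]
    · simp
    · intro j _ hj
      simp [Pi.single_eq_of_ne hj]
    · simp
  rw [h1, legendreMom, altSum, ← Fin.sum_univ_eq_sum_range (fun i => (-1 : ℝ) ^ i •
    iteratedDeriv i (fun s => comps (lagrDiff he y₀ L (jetCurve k q s)) (r + 1 + i)) t)]
  refine Finset.sum_congr rfl fun i _ => ?_
  congr 1
  have hi := i.2
  simp only at hi
  have h2 : ContDiffOn ℝ ∞ (partialL he y₀ L ⟨r + 1 + i, by omega⟩) (jetChart he y₀).target :=
    (((contDiffOn_lagrCoord hL he y₀).fderiv_of_isOpen (isOpen_jetChart_target he y₀)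
      (by simp)).clm_comp contDiffOn_const)
  have h3 := iterTotalDeriv_jetCurve (isOpen_jetChart_target he y₀) h2 i hq
    (jetCurve_mem_target he y₀ ht)
  refine Eq.trans h3 ?_
  refine congrArg (fun f => iteratedDeriv i f t) (funext fun s => ?_)
  exact (comps_lagrDiff he y₀ L _ (by omega)).symm

theorem contDiffAt_legendreFun_jetCurve (hL : ContMDiff 𝓘(ℝ, JetCoord n k) 𝓘(ℝ, ℝ) ∞ L)
    (he : IsAdapted π e) (y₀ : Jet π k) {q : ℝ → Fib n} {t : ℝ}
    (hq : ∀ᶠ s in 𝓝 t, ContDiffAt ℝ ∞ q s) (ht : (t, q t) ∈ e.target) :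
    ContDiffAt ℝ ∞ (fun s => legendreFun he y₀ L (jetCurve (2 * k - 1) q s)) t :=
  ContDiffAt.comp (g := legendreFun he y₀ L) t
    ((contDiffOn_legendreFun hL he y₀ ((curveSection he hq ht).jet _)).contDiffAt
      ((isOpen_jetChart_target he _).mem_nhds (jetCurve_mem_target he _ ht)))
    (contDiffAt_jetCurve _ hq.self_of_nhds)

variable [NeZero k]

/-- The Euler-Lagrange covector `∑_i (-1)^i (d/dt)^i (∂L/∂q_i)` along a curve. -/
def elCovector (he : IsAdapted π e) (y₀ : Jet π k) (L : Jet π k → ℝ) (q : ℝ → Fib n) (t : ℝ) :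
    Fib n →L[ℝ] ℝ :=
  altSum (fun j s => comps (lagrDiff he y₀ L (jetCurve k q s)) j) (k + 1) 0 t

theorem elResidual_legendreFun (hL : ContMDiff 𝓘(ℝ, JetCoord n k) 𝓘(ℝ, ℝ) ∞ L)
    (he : IsAdapted π e) (y₀ : Jet π k) {q : ℝ → Fib n} {t : ℝ}
    (hq : ∀ᶠ s in 𝓝 t, ContDiffAt ℝ ∞ q s) (ht : (t, q t) ∈ e.target)
    (u : Fin (2 * k - 1 + 1) → Fib n) :
    elResidual (lagrDiff he y₀ L (jetCurve k q t)) (legendreFun he y₀ L (jetCurve (2 * k - 1) q t))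
      (deriv (fun s => legendreFun he y₀ L (jetCurve (2 * k - 1) q s)) t) u
      = elCovector he y₀ L q t (u 0) := by
  refine elResidual_of_altSum (contDiffAt_lagrDiff_jetCurve hL he y₀ hq.self_of_nhds ht)
    ((contDiffAt_legendreFun_jetCurve hL he y₀ hq ht).differentiableAt (by simp)) ?_ u
  filter_upwards [hq.eventually_nhds, eventually_mem_target hq.self_of_nhds.continuousAt ht]
    with s hs hst r hr
  exact comps_legendreFun_jetCurve hL he y₀ hs hst hr

/-- Integration by parts in pointwise form: the telescoped residual evaluated on the derivatives of
η, with its last two terms recognised as the derivative of p^i η^{(i)}. This identity is what fixes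
the momenta independently of coordinates. -/
theorem deriv_legendreFun_derivs (hL : ContMDiff 𝓘(ℝ, JetCoord n k) 𝓘(ℝ, ℝ) ∞ L)
    (he : IsAdapted π e) (y₀ : Jet π k) {q η : ℝ → Fib n} {t : ℝ}
    (hq : ∀ᶠ s in 𝓝 t, ContDiffAt ℝ ∞ q s) (ht : (t, q t) ∈ e.target) (hη : ContDiffAt ℝ ∞ η t) :
    HasDerivAt (fun s => legendreFun he y₀ L (jetCurve (2 * k - 1) q s) (derivs (k - 1) η s))
      (lagrDiff he y₀ L (jetCurve k q t) (derivs k η t) - elCovector he y₀ L q t (η t)) t := by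
  have h1 := elResidual_legendreFun hL he y₀ hq ht (derivs _ η t)
  have h2 := ((contDiffAt_legendreFun_jetCurve hL he y₀ hq ht).differentiableAt
    (by simp)).hasDerivAt.clm_apply (hasDerivAt_derivs (pred_succ_le k) hη)
  refine h2.congr_deriv ?_
  have h3 : derivs (2 * k - 1) η t 0 = η t := by simp [derivs]
  rw [h3] at h1
  rw [← h1]
  simp only [elResidual, sub_apply, ContinuousLinearMap.comp_apply, restr_derivs]
  ring

/-- The Legendre-Ostrogradsky momenta do not depend on the natural coordinates. -/
theorem legendreFun_trans (hL : ContMDiff 𝓘(ℝ, JetCoord n k) 𝓘(ℝ, ℝ) ∞ L) (he : IsAdapted π e)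
    (he' : IsAdapted π e') (y₀ y₀' : Jet π k) (y₁ y₁' : Jet π (k - 1)) {q : ℝ → Fib n} {t : ℝ}
    (hq : ∀ᶠ s in 𝓝 t, ContDiffAt ℝ ∞ q s) (ht : (t, q t) ∈ e.target)
    (ht' : e.symm (t, q t) ∈ e'.source) :
    legendreFun he y₀ L (jetCurve (2 * k - 1) q t)
      = legendreFun he' y₀' L (jetCurve (2 * k - 1) (fun s => fibTrans e e' (s, q s)) t) ∘L
        ContinuousLinearMap.snd ℝ ℝ (Fin (k - 1 + 1) → Fib n) ∘L
        fderiv ℝ ((jetChart he y₁).symm.trans (jetChart he' y₁')) (jetCurve (k - 1) q t) ∘L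
        ContinuousLinearMap.inr ℝ ℝ (Fin (k - 1 + 1) → Fib n) := by
  set τ := (jetChart he y₁).symm.trans (jetChart he' y₁') with hτ
  set q' : ℝ → Fib n := fun s => fibTrans e e' (s, q s) with hq'
  let β : ℝ → (Fin (k - 1 + 1) → Fib n) →L[ℝ] ℝ := fun s =>
    legendreFun he y₀ L (jetCurve (2 * k - 1) q s)
  let β' : ℝ → (Fin (k - 1 + 1) → Fib n) →L[ℝ] ℝ := fun s =>
    legendreFun he' y₀' L (jetCurve (2 * k - 1) q' s)
  let T : ℝ → (Fin (k - 1 + 1) → Fib n) →L[ℝ] (Fin (k - 1 + 1) → Fib n) := fun s =>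
    ContinuousLinearMap.snd ℝ ℝ (Fin (k - 1 + 1) → Fib n) ∘L
      fderiv ℝ τ (jetCurve (k - 1) q s) ∘L
      ContinuousLinearMap.inr ℝ ℝ (Fin (k - 1 + 1) → Fib n)
  -- C compares the momenta of the two charts and ε compares the Euler–Lagrange terms. Integration
  -- by parts in both charts gives d/dt (C · j^{k−1}η) = ε(η), since the contributions of dL cancel.
  -- The right-hand side has order zero in η, which forces C = 0.
  let C : ℝ → (Fin (k - 1 + 1) → Fib n) →L[ℝ] ℝ := fun s => β s - β' s ∘L T s
  let ε : ℝ → Fib n → ℝ := fun s a => elCovector he' y₀' L q' s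
    (fderiv ℝ (fibTrans e e') (s, q s) ((0 : ℝ), a)) - elCovector he y₀ L q s a
  have hε : ∀ s, ε s 0 = 0 := by
    intro s
    have : ((0 : ℝ), (0 : Fib n)) = 0 := rfl
    simp only [ε, this, map_zero, sub_zero]
  have hct : ContinuousAt (fun s => (s, q s)) t :=
    continuousAt_id.prodMk hq.self_of_nhds.continuousAt
  have hW : IsOpen (e.target ∩ e.symm ⁻¹' e'.source) := e.symm.isOpen_inter_preimage e'.open_source
  have hgood : ∀ᶠ s in 𝓝 t, ContDiffAt ℝ ∞ q s ∧ (s, q s) ∈ e.target ∧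
      e.symm (s, q s) ∈ e'.source := by
    filter_upwards [hq, hct.eventually (hW.mem_nhds ⟨ht, ht'⟩)] with s h1 h2 using ⟨h1, h2.1, h2.2⟩
  have hq's : ∀ s, (ContDiffAt ℝ ∞ q s ∧ (s, q s) ∈ e.target ∧ e.symm (s, q s) ∈ e'.source) →
      ContDiffAt ℝ ∞ q' s ∧ (s, q' s) ∈ e'.target := by
    rintro s ⟨h1, h2, h3⟩
    refine ⟨ContDiffAt.comp (g := fibTrans e e') s (contDiffAt_fibTrans he he' h2 h3)
      (contDiffAt_id.prodMk h1), ?_⟩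
    have h4 : (s, q' s) = e' (e.symm (s, q s)) := by
      refine Prod.ext ?_ rfl
      rw [he'.fst_eq _ h3, ← he.fst_eq _ (e.map_target h2), e.right_inv h2]
    rw [h4]
    exact e'.map_source h3
  have hC : ∀ᶠ s in 𝓝 t, DifferentiableAt ℝ C s := by
    filter_upwards [hgood.eventually_nhds] with s hs
    have h1 : DifferentiableAt ℝ β s :=
      (contDiffAt_legendreFun_jetCurve hL he y₀ (hs.mono fun r hr => hr.1)
        hs.self_of_nhds.2.1).differentiableAt (by simp)
    have h2 : DifferentiableAt ℝ β' s :=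
      (contDiffAt_legendreFun_jetCurve hL he' y₀' (hs.mono fun r hr => (hq's r hr).1)
        (hq's s hs.self_of_nhds).2).differentiableAt (by simp)
    have hopen := isOpen_jetChart_symm_trans_source he he' y₁ y₁'
    have h3 : ContDiffAt ℝ ∞ (fderiv ℝ τ) (jetCurve (k - 1) q s) :=
      ((contDiffOn_jetChart_symm_trans he he' y₁ y₁').fderiv_of_isOpen hopen
        (by simp)).contDiffAt (hopen.mem_nhds (jetCurve_mem_trans_source he he' y₁ y₁'
          hs.self_of_nhds.2.1 hs.self_of_nhds.2.2))
    have h4 : ContDiffAt ℝ ∞ (fun s => fderiv ℝ τ (jetCurve (k - 1) q s)) s :=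
      ContDiffAt.comp (g := fderiv ℝ τ) s h3 (contDiffAt_jetCurve _ hs.self_of_nhds.1)
    have h5 : DifferentiableAt ℝ T s :=
      (contDiffAt_const.clm_comp (h4.clm_comp contDiffAt_const)).differentiableAt (by simp)
    exact h1.sub (h2.clm_comp h5)
  have hzero := eventually_eq_zero_of_deriv_order_zero hε hC (t := t) (by
    filter_upwards [hgood.eventually_nhds] with s hs η hη
    set η' : ℝ → Fib n := fun s => fderiv ℝ (fibTrans e e') (s, q s) ((0 : ℝ), η s) with hη'
    have e1 : (fun r => C r (derivs (k - 1) η r))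
        =ᶠ[𝓝 s] fun r => β r (derivs (k - 1) η r) - β' r (derivs (k - 1) η' r) := by
      filter_upwards [hs.eventually_nhds] with r hr
      have h1 : T r (derivs (k - 1) η r) = derivs (k - 1) η' r :=
        congrArg Prod.snd (fderiv_jetTrans_jetCurve he he' y₁ y₁' (hr.mono fun x hx => hx.1) hη
          hr.self_of_nhds.2.1 hr.self_of_nhds.2.2)
      show β r _ - β' r (T r (derivs (k - 1) η r)) = _
      rw [h1]
    have hη's : ContDiffAt ℝ ∞ η' s := by
      have h2 : ContDiffAt ℝ ∞ (fderiv ℝ (fibTrans e e')) (s, q s) :=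
        (contDiffAt_fibTrans he he' hs.self_of_nhds.2.1 hs.self_of_nhds.2.2).fderiv_right (by simp)
      have h3 : ContDiffAt ℝ ∞ (fun s => fderiv ℝ (fibTrans e e') (s, q s)) s :=
        ContDiffAt.comp (g := fderiv ℝ (fibTrans e e')) s h2
          (contDiffAt_id.prodMk hs.self_of_nhds.1)
      exact h3.clm_apply (contDiffAt_const.prodMk hη.contDiffAt)
    have d1 := deriv_legendreFun_derivs hL he y₀ (hs.mono fun r hr => hr.1) hs.self_of_nhds.2.1
      hη.contDiffAt
    have d2 := deriv_legendreFun_derivs hL he' y₀' (hs.mono fun r hr => (hq's r hr).1)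
      (hq's s hs.self_of_nhds).2 hη's
    rw [e1.deriv_eq, (d1.fun_sub d2).deriv,
      lagrDiff_derivs hL he he' y₀ y₀' (hs.mono fun r hr => hr.1) hη hs.self_of_nhds.2.1
        hs.self_of_nhds.2.2]
    simp only [ε]
    ring)
  exact sub_eq_zero.1 hzero.self_of_nhds

/-- The natural momenta of the Legendre-Ostrogradsky map in arbitrary natural coordinates. -/
theorem momCoord_legendre (hL : ContMDiff 𝓘(ℝ, JetCoord n k) 𝓘(ℝ, ℝ) ∞ L) (he : IsAdapted π e)
    (y₀ : Jet π k) (y : Jet π (2 * k - 1)) (hy : y.pt ∈ e.source) :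
    momCoord e (legendre L y) = legendreFun he y₀ L (jetCoord e _ y) := by
  have he' := chartE_adapted (π := π) y.pt
  have hy' := mem_chartE_source (π := π) y.pt
  have hpr := proj_pt (π := π) (k - 1) (by omega : k - 1 ≤ 2 * k - 1) y
  set f := y.rep with hf
  -- The jet is realised by its representative curve, so that the transformation law along curves
  -- applies, with the preferred chart from the definition of `legendre` as second chart.
  let q : ℝ → Fib n := fun s => (e (f.map s)).2
  have hsm := f.smooth_chart he.contMDiffOn hy
  have hq : ∀ᶠ s in 𝓝 f.base, ContDiffAt ℝ ∞ q s := hsm.1.mono fun s hs => hs.snd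
  have hfq : ∀ᶠ s in 𝓝 f.base, (s, q s) = e (f.map s) := by
    filter_upwards [hsm.2, f.isSection] with s h1 h2
    exact Prod.ext ((he.fst_eq _ h1).trans h2).symm rfl
  have ht : (f.base, q f.base) ∈ e.target := by
    rw [hfq.self_of_nhds]; exact e.map_source hy
  have ht' : e.symm (f.base, q f.base) ∈ (chartE π y.pt).source := by
    rw [hfq.self_of_nhds]
    exact (congrArg (· ∈ (chartE π y.pt).source) (e.left_inv hy)).mpr hy'
  have key := legendreFun_trans hL he he' y₀ (y.proj k (le_two_mul_sub_one k))
    (y.proj (k - 1) (by omega)) (y.proj (k - 1) (by omega)) hq ht ht'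
  have hjc : jetCurve (2 * k - 1) q f.base = jetCoord e _ y := rfl
  have hjc1 : jetCurve (k - 1) q f.base = jetCoord e (k - 1) (y.proj (k - 1) (by omega)) :=
    (jetCoord_proj he (k - 1) (by omega) y hy).symm
  have hjc' : jetCurve (2 * k - 1) (fun s => fibTrans e (chartE π y.pt) (s, q s)) f.base
      = jetCoord (chartE π y.pt) _ y := by
    refine Prod.ext rfl (funext fun i => Filter.EventuallyEq.iteratedDeriv_eq _ ?_)
    filter_upwards [hsm.2, hfq] with s h1 h2
    show (chartE π y.pt (e.symm (s, q s))).2 = _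
    rw [h2, e.left_inv h1]
  rw [hjc', hjc, hjc1, fderiv_jetChart_symm_trans he' he _ _ _ (by rw [hpr]; exact hy')
    (by rw [hpr]; exact hy)] at key
  rw [key]
  unfold legendre momOf
  rw [momCoord_mk he _ (by rw [hpr]; exact hy)]
  rfl

theorem phaseCoord_legendreGraph (hL : ContMDiff 𝓘(ℝ, JetCoord n k) 𝓘(ℝ, ℝ) ∞ L)
    (he : IsAdapted π e) (y₀ : Jet π k) (y : Jet π (2 * k - 1)) (hy : y.pt ∈ e.source) :
    phaseCoord e (legendreGraph L y) = (jetCoord e _ y, legendreFun he y₀ L (jetCoord e _ y)) :=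
  Prod.ext rfl (momCoord_legendre hL he y₀ y hy)

/-- The chart used in `legendre` is chosen anew at every point, with no continuity of the choice.
Independence of coordinates allows one fixed chart near y, where the momenta are visibly smooth. -/
theorem contMDiff_legendreGraph (hL : ContMDiff 𝓘(ℝ, JetCoord n k) 𝓘(ℝ, ℝ) ∞ L) :
    ContMDiff 𝓘(ℝ, JetCoord n (2 * k - 1)) 𝓘(ℝ, PhaseCoord n k) ∞
      (legendreGraph L : Jet π (2 * k - 1) → Phase π k) := by
  intro y
  have he := chartE_adapted (π := π) y.pt
  have hy := mem_chartE_source (π := π) y.pt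
  have hev : ∀ᶠ y' : Jet π (2 * k - 1) in 𝓝 y, y'.pt ∈ (chartE π y.pt).source :=
    (continuous_jet_pt.tendsto y).eventually ((chartE π y.pt).open_source.mem_nhds hy)
  refine contMDiffAt_phase_of_coord he hev ?_
  have h1 := contMDiffAt_jetCoord he hy
  have h2 : ContDiffAt ℝ ∞ (fun z => (z, legendreFun he (y.proj k (le_two_mul_sub_one k)) L z))
      (jetCoord (chartE π y.pt) _ y) :=
    contDiffAt_id.prodMk ((contDiffOn_legendreFun hL he _ y).contDiffAt
      ((isOpen_jetChart_target he y).mem_nhds ((jetChart he y).map_source hy)))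
  refine (ContMDiffAt.comp y h2.contMDiffAt h1).congr_of_eventuallyEq ?_
  filter_upwards [hev] with y' hy'
  exact phaseCoord_legendreGraph hL he _ y' hy'

end Legendre

/-! ### Differentiation of the action and vanishing of integrands of constant sign -/

section ParametricIntegral

/-- Differentiation under the integral sign for a compactly supported variation, up to a total
derivative of a compactly supported function. -/
theorem hasDerivAt_setIntegral_of_variation {P : ℝ × ℝ → ℝ} {B : ℝ → ℝ} {ε : ℝ} (hε : 0 < ε)
    {I V : Set ℝ} (hP : ContDiffOn ℝ ∞ P (Ioo (-ε) ε ×ˢ univ)) (hI : IsCompact I) (hIV : I ⊆ V)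
    (hV : IsOpen V) (hc : ∀ s ∈ Ioo (-ε) ε, ∀ t ∉ I, P (s, t) = P (0, t))
    (hint : IntegrableOn (fun t => P (0, t)) V) (hB : ContDiff ℝ ∞ B) (hBI : ∀ t ∉ I, B t = 0) :
    Continuous (fun t => deriv (fun s => P (s, t)) 0 - deriv B t) ∧
      (∀ t ∉ I, deriv (fun s => P (s, t)) 0 - deriv B t = 0) ∧
      HasDerivAt (fun s => ∫ t in V, P (s, t))
        (∫ t, (deriv (fun s => P (s, t)) 0 - deriv B t)) 0 := by
  have hO : IsOpen (Ioo (-ε) ε ×ˢ (univ : Set ℝ)) := isOpen_Ioo.prod isOpen_univ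
  have h0 : (0 : ℝ) ∈ Ioo (-ε) ε := ⟨by linarith, hε⟩
  have hd : ∀ p ∈ Ioo (-ε) ε ×ˢ (univ : Set ℝ),
      HasDerivAt (fun s => P (s, p.2)) (fderiv ℝ P p (1, 0)) p.1 := fun p hp =>
    HasFDerivAt.comp_hasDerivAt (x := p.1) (f := fun s : ℝ => (s, p.2))
      ((hP.contDiffAt (hO.mem_nhds hp)).differentiableAt (by simp)).hasFDerivAt
      ((hasDerivAt_id _).prodMk (hasDerivAt_const _ _))
  have hD : ContinuousOn (fun p : ℝ × ℝ => fderiv ℝ P p (1, 0)) (Ioo (-ε) ε ×ˢ univ) :=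
    ((hP.fderiv_of_isOpen (m := ∞) hO (by simp)).clm_apply contDiffOn_const).continuousOn
  have hslice : ∀ s ∈ Ioo (-ε) ε, Continuous fun t : ℝ => P (s, t) := fun s hs =>
    hP.continuousOn.comp_continuous (by fun_prop) fun t => ⟨hs, mem_univ _⟩
  have hD0 : Continuous fun t : ℝ => deriv (fun s => P (s, t)) 0 := by
    have h1 : Continuous fun t : ℝ => fderiv ℝ P (0, t) (1, 0) :=
      hD.comp_continuous (f := fun t : ℝ => ((0 : ℝ), t)) (by fun_prop) fun t => ⟨h0, mem_univ _⟩
    exact h1.congr fun t => (hd (0, t) ⟨h0, mem_univ _⟩).deriv.symm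
  have hB' : Continuous (deriv B) := hB.continuous_deriv (by simp)
  have hD0I : ∀ t ∉ I, deriv (fun s => P (s, t)) 0 = 0 := by
    intro t ht
    have h1 : (fun s => P (s, t)) =ᶠ[𝓝 0] fun _ => P (0, t) := by
      filter_upwards [isOpen_Ioo.mem_nhds h0] with s hs using hc s hs t ht
    rw [h1.deriv_eq, deriv_const]
  have hB'I : ∀ t ∉ I, deriv B t = 0 := by
    intro t ht
    have h1 : B =ᶠ[𝓝 t] fun _ => 0 := by
      filter_upwards [hI.isClosed.isOpen_compl.mem_nhds ht] with r hr using hBI r hr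
    rw [h1.deriv_eq, deriv_const]
  have hcs : ∀ {f : ℝ → ℝ}, Continuous f → (∀ t ∉ I, f t = 0) → Integrable f := fun hf h =>
    hf.integrable_of_hasCompactSupport (HasCompactSupport.intro hI h)
  refine ⟨hD0.sub hB', fun t ht => by rw [hD0I t ht, hB'I t ht, sub_zero], ?_⟩
  have hB0 : ∫ t, deriv B t = 0 :=
    integral_eq_zero_of_hasDerivAt_of_integrable
      (fun t => (hB.differentiable (by simp) t).hasDerivAt) (hcs hB' hB'I) (hcs hB.continuous hBI)
  rw [integral_sub (hcs hD0 hD0I) (hcs hB' hB'I), hB0, sub_zero,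
    ← setIntegral_eq_integral_of_forall_compl_eq_zero (s := I) hD0I]
  have hIm : MeasurableSet I := hI.isClosed.measurableSet
  -- Only the integral over the compact set I depends on s. Integrability over the possibly
  -- unbounded V is therefore needed at s = 0 alone.
  have hsplit : ∀ s ∈ Ioo (-ε) ε,
      ∫ t in V, P (s, t) = (∫ t in V \ I, P (0, t)) + ∫ t in I, P (s, t) := by
    intro s hs
    have h1 : EqOn (fun t => P (s, t)) (fun t => P (0, t)) (V \ I) := fun t ht => hc s hs t ht.2
    have hm : MeasurableSet (V \ I) := hV.measurableSet.diff hIm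
    conv_lhs => rw [← sdiff_union_of_subset hIV]
    rw [setIntegral_union disjoint_sdiff_left hIm
      ((hint.mono_set sdiff_subset).congr_fun h1.symm hm)
      ((hslice s hs).continuousOn.integrableOn_compact hI), setIntegral_congr_fun hm h1]
  have hK : IsCompact (Icc (-(ε / 2)) (ε / 2) ×ˢ I) := isCompact_Icc.prod hI
  have hKsub : Icc (-(ε / 2)) (ε / 2) ×ˢ I ⊆ Ioo (-ε) ε ×ˢ (univ : Set ℝ) :=
    prod_mono (fun s hs => ⟨by linarith [hs.1], by linarith [hs.2]⟩) (subset_univ _)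
  obtain ⟨C, hC⟩ := hK.exists_bound_of_continuousOn (hD.mono hKsub)
  have hn : Icc (-(ε / 2)) (ε / 2) ∈ 𝓝 (0 : ℝ) := Icc_mem_nhds (by linarith) (by linarith)
  have h2 := (hasDerivAt_integral_of_dominated_loc_of_deriv_le (μ := volume.restrict I)
    (F := fun s t => P (s, t)) (F' := fun s t => fderiv ℝ P (s, t) (1, 0)) (x₀ := 0)
    (bound := fun _ => C) hn
    (by
      filter_upwards [isOpen_Ioo.mem_nhds h0] with s hs
      exact (hslice s hs).aestronglyMeasurable)
    ((hslice 0 h0).continuousOn.integrableOn_compact hI)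
    (hD.comp_continuous (f := fun t : ℝ => ((0 : ℝ), t)) (by fun_prop)
      fun t => ⟨h0, mem_univ _⟩).aestronglyMeasurable
    (by
      filter_upwards [ae_restrict_mem hIm] with t ht s hs
      exact hC (s, t) ⟨hs, ht⟩)
    (integrableOn_const hI.measure_lt_top.ne)
    (by
      filter_upwards with t s hs
      exact hd (s, t) ⟨⟨by linarith [hs.1], by linarith [hs.2]⟩, mem_univ _⟩)).2
  have h3 : (∫ t in I, fderiv ℝ P (0, t) (1, 0)) = ∫ t in I, deriv (fun s => P (s, t)) 0 :=
    setIntegral_congr_fun hIm fun t _ => (hd (0, t) ⟨h0, mem_univ _⟩).deriv.symm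
  rw [← h3]
  refine (h2.const_add (∫ t in V \ I, P (0, t))).congr_of_eventuallyEq ?_
  filter_upwards [isOpen_Ioo.mem_nhds h0] with s hs using hsplit s hs

/-- A continuous compactly supported nonnegative function with vanishing integral vanishes. -/
theorem eq_zero_of_integral_eq_zero {R : ℝ → ℝ} {I : Set ℝ} (hR : Continuous R)
    (hI : IsCompact I) (hRI : ∀ t ∉ I, R t = 0) (hpos : ∀ t, 0 ≤ R t) (h : ∫ t, R t = 0) (t : ℝ) :
    R t = 0 := by
  by_contra hne
  exact ((hR.integral_pos_of_hasCompactSupport_nonneg_nonzero (HasCompactSupport.intro hI hRI)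
    hpos hne).ne' h)

end ParametricIntegral

/-! ### First variation of the unified action in coordinates -/

section CoordinateVariation

variable {Y : Type*} [NormedAddCommGroup Y] [NormedSpace ℝ Y] {k : ℕ} [NeZero k]

/-- The integrand `L + p (dq/dt - q')` of the unified action, along a two-parameter family. -/
def unifiedIntegrand (ℓ : ℝ × (Fin (k + 1) → Y) → ℝ) (x : ℝ × ℝ → Fin (2 * k - 1 + 1) → Y)
    (b : ℝ × ℝ → (Fin (k - 1 + 1) → Y) →L[ℝ] ℝ) (p : ℝ × ℝ) : ℝ :=
  ℓ (p.2, restr Y (le_two_mul_sub_one k) (x p)) + b p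
    (restr Y (by omega) (deriv (fun r => x (p.1, r)) p.2) - shift Y (pred_succ_le k) (x p))

variable {ℓ : ℝ × (Fin (k + 1) → Y) → ℝ} {x : ℝ × ℝ → Fin (2 * k - 1 + 1) → Y}
  {b : ℝ × ℝ → (Fin (k - 1 + 1) → Y) →L[ℝ] ℝ} {U : Set (ℝ × ℝ)}

theorem contDiffOn_unifiedIntegrand {O : Set (ℝ × (Fin (k + 1) → Y))} (hℓ : ContDiffOn ℝ ∞ ℓ O)
    (hU : IsOpen U) (hx : ContDiffOn ℝ ∞ x U) (hb : ContDiffOn ℝ ∞ b U)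
    (hxO : ∀ p ∈ U, (p.2, restr Y (le_two_mul_sub_one k) (x p)) ∈ O) :
    ContDiffOn ℝ ∞ (unifiedIntegrand ℓ x b) U := by
  have hx' : ContDiffOn ℝ ∞ (fun p : ℝ × ℝ => deriv (fun r => x (p.1, r)) p.2) U := by
    simpa only [iteratedDeriv_one] using contDiffOn_iteratedDeriv_param hU hx 1
  refine ContDiffOn.add ?_ (hb.clm_apply ?_)
  · exact hℓ.comp (contDiffOn_snd.prodMk
      ((restr Y (le_two_mul_sub_one k)).contDiff.comp_contDiffOn hx)) hxO
  · exact ((restr Y _).contDiff.comp_contDiffOn hx').sub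
      ((shift Y (pred_succ_le k)).contDiff.comp_contDiffOn hx)

/-- First variation of the unified action around a holonomic curve. -/
theorem deriv_unifiedIntegrand_sub (hU : IsOpen U) (hx : ContDiffOn ℝ ∞ x U)
    (hb : ContDiffOn ℝ ∞ b U) {t : ℝ} (ht : (0, t) ∈ U) {q : ℝ → Y} (hq : ContDiffAt ℝ ∞ q t)
    (hxq : ∀ᶠ r in 𝓝 t, x (0, r) = derivs (2 * k - 1) q r)
    (hℓ : DifferentiableAt ℝ ℓ (t, derivs k q t)) :
    deriv (fun s => unifiedIntegrand ℓ x b (s, t)) 0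
        - deriv (fun r => b (0, r) (restr Y (by omega) (deriv (fun s => x (s, r)) 0))) t
      = elResidual (fderiv ℝ ℓ (t, derivs k q t) ∘L ContinuousLinearMap.inr ℝ ℝ (Fin (k + 1) → Y))
          (b (0, t)) (deriv (fun r => b (0, r)) t) (deriv (fun s => x (s, t)) 0) := by
  have hs1 : HasDerivAt (fun s : ℝ => (s, t)) ((1 : ℝ), (0 : ℝ)) 0 :=
    (hasDerivAt_id _).prodMk (hasDerivAt_const _ _)
  have hr1 : HasDerivAt (fun r : ℝ => ((0 : ℝ), r)) ((0 : ℝ), (1 : ℝ)) t :=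
    (hasDerivAt_const _ _).prodMk (hasDerivAt_id _)
  have hxd := ((hx.contDiffAt (hU.mem_nhds ht)).differentiableAt (by simp)).hasFDerivAt
  have hbd := ((hb.contDiffAt (hU.mem_nhds ht)).differentiableAt (by simp)).hasFDerivAt
  have hxs : HasDerivAt (fun s => x (s, t)) (deriv (fun s => x (s, t)) 0) 0 :=
    (HasFDerivAt.comp_hasDerivAt (x := (0 : ℝ)) (f := fun s : ℝ => (s, t)) hxd
      hs1).differentiableAt.hasDerivAt
  have hbs : HasDerivAt (fun s => b (s, t)) (deriv (fun s => b (s, t)) 0) 0 :=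
    (HasFDerivAt.comp_hasDerivAt (x := (0 : ℝ)) (f := fun s : ℝ => (s, t)) hbd
      hs1).differentiableAt.hasDerivAt
  have hbr : HasDerivAt (fun r => b (0, r)) (deriv (fun r => b (0, r)) t) t :=
    (HasFDerivAt.comp_hasDerivAt (x := t) (f := fun r : ℝ => ((0 : ℝ), r)) hbd
      hr1).differentiableAt.hasDerivAt
  have hx' : ContDiffOn ℝ ∞ (fun p : ℝ × ℝ => deriv (fun r => x (p.1, r)) p.2) U := by
    simpa only [iteratedDeriv_one] using contDiffOn_iteratedDeriv_param hU hx 1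
  have hcomm := deriv_iteratedDeriv_comm hU hx 1 _ ht
  simp only [iteratedDeriv_one] at hcomm
  have hx's : HasDerivAt (fun s => deriv (fun r => x (s, r)) t)
      (deriv (fun r => deriv (fun s => x (s, r)) 0) t) 0 := by
    rw [← hcomm]
    exact (HasFDerivAt.comp_hasDerivAt (x := (0 : ℝ)) (f := fun s : ℝ => (s, t))
      ((hx'.contDiffAt (hU.mem_nhds ht)).differentiableAt (by simp)).hasFDerivAt
      hs1).differentiableAt.hasDerivAt
  have hδ : HasDerivAt (fun r => deriv (fun s => x (s, r)) 0)
      (deriv (fun r => deriv (fun s => x (s, r)) 0) t) t := by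
    have hxU : ContDiffOn ℝ ∞ (fun p : ℝ × ℝ => fderiv ℝ x p (1, 0)) U :=
      (hx.fderiv_of_isOpen hU (by simp)).clm_apply contDiffOn_const
    have h1 := HasFDerivAt.comp_hasDerivAt (x := t) (f := fun r : ℝ => ((0 : ℝ), r))
      ((hxU.contDiffAt (hU.mem_nhds ht)).differentiableAt (by simp)).hasFDerivAt hr1
    refine (h1.congr_of_eventuallyEq ?_).differentiableAt.hasDerivAt
    have hUr : ∀ᶠ r in 𝓝 t, ((0 : ℝ), r) ∈ U := hr1.continuousAt.eventually (hU.mem_nhds ht)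
    filter_upwards [hUr] with r hr
    exact (HasFDerivAt.comp_hasDerivAt (x := (0 : ℝ)) (f := fun s : ℝ => (s, r))
      ((hx.contDiffAt (hU.mem_nhds hr)).differentiableAt (by simp)).hasFDerivAt
      ((hasDerivAt_id _).prodMk (hasDerivAt_const _ _))).deriv
  have hx0 : x (0, t) = derivs (2 * k - 1) q t := hxq.self_of_nhds
  -- The curve at s = 0 is holonomic, so the factor multiplying the momenta vanishes there and their
  -- s-derivative disappears from the first variation.
  have hhol : restr Y (by omega : k - 1 ≤ 2 * k - 1) (deriv (fun r => x (0, r)) t)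
      - shift Y (pred_succ_le k) (x (0, t)) = 0 := by
    rw [Filter.EventuallyEq.deriv_eq hxq, hx0, ← (hasDerivAt_derivs (pred_succ_le k) hq).deriv,
      sub_eq_zero]
    exact (((restr Y (by omega : k - 1 ≤ 2 * k - 1)).hasFDerivAt.comp_hasDerivAt t
      ((contDiffAt_derivs (2 * k - 1) hq).differentiableAt (by simp)).hasDerivAt).deriv).symm
  have hF1 : HasDerivAt (fun s => ℓ (t, restr Y (le_two_mul_sub_one k) (x (s, t))))
      (fderiv ℝ ℓ (t, derivs k q t)
        ((0 : ℝ), restr Y (le_two_mul_sub_one k) (deriv (fun s => x (s, t)) 0))) 0 := by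
    refine HasFDerivAt.comp_hasDerivAt (x := (0 : ℝ))
      (f := fun s : ℝ => (t, restr Y (le_two_mul_sub_one k) (x (s, t)))) ?_
      ((hasDerivAt_const _ _).prodMk
        ((restr Y (le_two_mul_sub_one k)).hasFDerivAt.comp_hasDerivAt _ hxs))
    rw [hx0, restr_derivs]
    exact hℓ.hasFDerivAt
  have hF2 := hbs.clm_apply
    (((restr Y (by omega : k - 1 ≤ 2 * k - 1)).hasFDerivAt.comp_hasDerivAt _ hx's).sub
      ((shift Y (pred_succ_le k)).hasFDerivAt.comp_hasDerivAt _ hxs))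
  have hBd := hbr.clm_apply ((restr Y (by omega : k - 1 ≤ 2 * k - 1)).hasFDerivAt.comp_hasDerivAt
    _ hδ)
  have hF : HasDerivAt (fun s => unifiedIntegrand ℓ x b (s, t)) _ 0 := hF1.add hF2
  have hBd' : HasDerivAt (fun r => b (0, r) (restr Y (by omega : k - 1 ≤ 2 * k - 1)
    (deriv (fun s => x (s, r)) 0))) _ t := hBd
  rw [hF.deriv, hBd'.deriv]
  simp only [Pi.sub_apply, Function.comp_apply]
  rw [hhol, map_zero, map_sub]
  simp only [elResidual, sub_apply, ContinuousLinearMap.comp_apply, ContinuousLinearMap.inr_apply]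
  ring

end CoordinateVariation

theorem pullCurve_congr {H M : Type*} [NormedAddCommGroup H] [NormedSpace ℝ H]
    [TopologicalSpace M] [ChartedSpace H M] (θ : ∀ x : M, TangentSpace 𝓘(ℝ, H) x →L[ℝ] ℝ)
    {γ γ' : ℝ → M} {t : ℝ} (h : γ =ᶠ[𝓝 t] γ') : pullCurve θ γ t = pullCurve θ γ' t := by
  have key : ∀ {x x' : M} (v : H), x = x' → (θ x : H →L[ℝ] ℝ) v = (θ x' : H →L[ℝ] ℝ) v := by
    rintro x _ v rfl; rfl
  unfold pullCurve
  rw [h.mfderiv_eq]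
  exact key _ h.self_of_nhds

/-! ### Variations in W_r and their first-variation formula -/

section PhaseVariations

variable {n : ℕ} {E : Type u} [TopologicalSpace E] [ChartedSpace (ℝ × Fib n) E]
  {π : FibreBundle n E} {e : OpenPartialHomeomorph E (ℝ × Fib n)}

/-- The principal part of a section in adapted coordinates. -/
def Sec.curve (φ : Sec π) (e : OpenPartialHomeomorph E (ℝ × Fib n)) (t : ℝ) : Fib n :=
  (e (φ.toFun t)).2

theorem Sec.pt_jet (φ : Sec π) (m : ℕ) (t : ℝ) : (φ.jet m t).pt = φ.toFun t :=
  Jet.pt_jet (φ.germ t)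

theorem Sec.base_jet (φ : Sec π) (m : ℕ) (t : ℝ) : (φ.jet m t).base = t :=
  Jet.base_jet (φ.germ t)

theorem Sec.eventually_mem (φ : Sec π) {t : ℝ} (ht : φ.toFun t ∈ e.source) :
    ∀ᶠ r in 𝓝 t, φ.toFun r ∈ e.source :=
  φ.smooth.continuous.continuousAt.eventually (e.open_source.mem_nhds ht)

theorem Sec.contDiffAt_curve (φ : Sec π) (he : IsAdapted π e) {t : ℝ}
    (ht : φ.toFun t ∈ e.source) : ContDiffAt ℝ ∞ (φ.curve e) t :=
  ((φ.germ t).smooth_chart he.contMDiffOn ht).1.self_of_nhds.snd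

theorem Sec.eventually_contDiffAt_curve (φ : Sec π) (he : IsAdapted π e) {t : ℝ}
    (ht : φ.toFun t ∈ e.source) : ∀ᶠ r in 𝓝 t, ContDiffAt ℝ ∞ (φ.curve e) r :=
  (φ.eventually_mem ht).mono fun _ hr => φ.contDiffAt_curve he hr

theorem Sec.curve_mem_target (φ : Sec π) (he : IsAdapted π e) {t : ℝ}
    (ht : φ.toFun t ∈ e.source) : (t, φ.curve e t) ∈ e.target := by
  have h1 : (t, φ.curve e t) = e (φ.toFun t) :=
    Prod.ext ((he.fst_eq _ ht).trans (φ.isSection t)).symm rfl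
  rw [h1]; exact e.map_source ht

variable [IsManifold 𝓘(ℝ, ℝ × Fib n) ∞ E]

theorem Sec.jetCoord_jet (φ : Sec π) (he : IsAdapted π e) (m : ℕ) {t : ℝ}
    (ht : φ.toFun t ∈ e.source) : jetCoord e m (φ.jet m t) = jetCurve m (φ.curve e) t :=
  HOMech.jetCoord_jet he m (φ.germ t) ht

theorem Sec.contMDiff_jet (φ : Sec π) (m : ℕ) :
    ContMDiff 𝓘(ℝ, ℝ) 𝓘(ℝ, JetCoord n m) ∞ (φ.jet m) := by
  intro t
  have he := chartE_adapted (π := π) (φ.toFun t)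
  have ht := mem_chartE_source (π := π) (φ.toFun t)
  have hev := φ.eventually_mem ht
  refine contMDiffAt_jet_of_coord he (hev.mono fun r hr => by rwa [φ.pt_jet]) ?_
  exact ((contDiffAt_jetCurve m (φ.contDiffAt_curve he ht)).contMDiffAt).congr_of_eventuallyEq
    (hev.mono fun r hr => φ.jetCoord_jet he m hr)

theorem Sec.proj_jet (φ : Sec π) {m r : ℕ} (h : r ≤ m) (t : ℝ) :
    (φ.jet m t).proj r h = φ.jet r t := by
  have he := chartE_adapted (π := π) (φ.toFun t)
  have ht := mem_chartE_source (π := π) (φ.toFun t)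
  have h1 : (φ.jet m t).pt ∈ (chartE π (φ.toFun t)).source := by rwa [φ.pt_jet]
  refine (jetChart he (φ.jet r t)).injOn ?_ ?_ ?_
  · show Jet.pt _ ∈ (chartE π (φ.toFun t)).source
    rwa [proj_pt]
  · show Jet.pt _ ∈ (chartE π (φ.toFun t)).source
    rwa [φ.pt_jet]
  · show jetCoord _ r _ = jetCoord _ r _
    rw [jetCoord_proj he r h _ h1, φ.jetCoord_jet he _ ht, φ.jetCoord_jet he _ ht]
    rfl

variable {k : ℕ}

/-- A compactly supported variation, by sections of `W_r → ℝ`, of a section lying over the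
prolongation of `φ`. -/
structure PhaseVariation (φ : Sec π) (ε : ℝ) (I : Set ℝ) (Ψ : ℝ × ℝ → Phase π k) : Prop where
  pos : 0 < ε
  smooth : ContMDiffOn 𝓘(ℝ, ℝ × ℝ) 𝓘(ℝ, PhaseCoord n k) ∞ Ψ (Ioo (-ε) ε ×ˢ univ)
  base_eq : ∀ s ∈ Ioo (-ε) ε, ∀ t, (Ψ (s, t)).base = t
  jet_eq : ∀ t, (Ψ (0, t)).jet = φ.jet (2 * k - 1) t
  compact : IsCompact I
  const : ∀ s ∈ Ioo (-ε) ε, ∀ t ∉ I, Ψ (s, t) = Ψ (0, t)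

namespace PhaseVariation

variable {φ : Sec π} {ε : ℝ} {I : Set ℝ} {Ψ : ℝ × ℝ → Phase π k} {L : Jet π k → ℝ}

/-- The part of the strip where the variation stays in the domain of `e`. -/
def dom (e : OpenPartialHomeomorph E (ℝ × Fib n)) (ε : ℝ) (Ψ : ℝ × ℝ → Phase π k) : Set (ℝ × ℝ) :=
  (Ioo (-ε) ε ×ˢ univ) ∩ (fun p => (Ψ p).jet.pt) ⁻¹' e.source

/-- The positions `(q_0, …, q_{2k-1})` along a variation. -/
def positions (e : OpenPartialHomeomorph E (ℝ × Fib n)) (Ψ : ℝ × ℝ → Phase π k) (p : ℝ × ℝ) :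
    Fin (2 * k - 1 + 1) → Fib n := (phaseCoord e (Ψ p)).1.2

/-- The momenta along a variation. -/
def momenta (e : OpenPartialHomeomorph E (ℝ × Fib n)) (Ψ : ℝ × ℝ → Phase π k) (p : ℝ × ℝ) :
    (Fin (k - 1 + 1) → Fib n) →L[ℝ] ℝ := (phaseCoord e (Ψ p)).2

/-- The infinitesimal variation of the positions. -/
def deltaPos (e : OpenPartialHomeomorph E (ℝ × Fib n)) (Ψ : ℝ × ℝ → Phase π k) (t : ℝ) :
    Fin (2 * k - 1 + 1) → Fib n := deriv (fun s => positions e Ψ (s, t)) 0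

/-- The boundary term of the first variation. -/
def boundary (Ψ : ℝ × ℝ → Phase π k) (t : ℝ) : ℝ :=
  (Ψ (0, t)).mom.rep
    (mfderiv 𝓘(ℝ, ℝ) 𝓘(ℝ, JetCoord n (k - 1)) (fun s => (Ψ (s, t)).toJet) 0 (1 : ℝ))

theorem zero_mem (h : PhaseVariation φ ε I Ψ) : (0 : ℝ) ∈ Ioo (-ε) ε :=
  ⟨by linarith [h.pos], h.pos⟩

theorem contMDiffAt (h : PhaseVariation φ ε I Ψ) {p : ℝ × ℝ} (hp : p.1 ∈ Ioo (-ε) ε) :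
    ContMDiffAt 𝓘(ℝ, ℝ × ℝ) 𝓘(ℝ, PhaseCoord n k) ∞ Ψ p :=
  h.smooth.contMDiffAt ((isOpen_Ioo.prod isOpen_univ).mem_nhds ⟨hp, mem_univ _⟩)

theorem isOpen_dom (h : PhaseVariation φ ε I Ψ) : IsOpen (dom e ε Ψ) :=
  (continuous_phase_pt.comp_continuousOn h.smooth.continuousOn).isOpen_inter_preimage
    (isOpen_Ioo.prod isOpen_univ) e.open_source

theorem mem_dom (h : PhaseVariation φ ε I Ψ) {t : ℝ} (ht : φ.toFun t ∈ e.source) :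
    ((0 : ℝ), t) ∈ dom e ε Ψ := by
  refine ⟨⟨h.zero_mem, mem_univ _⟩, ?_⟩
  show (Ψ (0, t)).jet.pt ∈ e.source
  rwa [h.jet_eq, φ.pt_jet]

theorem contDiffOn_phaseCoord (h : PhaseVariation φ ε I Ψ) (he : IsAdapted π e) :
    ContDiffOn ℝ ∞ (fun p => phaseCoord e (Ψ p)) (dom e ε Ψ) := fun p hp =>
  (ContMDiffAt.comp (g := phaseCoord e) p (contMDiffAt_phaseCoord he hp.2)
    (h.contMDiffAt hp.1.1)).contDiffAt.contDiffWithinAt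

theorem contDiffOn_positions (h : PhaseVariation φ ε I Ψ) (he : IsAdapted π e) :
    ContDiffOn ℝ ∞ (positions e Ψ) (dom e ε Ψ) := (h.contDiffOn_phaseCoord he).fst.snd

theorem contDiffOn_momenta (h : PhaseVariation φ ε I Ψ) (he : IsAdapted π e) :
    ContDiffOn ℝ ∞ (momenta e Ψ) (dom e ε Ψ) := (h.contDiffOn_phaseCoord he).snd

theorem positions_zero (h : PhaseVariation φ ε I Ψ) (he : IsAdapted π e) {t : ℝ}
    (ht : φ.toFun t ∈ e.source) :
    positions e Ψ (0, t) = derivs (2 * k - 1) (φ.curve e) t := by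
  have h1 := congrArg (jetCoord e (2 * k - 1)) (h.jet_eq t)
  exact congrArg Prod.snd (h1.trans (φ.jetCoord_jet he _ ht))

theorem jetCoord_eq (h : PhaseVariation φ ε I Ψ) {p : ℝ × ℝ} (hp : p ∈ dom e ε Ψ) :
    jetCoord e _ (Ψ p).jet = (p.2, positions e Ψ p) :=
  Prod.ext (h.base_eq p.1 hp.1.1 p.2) rfl

/-- The base instant does not move with s, so the infinitesimal variation is vertical and pairs with
the momentum class. The definition of `boundary` uses no chart, so these local expressions p^i δq_i
are restrictions of one function of t. -/
theorem boundary_eq (h : PhaseVariation φ ε I Ψ) (he : IsAdapted π e) {t : ℝ}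
    (ht : φ.toFun t ∈ e.source) :
    boundary Ψ t = momenta e Ψ (0, t) (restr (Fib n) (by omega) (deltaPos e Ψ t)) := by
  have hd := h.mem_dom ht
  have h1 : ContMDiffAt 𝓘(ℝ, ℝ) 𝓘(ℝ, ℝ × ℝ) ∞ (fun s : ℝ => (s, t)) 0 :=
    (contDiff_id.prodMk contDiff_const).contMDiff.contMDiffAt
  have h2 : ContMDiffAt 𝓘(ℝ, ℝ) 𝓘(ℝ, JetCoord n (k - 1)) ∞ (fun s => (Ψ (s, t)).toJet) 0 :=
    ContMDiffAt.comp (g := fun p => (Ψ p).toJet) (0 : ℝ)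
      (contMDiff_phase_toJet.contMDiffAt.comp _ (h.contMDiffAt h.zero_mem)) h1
  have hpt : (Ψ (0, t)).toJet.pt ∈ e.source := by
    unfold Phase.toJet; rw [proj_pt]; exact hd.2
  have h3 := jetCoordDeriv_mfderiv he (h2.mdifferentiableAt (by simp)) hpt
  have hx := (((h.contDiffOn_positions he).contDiffAt
    ((h.isOpen_dom).mem_nhds hd)).differentiableAt (by simp)).hasFDerivAt
  have hx1 : HasDerivAt (fun s => positions e Ψ (s, t)) (deltaPos e Ψ t) 0 :=
    (HasFDerivAt.comp_hasDerivAt (x := (0 : ℝ)) (f := fun s : ℝ => (s, t)) hx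
      ((hasDerivAt_id _).prodMk (hasDerivAt_const _ _))).differentiableAt.hasDerivAt
  have h4 : HasDerivAt (fun s => jetCoord e (k - 1) (Ψ (s, t)).toJet)
      ((0 : ℝ), restr (Fib n) (by omega) (deltaPos e Ψ t)) 0 := by
    refine ((hasDerivAt_const _ t).prodMk ((restr (Fib n) (by omega :
      k - 1 ≤ 2 * k - 1)).hasFDerivAt.comp_hasDerivAt _ hx1)).congr_of_eventuallyEq ?_
    have h5 : ∀ᶠ s in 𝓝 (0 : ℝ), (s, t) ∈ dom e ε Ψ :=
      h1.continuousAt.eventually ((h.isOpen_dom).mem_nhds hd)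
    filter_upwards [h5] with s hs
    show jetCoord e (k - 1) ((Ψ (s, t)).jet.proj (k - 1) (by omega)) = _
    rw [jetCoord_proj he _ _ _ hs.2, h.jetCoord_eq hs]
    rfl
  have h6 := h3.unique h4
  have h7 := rep_eq_momCoord he hpt (Ψ (0, t)).mom (congrArg Prod.fst h6)
  exact h7.trans (congrArg (fun z : JetCoord n (k - 1) => momCoord e (Ψ (0, t)).mom z.2) h6)

theorem contDiff_boundary (h : PhaseVariation φ ε I Ψ) : ContDiff ℝ ∞ (boundary Ψ) := by
  rw [contDiff_iff_contDiffAt]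
  intro t
  have he := chartE_adapted (π := π) (φ.toFun t)
  have ht := mem_chartE_source (π := π) (φ.toFun t)
  set e := chartE π (φ.toFun t)
  have hd := h.mem_dom ht
  have hU := h.isOpen_dom (e := e)
  have hr : ContDiffAt ℝ ∞ (fun r : ℝ => ((0 : ℝ), r)) t := contDiffAt_const.prodMk contDiffAt_id
  have hev : ∀ᶠ r in 𝓝 t, φ.toFun r ∈ e.source := φ.eventually_mem ht
  have hxU : ContDiffOn ℝ ∞ (fun p : ℝ × ℝ => fderiv ℝ (positions e Ψ) p (1, 0)) (dom e ε Ψ) :=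
    ((h.contDiffOn_positions he).fderiv_of_isOpen hU (by simp)).clm_apply contDiffOn_const
  have h1 : ContDiffAt ℝ ∞ (fun r : ℝ => momenta e Ψ (0, r) (restr (Fib n)
      (by omega : k - 1 ≤ 2 * k - 1) (fderiv ℝ (positions e Ψ) (0, r) (1, 0)))) t :=
    (((h.contDiffOn_momenta he).contDiffAt (hU.mem_nhds hd)).comp t hr).clm_apply
      ((restr (Fib n) _).contDiff.contDiffAt.comp t
        ((hxU.contDiffAt (hU.mem_nhds hd)).comp t hr))
  refine h1.congr_of_eventuallyEq ?_
  filter_upwards [hev] with r hr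
  rw [h.boundary_eq he hr]
  have h2 := HasFDerivAt.comp_hasDerivAt (x := (0 : ℝ)) (f := fun s : ℝ => (s, r))
    (((h.contDiffOn_positions he).contDiffAt (hU.mem_nhds (h.mem_dom hr))).differentiableAt
      (by simp)).hasFDerivAt
    ((hasDerivAt_id _).prodMk (hasDerivAt_const _ _))
  rw [← h2.deriv]; rfl

theorem boundary_const (h : PhaseVariation φ ε I Ψ) {t : ℝ} (ht : t ∉ I) :
    boundary Ψ t = 0 := by
  have h1 : (fun s => (Ψ (s, t)).toJet) =ᶠ[𝓝 0] fun _ => (Ψ (0, t)).toJet := by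
    filter_upwards [isOpen_Ioo.mem_nhds h.zero_mem] with s hs
    rw [h.const s hs t ht]
  unfold boundary
  rw [h1.mfderiv_eq, mfderiv_const]
  exact map_zero _

variable [NeZero k]

/-- The integrand of the action along a variation. -/
def integrand (L : Jet π k → ℝ) (Ψ : ℝ × ℝ → Phase π k) (p : ℝ × ℝ) : ℝ :=
  pullCurve (thetaR L) (fun r => Ψ (p.1, r)) p.2

theorem integrand_eq (h : PhaseVariation φ ε I Ψ) (he : IsAdapted π e) (y₀ : Jet π k)
    {p : ℝ × ℝ} (hp : p ∈ dom e ε Ψ) :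
    integrand L Ψ p
      = unifiedIntegrand (lagrCoord he y₀ L) (positions e Ψ) (momenta e Ψ) p := by
  have hγ : MDifferentiableAt 𝓘(ℝ, ℝ) 𝓘(ℝ, PhaseCoord n k) (fun r => Ψ (p.1, r)) p.2 := by
    have h1 : ContMDiffAt 𝓘(ℝ, ℝ) 𝓘(ℝ, ℝ × ℝ) ∞ (fun r : ℝ => (p.1, r)) p.2 :=
      (contDiff_const.prodMk contDiff_id).contMDiff.contMDiffAt
    exact (ContMDiffAt.comp (g := Ψ) p.2 (h.contMDiffAt hp.1.1) h1).mdifferentiableAt (by simp)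
  refine (pullCurve_thetaR L he hγ hp.2
    (Eventually.of_forall fun r => h.base_eq p.1 hp.1.1 r)).trans ?_
  refine congrArg (fun a => a + _) ?_
  have h2 : ((Ψ p).jet.proj k (le_two_mul_sub_one k)).pt ∈ e.source := by
    rw [proj_pt]; exact hp.2
  show L ((Ψ p).jet.proj k (le_two_mul_sub_one k)) = _
  rw [← lagrCoord_jetCoord (L := L) he y₀ _ h2, jetCoord_proj he _ _ _ hp.2, h.jetCoord_eq hp]
  rfl

theorem mem_target (h : PhaseVariation φ ε I Ψ) (he : IsAdapted π e) (y₀ : Jet π k)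
    {p : ℝ × ℝ} (hp : p ∈ dom e ε Ψ) :
    (p.2, restr (Fib n) (le_two_mul_sub_one k) (positions e Ψ p)) ∈ (jetChart he y₀).target := by
  have h1 := jetCoord_fst he (Ψ p).jet hp.2
  rw [h.jetCoord_eq hp] at h1
  show (p.2, positions e Ψ p 0) ∈ e.target
  exact h1 ▸ e.map_source hp.2

theorem contDiffOn_integrand (h : PhaseVariation φ ε I Ψ)
    (hL : ContMDiff 𝓘(ℝ, JetCoord n k) 𝓘(ℝ, ℝ) ∞ L) :
    ContDiffOn ℝ ∞ (integrand L Ψ) (Ioo (-ε) ε ×ˢ univ) := by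
  intro p hp
  have he := chartE_adapted (π := π) (Ψ p).jet.pt
  have hpd : p ∈ dom (chartE π (Ψ p).jet.pt) ε Ψ := ⟨hp, mem_chartE_source (π := π) _⟩
  -- Any jet would do: it is only the default value of the inverse chart outside its domain.
  have y₀ := φ.jet k 0
  have h1 := (contDiffOn_unifiedIntegrand (contDiffOn_lagrCoord hL he y₀) (h.isOpen_dom)
    (h.contDiffOn_positions he) (h.contDiffOn_momenta he)
    fun p hp => h.mem_target he y₀ hp).congr fun p hp => h.integrand_eq he y₀ hp
  exact (h1.contDiffAt ((h.isOpen_dom).mem_nhds hpd)).contDiffWithinAt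

theorem integrand_const (h : PhaseVariation φ ε I Ψ) {s t : ℝ} (hs : s ∈ Ioo (-ε) ε)
    (ht : t ∉ I) : integrand L Ψ (s, t) = integrand L Ψ (0, t) := by
  have h1 : (fun r => Ψ (s, r)) =ᶠ[𝓝 t] fun r => Ψ (0, r) := by
    filter_upwards [h.compact.isClosed.isOpen_compl.mem_nhds ht] with r hr using h.const s hs r hr
  exact pullCurve_congr _ h1

/-- The integrand of the first variation, up to a total derivative. -/
def residual (L : Jet π k → ℝ) (Ψ : ℝ × ℝ → Phase π k) (t : ℝ) : ℝ :=
  deriv (fun s => integrand L Ψ (s, t)) 0 - deriv (boundary Ψ) t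

theorem residual_eq (h : PhaseVariation φ ε I Ψ) (hL : ContMDiff 𝓘(ℝ, JetCoord n k) 𝓘(ℝ, ℝ) ∞ L)
    (he : IsAdapted π e) (y₀ : Jet π k) {t : ℝ} (ht : φ.toFun t ∈ e.source) :
    residual L Ψ t = elResidual (lagrDiff he y₀ L (jetCurve k (φ.curve e) t))
      (momenta e Ψ (0, t)) (deriv (fun r => momenta e Ψ (0, r)) t) (deltaPos e Ψ t) := by
  have hd := h.mem_dom ht
  have hU := h.isOpen_dom (e := e)
  have hs1 : ∀ᶠ s in 𝓝 (0 : ℝ), (s, t) ∈ dom e ε Ψ :=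
    (by fun_prop : Continuous fun s : ℝ => (s, t)).continuousAt.eventually (hU.mem_nhds hd)
  have h1 : deriv (fun s => integrand L Ψ (s, t)) 0 = deriv (fun s =>
      unifiedIntegrand (lagrCoord he y₀ L) (positions e Ψ) (momenta e Ψ) (s, t)) 0 :=
    Filter.EventuallyEq.deriv_eq (hs1.mono fun s hs => h.integrand_eq he y₀ hs)
  have h2 : deriv (boundary Ψ) t = deriv (fun r => momenta e Ψ (0, r) (restr (Fib n) (by omega)
      (deriv (fun s => positions e Ψ (s, r)) 0))) t :=
    Filter.EventuallyEq.deriv_eq ((φ.eventually_mem ht).mono fun r hr => h.boundary_eq he hr)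
  unfold residual
  rw [h1, h2]
  exact deriv_unifiedIntegrand_sub hU (h.contDiffOn_positions he) (h.contDiffOn_momenta he) hd
    (φ.contDiffAt_curve he ht)
    ((φ.eventually_mem ht).mono fun r hr => h.positions_zero he hr)
    (((contDiffOn_lagrCoord hL he y₀).contDiffAt ((isOpen_jetChart_target he y₀).mem_nhds
      (jetCurve_mem_target he y₀ (φ.curve_mem_target he ht)))).differentiableAt (by simp))

/-- The boundary term is smooth and vanishes off the compact set I, so subtracting its derivative
does not affect the integral of the first variation. -/
theorem hasDerivAt_action (h : PhaseVariation φ ε I Ψ)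
    (hL : ContMDiff 𝓘(ℝ, JetCoord n k) 𝓘(ℝ, ℝ) ∞ L) {V : Set ℝ} (hIV : I ⊆ V) (hV : IsOpen V)
    (hint : IntegrableOn (pullCurve (thetaR L) fun r => Ψ (0, r)) V) :
    Continuous (residual L Ψ) ∧ (∀ t ∉ I, residual L Ψ t = 0) ∧
      HasDerivAt (fun s => ∫ t in V, pullCurve (thetaR L) (fun r => Ψ (s, r)) t)
        (∫ t, residual L Ψ t) 0 :=
  hasDerivAt_setIntegral_of_variation h.pos (h.contDiffOn_integrand hL) h.compact hIV hV
    (fun _ hs _ ht => h.integrand_const hs ht) hint h.contDiff_boundary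
    fun _ ht => h.boundary_const ht

end PhaseVariation

end PhaseVariations

/-! ### Local flows of vertical, compactly supported fields -/

section LocalFlows

variable {H M : Type*} [NormedAddCommGroup H] [NormedSpace ℝ H] [TopologicalSpace M]
  [ChartedSpace H M] {ρ : M → ℝ} {V : Set ℝ}
  {Z : ∀ x : M, TangentSpace 𝓘(ℝ, H) x} {ε : ℝ} {σ : ℝ → M → M}

theorem IsLocalFlow.zero_mem (hσ : IsLocalFlow Z ε σ) : (0 : ℝ) ∈ Ioo (-ε) ε :=
  ⟨by linarith [hσ.pos], hσ.pos⟩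

theorem IsLocalFlow.contMDiffOn_comp (hσ : IsLocalFlow Z ε σ) {γ : ℝ → M}
    (hγ : ContMDiff 𝓘(ℝ, ℝ) 𝓘(ℝ, H) ∞ γ) :
    ContMDiffOn 𝓘(ℝ, ℝ × ℝ) 𝓘(ℝ, H) ∞ (fun p : ℝ × ℝ => σ p.1 (γ p.2))
      (Ioo (-ε) ε ×ˢ univ) := by
  have h1 : ContMDiff 𝓘(ℝ, ℝ × ℝ) (𝓘(ℝ, ℝ).prod 𝓘(ℝ, H)) ∞ (fun p : ℝ × ℝ => (p.1, γ p.2)) :=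
    contDiff_fst.contMDiff.prodMk (hγ.comp contDiff_snd.contMDiff)
  exact hσ.smooth.comp h1.contMDiffOn fun p hp => ⟨hp.1, mem_univ _⟩

variable [IsManifold 𝓘(ℝ, H) ∞ M]

/-- At a zero of Z the constant curve is an integral curve, and integral curves are unique. Hence a
varied section stays fixed at the instants where it is off the support of Z. -/
theorem IsLocalFlow.eq_of_zero [T2Space M] [CompleteSpace H] (hσ : IsLocalFlow Z ε σ)
    (hZ : IsVariationField ρ V Z) {x : M} (hx : Z x = 0) {s : ℝ} (hs : s ∈ Ioo (-ε) ε) :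
    σ s x = x := by
  have hM : IsManifold 𝓘(ℝ, H) 1 M := IsManifold.of_le (n := ∞) (by simp)
  exact isMIntegralCurveOn_Ioo_eqOn_of_contMDiff_boundaryless hσ.zero_mem
    (hZ.smooth.of_le (by simp)) (hσ.integral x)
    ((isMIntegralCurve_const hx).isMIntegralCurveOn _) (hσ.zero x) hs

/-- Verticality makes the derivative of ρ along each integral curve zero. This is why the flow
carries sections to sections. -/
theorem IsLocalFlow.map_eq (hσ : IsLocalFlow Z ε σ) (hZ : IsVariationField ρ V Z)
    (hρ : ContMDiff 𝓘(ℝ, H) 𝓘(ℝ, ℝ) ∞ ρ) (x : M) {s : ℝ} (hs : s ∈ Ioo (-ε) ε) :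
    ρ (σ s x) = ρ x := by
  have hd : ∀ r ∈ Ioo (-ε) ε, HasDerivAt (fun r => ρ (σ r x)) 0 r := by
    intro r hr
    have h1 := (hσ.integral x r hr).hasMFDerivAt (isOpen_Ioo.mem_nhds hr)
    have h2 := ((hρ (σ r x)).mdifferentiableAt (by simp)).hasMFDerivAt.comp r h1
    have h3 : mfderiv 𝓘(ℝ, H) 𝓘(ℝ, ℝ) ρ (σ r x) ((1 : ℝ) • Z (σ r x)) = 0 := by
      rw [one_smul]; exact hZ.vertical _
    obtain ⟨A, hA, hA0⟩ : ∃ A : ℝ →L[ℝ] ℝ, HasFDerivAt (fun r => ρ (σ r x)) A r ∧ A 1 = 0 :=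
      ⟨_, hasMFDerivAt_iff_hasFDerivAt.1 h2, h3⟩
    exact hA.hasDerivAt.congr_deriv hA0
  have h := isOpen_Ioo.is_const_of_deriv_eq_zero isPreconnected_Ioo
    (fun r hr => (hd r hr).differentiableAt.differentiableWithinAt)
    (fun r hr => (hd r hr).deriv) hs hσ.zero_mem
  simpa [hσ.zero] using h

/-- The instants at which a section meets the support of a variation field. -/
theorem IsVariationField.isCompact_preimage (hZ : IsVariationField ρ V Z)
    (hρ : Continuous ρ) {γ : ℝ → M} (hγ : Continuous γ) (hργ : ∀ t, ρ (γ t) = t) :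
    IsCompact (γ ⁻¹' closure {x | Z x ≠ 0}) ∧ γ ⁻¹' closure {x | Z x ≠ 0} ⊆ V := by
  have hsub : γ ⁻¹' closure {x | Z x ≠ 0} ⊆ ρ '' closure {x | Z x ≠ 0} :=
    fun t ht => ⟨γ t, ht, hργ t⟩
  exact ⟨(hZ.compact.image hρ).of_isClosed_subset (isClosed_closure.preimage hγ) hsub,
    hsub.trans hZ.support_subset⟩

end LocalFlows

/-! ### Flows on W_r and on E as variations of holonomic sections -/

section SectionVariations

variable {n : ℕ} {E : Type u} [TopologicalSpace E] [ChartedSpace (ℝ × Fib n) E]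
  {π : FibreBundle n E} {e : OpenPartialHomeomorph E (ℝ × Fib n)}

theorem contMDiff_fibreBundle : ContMDiff 𝓘(ℝ, ℝ × Fib n) 𝓘(ℝ, ℝ) ∞ π.toFun := by
  intro x
  have he := chartE_adapted (π := π) x
  have hs := (chartE π x).open_source.mem_nhds (mem_chartE_source (π := π) x)
  have h1 := ContMDiffAt.comp (g := (Prod.fst : ℝ × Fib n → ℝ)) x
    contDiff_fst.contMDiff.contMDiffAt (he.contMDiffOn.contMDiffAt hs)
  refine h1.congr_of_eventuallyEq ?_
  filter_upwards [hs] with y hy using (he.fst_eq y hy).symm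

variable [IsManifold 𝓘(ℝ, ℝ × Fib n) ∞ E]

theorem Sec.jet_congr {φ φ' : Sec π} {t : ℝ} (h : φ.toFun =ᶠ[𝓝 t] φ'.toFun) (m : ℕ) :
    φ.jet m t = φ'.jet m t := by
  have he := chartE_adapted (π := π) (φ.toFun t)
  have ht := mem_chartE_source (π := π) (φ.toFun t)
  refine (LocalSection.jet_eq_iff he (f := φ.germ t) (g := φ'.germ t) ht
    (by rw [h.self_of_nhds] at ht; rw [h.self_of_nhds]; exact ht)).2
    ⟨rfl, fun i _ => Filter.EventuallyEq.iteratedDeriv_eq _ ?_⟩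
  filter_upwards [h] with s hs
  show (chartE π (φ.toFun t) (φ.toFun s)).2 = (chartE π (φ.toFun t) (φ'.toFun s)).2
  rw [hs]

/-- The prolongation of a smooth family of sections is smooth. -/
theorem contMDiffOn_jet_family {O : Set ℝ} (hO : IsOpen O) {Φ : ℝ → Sec π}
    (hΦ : ContMDiffOn 𝓘(ℝ, ℝ × ℝ) 𝓘(ℝ, ℝ × Fib n) ∞ (fun p : ℝ × ℝ => (Φ p.1).toFun p.2)
      (O ×ˢ univ)) (m : ℕ) :
    ContMDiffOn 𝓘(ℝ, ℝ × ℝ) 𝓘(ℝ, JetCoord n m) ∞ (fun p : ℝ × ℝ => (Φ p.1).jet m p.2)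
      (O ×ˢ univ) := by
  intro p hp
  have he := chartE_adapted (π := π) ((Φ p.1).toFun p.2)
  have ht := mem_chartE_source (π := π) ((Φ p.1).toFun p.2)
  set e := chartE π ((Φ p.1).toFun p.2)
  set U : Set (ℝ × ℝ) := (O ×ˢ univ) ∩ (fun p : ℝ × ℝ => (Φ p.1).toFun p.2) ⁻¹' e.source
  have hU : IsOpen U :=
    hΦ.continuousOn.isOpen_inter_preimage (hO.prod isOpen_univ) e.open_source
  have hUp : U ∈ 𝓝 p := hU.mem_nhds ⟨hp, ht⟩
  have hG : ContDiffOn ℝ ∞ (fun p : ℝ × ℝ => (Φ p.1).curve e p.2) U := by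
    intro r hr
    have h1 := ContMDiffAt.comp (g := e) r (he.contMDiffOn.contMDiffAt
      (e.open_source.mem_nhds hr.2)) (hΦ.contMDiffAt ((hO.prod isOpen_univ).mem_nhds hr.1))
    exact h1.contDiffAt.snd.contDiffWithinAt
  have hD : ContDiffOn ℝ ∞ (fun p : ℝ × ℝ => jetCurve m ((Φ p.1).curve e) p.2) U :=
    contDiffOn_snd.prodMk (contDiffOn_pi.2 fun i => contDiffOn_iteratedDeriv_param hU hG i)
  refine (contMDiffAt_jet_of_coord he ?_ ?_).contMDiffWithinAt
  · filter_upwards [hUp] with r hr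
    rw [Sec.pt_jet]; exact hr.2
  · refine (hD.contDiffAt hUp).contMDiffAt.congr_of_eventuallyEq ?_
    filter_upwards [hUp] with r hr using (Φ r.1).jetCoord_jet he m hr.2

variable {k : ℕ} {φ : Sec π} {V : Set ℝ} {ε : ℝ}

/-- The variation of a section of `W_r` by a flow. -/
theorem phaseVariation_of_flow [T2Space E] {ψ : ℝ → Phase π k}
    (hψ : ContMDiff 𝓘(ℝ, ℝ) 𝓘(ℝ, PhaseCoord n k) ∞ ψ)
    (hφ : ∀ t, (ψ t).jet = φ.jet (2 * k - 1) t)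
    {Z : ∀ w : Phase π k, TangentSpace 𝓘(ℝ, PhaseCoord n k) w} {σ : ℝ → Phase π k → Phase π k}
    (hZ : IsVariationField Phase.base V Z) (hσ : IsLocalFlow Z ε σ) :
    PhaseVariation φ ε (ψ ⁻¹' closure {x | Z x ≠ 0}) (fun p => σ p.1 (ψ p.2)) ∧
      ψ ⁻¹' closure {x | Z x ≠ 0} ⊆ V := by
  have hb : ∀ r, (ψ r).base = r := fun r => by
    show (ψ r).jet.base = r
    rw [hφ, φ.base_jet]
  have hK := hZ.isCompact_preimage contMDiff_phase_base.continuous hψ.continuous hb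
  refine ⟨⟨hσ.pos, hσ.contMDiffOn_comp hψ, fun s hs t => ?_, fun t => ?_, hK.1,
    fun s hs t ht => ?_⟩, hK.2⟩
  · rw [hσ.map_eq hZ contMDiff_phase_base _ hs, hb]
  · rw [hσ.zero, hφ]
  · have hx : Z (ψ t) = 0 := by
      by_contra hne
      exact ht (subset_closure hne)
    simp only [hσ.eq_of_zero hZ hx hs, hσ.zero]

variable [NeZero k] {L : Jet π k → ℝ}

/-- The momenta multiply dq_i/dt − q_{i+1}, which is zero on a holonomic section. The integrand is
thus the same for all momenta over φ, and so is the condition of absolute convergence. -/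
theorem pullCurve_thetaR_holonomic {ψ : ℝ → Phase π k}
    (hψ : ContMDiff 𝓘(ℝ, ℝ) 𝓘(ℝ, PhaseCoord n k) ∞ ψ)
    (hφ : ∀ t, (ψ t).jet = φ.jet (2 * k - 1) t) (t : ℝ) :
    pullCurve (thetaR L) ψ t = L (φ.jet k t) := by
  have he := chartE_adapted (π := π) (φ.toFun t)
  have ht := mem_chartE_source (π := π) (φ.toFun t)
  set e := chartE π (φ.toFun t)
  have hs : (ψ t).jet.pt ∈ e.source := by rwa [hφ, φ.pt_jet]
  have hb : ∀ r, (ψ r).base = r := fun r => by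
    show (ψ r).jet.base = r
    rw [hφ, φ.base_jet]
  have hq : ∀ᶠ r in 𝓝 t, (phaseCoord e (ψ r)).1.2 = derivs (2 * k - 1) (φ.curve e) r := by
    filter_upwards [φ.eventually_mem ht] with r hr
    exact congrArg Prod.snd ((congrArg (jetCoord e (2 * k - 1)) (hφ r)).trans
      (φ.jetCoord_jet he _ hr))
  have hd := φ.contDiffAt_curve he ht
  rw [pullCurve_thetaR L he ((hψ t).mdifferentiableAt (by simp)) hs (Eventually.of_forall hb),
    Filter.EventuallyEq.deriv_eq hq, hq.self_of_nhds]
  have h1 : restr (Fib n) (by omega : k - 1 ≤ 2 * k - 1)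
      (deriv (derivs (2 * k - 1) (φ.curve e)) t)
      - shift (Fib n) (pred_succ_le k) (derivs (2 * k - 1) (φ.curve e) t) = 0 := by
    rw [← (hasDerivAt_derivs (pred_succ_le k) hd).deriv, sub_eq_zero]
    exact (((restr (Fib n) (by omega : k - 1 ≤ 2 * k - 1)).hasFDerivAt.comp_hasDerivAt t
      ((contDiffAt_derivs (2 * k - 1) hd).differentiableAt (by simp)).hasDerivAt).deriv).symm
  rw [h1, map_zero, add_zero]
  show L ((ψ t).jet.proj k _) = _
  rw [hφ, φ.proj_jet]

theorem pullCurve_thetaL (hL : ContMDiff 𝓘(ℝ, JetCoord n k) 𝓘(ℝ, ℝ) ∞ L) (φ : Sec π) (t : ℝ) :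
    pullCurve (thetaL L) (φ.jet (2 * k - 1)) t
      = pullCurve (thetaR L) (fun r => legendreGraph L (φ.jet (2 * k - 1) r)) t := by
  have h1 := mfderiv_comp t
    ((contMDiff_legendreGraph hL (φ.jet (2 * k - 1) t)).mdifferentiableAt (by simp))
    ((φ.contMDiff_jet (2 * k - 1) t).mdifferentiableAt (by simp))
  exact (congrArg (fun A : ℝ →L[ℝ] PhaseCoord n k =>
    (thetaR L (legendreGraph L (φ.jet (2 * k - 1) t)) : PhaseCoord n k →L[ℝ] ℝ) (A 1)) h1).symm

theorem pullCurve_thetaR_eq_thetaL (hL : ContMDiff 𝓘(ℝ, JetCoord n k) 𝓘(ℝ, ℝ) ∞ L)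
    {ψ : ℝ → Phase π k} (hψ : ContMDiff 𝓘(ℝ, ℝ) 𝓘(ℝ, PhaseCoord n k) ∞ ψ)
    (hφ : ∀ t, (ψ t).jet = φ.jet (2 * k - 1) t) :
    pullCurve (thetaR L) ψ = pullCurve (thetaL L) (φ.jet (2 * k - 1)) := by
  funext t
  rw [pullCurve_thetaL hL, pullCurve_thetaR_holonomic hψ hφ]
  exact (pullCurve_thetaR_holonomic (ψ := fun r => legendreGraph L (φ.jet (2 * k - 1) r))
    ((contMDiff_legendreGraph hL).comp (φ.contMDiff_jet _)) (fun _ => rfl) t).symm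

/-- The variation of the Legendre lift of a section of `π` by a flow on `E`. -/
theorem phaseVariation_of_section_flow [T2Space E]
    (hL : ContMDiff 𝓘(ℝ, JetCoord n k) 𝓘(ℝ, ℝ) ∞ L)
    {Z : ∀ x : E, TangentSpace 𝓘(ℝ, ℝ × Fib n) x} {σ : ℝ → E → E}
    (hZ : IsVariationField π.toFun V Z) (hσ : IsLocalFlow Z ε σ) {Φ : ℝ → Sec π}
    (hΦ : ∀ s ∈ Ioo (-ε) ε, ∀ t, (Φ s).toFun t = σ s (φ.toFun t)) :
    PhaseVariation φ ε (φ.toFun ⁻¹' closure {x | Z x ≠ 0})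
      (fun p => legendreGraph L ((Φ p.1).jet (2 * k - 1) p.2)) ∧
      φ.toFun ⁻¹' closure {x | Z x ≠ 0} ⊆ V := by
  have hK := hZ.isCompact_preimage contMDiff_fibreBundle.continuous φ.smooth.continuous
    φ.isSection
  have h0 : ∀ t, (Φ 0).toFun t = φ.toFun t := fun t => by
    rw [hΦ 0 hσ.zero_mem, hσ.zero]
  have hfam := (hσ.contMDiffOn_comp φ.smooth).congr
    (f₁ := fun p : ℝ × ℝ => (Φ p.1).toFun p.2) fun p hp => hΦ p.1 hp.1 p.2
  refine ⟨⟨hσ.pos, (contMDiff_legendreGraph hL).comp_contMDiffOn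
    (contMDiffOn_jet_family isOpen_Ioo hfam _), fun s hs t => (Φ s).base_jet _ t,
    fun t => Sec.jet_congr (Eventually.of_forall h0) _, hK.1, fun s hs t ht => ?_⟩, hK.2⟩
  -- Equality of jets at t requires the sections to agree near t; this holds because the instants in
  -- the support form a closed set.
  refine congrArg (legendreGraph L) (Sec.jet_congr ?_ _)
  filter_upwards [hK.1.isClosed.isOpen_compl.mem_nhds ht] with r hr
  have hx : Z (φ.toFun r) = 0 := by
    by_contra hne
    exact hr (subset_closure hne)
  rw [h0, hΦ s hs, hσ.eq_of_zero hZ hx hs]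

end SectionVariations

/-! ### Criticality and the Euler–Lagrange equations -/

section Stationarity

variable {n : ℕ} {E : Type u} [TopologicalSpace E] [ChartedSpace (ℝ × Fib n) E]
  {π : FibreBundle n E} [IsManifold 𝓘(ℝ, ℝ × Fib n) ∞ E]
  {e : OpenPartialHomeomorph E (ℝ × Fib n)} {k : ℕ} {φ : Sec π} {ε : ℝ} {V I : Set ℝ}
  {Ψ : ℝ × ℝ → Phase π k} {L : Jet π k → ℝ}

/-- The Euler-Lagrange equations in natural coordinates around `t`. -/
theorem elCovector_apply (hL : ContMDiff 𝓘(ℝ, JetCoord n k) 𝓘(ℝ, ℝ) ∞ L) (he : IsAdapted π e)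
    (y₀ : Jet π k) {t : ℝ} (ht : φ.toFun t ∈ e.source) (a : Fib n) :
    ∑ i : Fin (k + 1), (-1 : ℝ) ^ (i : ℕ) * iteratedDeriv i (fun s =>
        partialL he y₀ L i (jetCoord e k (φ.jet k s)) a) t
      = elCovector he y₀ L (φ.curve e) t a := by
  unfold elCovector altSum
  rw [sum_apply, ← Fin.sum_univ_eq_sum_range (fun i => ((-1 : ℝ) ^ i • iteratedDeriv i (fun s =>
    comps (lagrDiff he y₀ L (jetCurve k (φ.curve e) s)) (0 + i)) t) a)]
  refine Finset.sum_congr rfl fun i _ => ?_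
  have h1 : (fun s => partialL he y₀ L i (jetCoord e k (φ.jet k s)) a) =ᶠ[𝓝 t] fun s =>
      ContinuousLinearMap.apply ℝ ℝ a
        (comps (lagrDiff he y₀ L (jetCurve k (φ.curve e) s)) (0 + i)) := by
    filter_upwards [φ.eventually_mem ht] with s hs
    rw [φ.jetCoord_jet he k hs, zero_add, comps_lagrDiff he y₀ L _ i.2]
    rfl
  have h2 := contDiffAt_comps (contDiffAt_lagrDiff_jetCurve hL he y₀ (φ.contDiffAt_curve he ht)
    (φ.curve_mem_target he ht)) (0 + i)
  rw [h1.iteratedDeriv_eq, iteratedDeriv_clm _ _ (h2.of_le (by exact_mod_cast le_top))]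
  rfl

variable [NeZero k]

open PhaseVariation

/-- The residual involves the momenta only along s = 0, where they are the Legendre ones, so it
telescopes. The varied sections themselves may leave the Legendre graph. -/
theorem PhaseVariation.residual_legendreGraph (h : PhaseVariation φ ε I Ψ)
    (hΨ : ∀ t, Ψ (0, t) = legendreGraph L (φ.jet (2 * k - 1) t))
    (hL : ContMDiff 𝓘(ℝ, JetCoord n k) 𝓘(ℝ, ℝ) ∞ L) (he : IsAdapted π e) (y₀ : Jet π k) {t : ℝ}
    (ht : φ.toFun t ∈ e.source) :
    residual L Ψ t = elCovector he y₀ L (φ.curve e) t (deltaPos e Ψ t 0) := by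
  have h1 : ∀ r, φ.toFun r ∈ e.source →
      momenta e Ψ (0, r) = legendreFun he y₀ L (jetCurve (2 * k - 1) (φ.curve e) r) := by
    intro r hr
    have h2 : (φ.jet (2 * k - 1) r).pt ∈ e.source := by rwa [φ.pt_jet]
    have h3 := congrArg Prod.snd (phaseCoord_legendreGraph hL he y₀ _ h2)
    rw [φ.jetCoord_jet he _ hr, ← hΨ r] at h3
    exact h3
  rw [h.residual_eq hL he y₀ ht, h1 t ht,
    Filter.EventuallyEq.deriv_eq ((φ.eventually_mem ht).mono fun r hr => h1 r hr),
    elResidual_legendreFun hL he y₀ (φ.eventually_contDiffAt_curve he ht)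
      (φ.curve_mem_target he ht)]

/-- Flows on W_r and lifted flows on E both give variations of the Legendre lift, so this one
statement yields criticality in both problems. The equations are needed over V only, as the residual
vanishes off I. -/
theorem PhaseVariation.hasDerivAt_action_zero (h : PhaseVariation φ ε I Ψ)
    (hL : ContMDiff 𝓘(ℝ, JetCoord n k) 𝓘(ℝ, ℝ) ∞ L) (hIV : I ⊆ V) (hV : IsOpen V)
    (hΨ : ∀ t, Ψ (0, t) = legendreGraph L (φ.jet (2 * k - 1) t))
    (hint : IntegrableOn (pullCurve (thetaL L) (φ.jet (2 * k - 1))) V)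
    (hEL : ∀ (e : OpenPartialHomeomorph E (ℝ × Fib n)) (he : IsAdapted π e) (y₀ : Jet π k),
      ∀ t ∈ V, φ.toFun t ∈ e.source → elCovector he y₀ L (φ.curve e) t = 0) :
    HasDerivAt (fun s => ∫ t in V, pullCurve (thetaR L) (fun r => Ψ (s, r)) t) 0 0 := by
  have h0 : (fun r => Ψ (0, r)) = fun r => legendreGraph L (φ.jet (2 * k - 1) r) := funext hΨ
  have hint' : IntegrableOn (pullCurve (thetaR L) fun r => Ψ (0, r)) V := by
    rw [h0]
    exact hint.congr_fun (fun t _ => pullCurve_thetaL hL φ t) hV.measurableSet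
  obtain ⟨-, h1, h2⟩ := h.hasDerivAt_action hL hIV hV hint'
  have h3 : ∀ t, residual L Ψ t = 0 := by
    intro t
    by_cases ht : t ∈ I
    · have y₀ := φ.jet k 0
      rw [h.residual_legendreGraph hΨ hL (chartE_adapted (φ.toFun t)) y₀
        (mem_chartE_source (π := π) _), hEL _ _ _ t (hIV ht) (mem_chartE_source (π := π) _)]
      rfl
    · exact h1 t ht
  simpa [h3] using h2

/-- If the derivative of the action vanishes, a residual of constant sign vanishes. -/
theorem PhaseVariation.residual_eq_zero (h : PhaseVariation φ ε I Ψ)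
    (hL : ContMDiff 𝓘(ℝ, JetCoord n k) 𝓘(ℝ, ℝ) ∞ L) (hIV : I ⊆ V) (hV : IsOpen V)
    (hint : IntegrableOn (pullCurve (thetaR L) fun r => Ψ (0, r)) V)
    (hd : HasDerivAt (fun s => ∫ t in V, pullCurve (thetaR L) (fun r => Ψ (s, r)) t) 0 0)
    {c : ℝ} (hc : c ≠ 0) (hpos : ∀ t, 0 ≤ residual L Ψ t * c) (t : ℝ) : residual L Ψ t = 0 := by
  obtain ⟨h1, h2, h3⟩ := h.hasDerivAt_action hL hIV hV hint
  have h4 := eq_zero_of_integral_eq_zero (R := fun t => residual L Ψ t * c)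
    (h1.mul continuous_const) h.compact
    (fun t ht => by rw [h2 t ht, zero_mul]) hpos
    (by rw [integral_mul_const, h3.unique hd, zero_mul]) t
  exact (mul_eq_zero.1 h4).resolve_right hc

variable [T2Space E]

theorem isCriticalL_of_elCovector (hL : ContMDiff 𝓘(ℝ, JetCoord n k) 𝓘(ℝ, ℝ) ∞ L) (hV : IsOpen V)
    (hint : IntegrableOn (pullCurve (thetaL L) (φ.jet (2 * k - 1))) V)
    (hEL : ∀ (e : OpenPartialHomeomorph E (ℝ × Fib n)) (he : IsAdapted π e) (y₀ : Jet π k),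
      ∀ t ∈ V, φ.toFun t ∈ e.source → elCovector he y₀ L (φ.curve e) t = 0) :
    IsCriticalL L V φ := by
  refine ⟨hint, fun Z hZ ε σ hσ Φ hΦ => ?_⟩
  obtain ⟨h, hIV⟩ := phaseVariation_of_section_flow hL hZ hσ hΦ
  have h1 := h.hasDerivAt_action_zero hL hIV hV (fun t => ?_) hint hEL
  · simpa only [pullCurve_thetaL hL] using h1
  · exact congrArg (legendreGraph L) (h.jet_eq t)

theorem isCriticalLH_of_elCovector (hL : ContMDiff 𝓘(ℝ, JetCoord n k) 𝓘(ℝ, ℝ) ∞ L) (hV : IsOpen V)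
    (hint : IntegrableOn (pullCurve (thetaL L) (φ.jet (2 * k - 1))) V)
    (hEL : ∀ (e : OpenPartialHomeomorph E (ℝ × Fib n)) (he : IsAdapted π e) (y₀ : Jet π k),
      ∀ t ∈ V, φ.toFun t ∈ e.source → elCovector he y₀ L (φ.curve e) t = 0) :
    IsCriticalLH L V (fun t => legendreGraph L (φ.jet (2 * k - 1) t)) := by
  have hψ : ContMDiff 𝓘(ℝ, ℝ) 𝓘(ℝ, PhaseCoord n k) ∞
      (fun t => legendreGraph L (φ.jet (2 * k - 1) t)) :=
    (contMDiff_legendreGraph hL).comp (φ.contMDiff_jet _)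
  refine ⟨hint.congr_fun (fun t _ => pullCurve_thetaL hL φ t) hV.measurableSet,
    fun Z hZ ε σ hσ => ?_⟩
  obtain ⟨h, hIV⟩ := phaseVariation_of_flow hψ (fun _ => rfl) hZ hσ
  exact h.hasDerivAt_action_zero hL hIV hV (fun t => hσ.zero _) hint hEL

/-- The fundamental lemma for the unified action: variations along a constant direction in natural
coordinates. -/
theorem elResidual_eq_zero_of_isCriticalLH (hL : ContMDiff 𝓘(ℝ, JetCoord n k) 𝓘(ℝ, ℝ) ∞ L)
    (hV : IsOpen V) {ψ : ℝ → Phase π k} (hψ : ContMDiff 𝓘(ℝ, ℝ) 𝓘(ℝ, PhaseCoord n k) ∞ ψ)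
    (hφ : ∀ t, (ψ t).jet = φ.jet (2 * k - 1) t) (hcrit : IsCriticalLH L V ψ)
    (he : IsAdapted π e) (y₀ : Jet π k) {t : ℝ} (htV : t ∈ V) (ht : φ.toFun t ∈ e.source) :
    elResidual (lagrDiff he y₀ L (jetCurve k (φ.curve e) t)) (phaseCoord e (ψ t)).2
      (deriv (fun r => (phaseCoord e (ψ r)).2) t) = 0 := by
  ext1 u
  by_contra hne
  rw [zero_apply] at hne
  have hb : ∀ r, (ψ r).base = r := fun r => by
    show (ψ r).jet.base = r
    rw [hφ, φ.base_jet]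
  have hpt : ∀ r, (ψ r).jet.pt = φ.toFun r := fun r => by rw [hφ, φ.pt_jet]
  set g : ℝ → ℝ := fun r => elResidual (lagrDiff he y₀ L (jetCurve k (φ.curve e) r))
    (phaseCoord e (ψ r)).2 (deriv (fun r => (phaseCoord e (ψ r)).2) r) u with hg
  have hgt : g t ≠ 0 := hne
  have hu : u ≠ 0 := by
    rintro rfl
    exact hgt (map_zero _)
  have hgc : ContinuousAt g t := by
    have h1 := (contDiffAt_lagrDiff_jetCurve hL he y₀ (φ.contDiffAt_curve he ht)
      (φ.curve_mem_target he ht)).continuousAt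
    have h2 : ContDiffAt ℝ ∞ (fun r => (phaseCoord e (ψ r)).2) t :=
      (ContMDiffAt.comp (g := phaseCoord e) t
        (contMDiffAt_phaseCoord he (by rw [hpt]; exact ht)) (hψ t)).contDiffAt.snd
    exact ((h1.clm_apply continuousAt_const).sub (h2.continuousAt.clm_apply continuousAt_const)).sub
      ((contDiffAt_deriv_of h2).continuousAt.clm_apply continuousAt_const)
  have hx₀ : ψ t ∈ (phaseHomeo he (ψ t)).source := by
    show (ψ t).jet.pt ∈ e.source
    rw [hpt]; exact ht
  have hT : Tendsto (Phase.base : Phase π k → ℝ) (𝓝 (ψ t)) (𝓝 t) := by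
    have := (contMDiff_phase_base (π := π) (k := k)).continuous.tendsto (ψ t)
    rwa [hb] at this
  have hgN : ∀ᶠ r in 𝓝 t, 0 < g r * g t :=
    (hgc.mul continuousAt_const).eventually (lt_mem_nhds (mul_self_pos.2 hgt))
  -- The field will be supported where the coefficient g keeps the sign of its value at t.
  set N : Set (Phase π k) := {w | w.jet.pt ∈ e.source ∧ w.base ∈ V ∧ 0 < g w.base * g t} with hN
  have hNt : N ∈ 𝓝 (ψ t) := by
    filter_upwards [(phaseHomeo he (ψ t)).open_source.mem_nhds hx₀,
      hT.eventually (hV.mem_nhds htV), hT.eventually hgN] with w h1 h2 h3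
    exact ⟨h1, h2, h3⟩
  -- The direction moves the positions by a multiple of the constant tuple u and leaves the momenta
  -- fixed. It need not be the prolongation of a variation on E, which is why every component of the
  -- residual is reached.
  obtain ⟨Z, σ, F, w, hZ, hZN, hσ, -, -, hw0, hwt, hwN, -, hFd, hflow⟩ :=
    exists_chart_variation (phaseHomeo he (ψ t)) (contMDiffOn_phaseHomeo he _)
      (contMDiffOn_phaseHomeo_symm he _) (ρ := Phase.base)
      (ℓ := ContinuousLinearMap.fst ℝ ℝ (Fin (2 * k - 1 + 1) → Fib n) ∘L
        ContinuousLinearMap.fst ℝ (JetCoord n (2 * k - 1)) _) (fun x _ => rfl) (V := V) hx₀ hNt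
      (by rintro _ ⟨x, hx, rfl⟩; exact hx.2.1) (v := (((0 : ℝ), u), 0))
      (fun h => hu (congrArg (fun z : PhaseCoord n k => z.1.2) h)) rfl
  obtain ⟨h, hIV⟩ := phaseVariation_of_flow hψ hφ hZ hσ
  have h0 : (fun r => σ 0 (ψ r)) = ψ := funext fun r => hσ.zero _
  have hres : ∀ r, φ.toFun r ∈ e.source →
      residual L (fun p => σ p.1 (ψ p.2)) r = w (phaseCoord e (ψ r)) * g r := by
    intro r hr
    have hrs : ψ r ∈ (phaseHomeo he (ψ t)).source := by
      show (ψ r).jet.pt ∈ e.source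
      rw [hpt]; exact hr
    have h1 : deltaPos e (fun p => σ p.1 (ψ p.2)) r = w (phaseCoord e (ψ r)) • u := by
      have h2 : (fun s => positions e (fun p : ℝ × ℝ => σ p.1 (ψ p.2)) (s, r)) =ᶠ[𝓝 0] fun s =>
          (phaseCoord e (ψ r)).1.2 + F (s, phaseCoord e (ψ r)) • u := by
        filter_upwards [isOpen_Ioo.mem_nhds hσ.zero_mem] with s hs
        exact congrArg (fun z : PhaseCoord n k => z.1.2) (hflow s hs (ψ r) hrs).2
      exact (((hFd (phaseCoord e (ψ r))).smul_const u).const_add _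
        |>.congr_of_eventuallyEq h2).deriv
    have h3 : (fun r => momenta e (fun p : ℝ × ℝ => σ p.1 (ψ p.2)) (0, r))
        = fun r => (phaseCoord e (ψ r)).2 := by
      funext r
      show (phaseCoord e (σ 0 (ψ r))).2 = _
      rw [hσ.zero]
    rw [h.residual_eq hL he y₀ hr, h1, h3, map_smul, smul_eq_mul]
    exact congrArg (fun β => w (phaseCoord e (ψ r)) * elResidual _ β _ u) (congrFun h3 r)
  -- The residual is w · g in the chart, so its product with g t is nonnegative and has zero
  -- integral; yet at t it is a positive multiple of the square of g t.
  have hzero := h.residual_eq_zero hL hIV hV (by rw [h0]; exact hcrit.1)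
    (hcrit.2 Z hZ 1 σ hσ) hgt (fun r => ?_) t
  · rw [hres t ht] at hzero
    exact mul_ne_zero hwt.ne' hgt hzero
  · by_cases hrN : ψ r ∈ N
    · have hr : φ.toFun r ∈ e.source := by rw [← hpt]; exact hrN.1
      have h4 := hrN.2.2
      rw [hb] at h4
      rw [hres r hr, mul_assoc]
      exact mul_nonneg (hw0 _) h4.le
    · have h5 : residual L (fun p => σ p.1 (ψ p.2)) r = 0 :=
        (h.hasDerivAt_action hL hIV hV (by rw [h0]; exact hcrit.1)).2.1 r fun hr => hrN (hZN hr)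
      rw [h5, zero_mul]

/-- It is not assumed that ψ takes values in the Legendre graph: the vanishing of the residual near
t determines the momenta. Openness of V supplies the neighbourhood needed to differentiate them. -/
theorem elCovector_eq_zero_of_isCriticalLH (hL : ContMDiff 𝓘(ℝ, JetCoord n k) 𝓘(ℝ, ℝ) ∞ L)
    (hV : IsOpen V) {ψ : ℝ → Phase π k} (hψ : ContMDiff 𝓘(ℝ, ℝ) 𝓘(ℝ, PhaseCoord n k) ∞ ψ)
    (hφ : ∀ t, (ψ t).jet = φ.jet (2 * k - 1) t) (hcrit : IsCriticalLH L V ψ)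
    (he : IsAdapted π e) (y₀ : Jet π k) {t : ℝ} (htV : t ∈ V) (ht : φ.toFun t ∈ e.source) :
    elCovector he y₀ L (φ.curve e) t = 0 := by
  have hev := φ.eventually_mem ht
  refine altSum_eq_zero_of_elResidual (β := fun r => (phaseCoord e (ψ r)).2)
    (hev.mono fun s hs => contDiffAt_lagrDiff_jetCurve hL he y₀ (φ.contDiffAt_curve he hs)
      (φ.curve_mem_target he hs)) (hev.mono fun s hs => ?_) ?_
  · exact ((ContMDiffAt.comp (g := phaseCoord e) s
        (contMDiffAt_phaseCoord he (by rw [hφ, φ.pt_jet]; exact hs))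
        (hψ s)).contDiffAt.snd).differentiableAt (by simp)
  · filter_upwards [hev, hV.mem_nhds htV] with s hs hsV
    exact elResidual_eq_zero_of_isCriticalLH hL hV hψ hφ hcrit he y₀ hsV hs

open Classical in
/-- The sections obtained from a section by a local flow of a vertical vector field. -/
def Sec.flow (φ : Sec π) {Z : ∀ x : E, TangentSpace 𝓘(ℝ, ℝ × Fib n) x} {σ : ℝ → E → E}
    (hZ : IsVariationField π.toFun V Z) (hσ : IsLocalFlow Z ε σ) (s : ℝ) : Sec π :=
  if hs : s ∈ Ioo (-ε) ε then
    { toFun := fun t => σ s (φ.toFun t)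
      smooth := by
        intro t
        exact ContMDiffAt.comp (g := fun p : ℝ × ℝ => σ p.1 (φ.toFun p.2)) t
          ((hσ.contMDiffOn_comp φ.smooth).contMDiffAt
            ((isOpen_Ioo.prod isOpen_univ).mem_nhds ⟨hs, mem_univ t⟩))
          (contDiff_const.prodMk contDiff_id : ContDiff ℝ ∞ fun t : ℝ => (s, t)).contMDiff.contMDiffAt
      isSection := fun t => by
        rw [hσ.map_eq hZ contMDiff_fibreBundle _ hs, φ.isSection] }
  -- A default value, invisible to the derivative at s = 0.
  else φ

/-- The sign argument used on W_r, now with a field on E in the constant direction a. On the lifted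
variation the residual depends on δq_0 alone, which is w · a, so the derivatives of w that appear in
the prolongation play no role. -/
theorem elCovector_eq_zero_of_isCriticalL (hL : ContMDiff 𝓘(ℝ, JetCoord n k) 𝓘(ℝ, ℝ) ∞ L)
    (hV : IsOpen V) (hcrit : IsCriticalL L V φ) (he : IsAdapted π e) (y₀ : Jet π k) {t : ℝ}
    (htV : t ∈ V) (ht : φ.toFun t ∈ e.source) : elCovector he y₀ L (φ.curve e) t = 0 := by
  ext1 a
  by_contra hne
  rw [zero_apply] at hne
  set g : ℝ → ℝ := fun r => elCovector he y₀ L (φ.curve e) r a with hg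
  have hgt : g t ≠ 0 := hne
  have ha : a ≠ 0 := by
    rintro rfl
    exact hgt (map_zero _)
  have hgc : ContinuousAt g t :=
    (contDiffAt_altSum (fun r => contDiffAt_comps (contDiffAt_lagrDiff_jetCurve hL he y₀
      (φ.contDiffAt_curve he ht) (φ.curve_mem_target he ht)) r) _ _).continuousAt.clm_apply
        continuousAt_const
  have hT : Tendsto π.toFun (𝓝 (φ.toFun t)) (𝓝 t) := by
    have := (contMDiff_fibreBundle (π := π)).continuous.tendsto (φ.toFun t)
    rwa [φ.isSection] at this
  have hgN : ∀ᶠ r in 𝓝 t, 0 < g r * g t :=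
    (hgc.mul continuousAt_const).eventually (lt_mem_nhds (mul_self_pos.2 hgt))
  set N : Set E := {x | x ∈ e.source ∧ π.toFun x ∈ V ∧ 0 < g (π.toFun x) * g t} with hN
  have hNt : N ∈ 𝓝 (φ.toFun t) := by
    filter_upwards [e.open_source.mem_nhds ht,
      hT.eventually (hV.mem_nhds htV), hT.eventually hgN] with w h1 h2 h3
    exact ⟨h1, h2, h3⟩
  obtain ⟨Z, σ, F, w, hZ, hZN, hσ, -, -, hw0, hwt, hwN, -, hFd, hflow⟩ :=
    exists_chart_variation e he.contMDiffOn he.contMDiffOn_symm (ρ := π.toFun)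
      (ℓ := ContinuousLinearMap.fst ℝ ℝ (Fib n)) (fun x hx => (he.fst_eq x hx).symm) (V := V) ht hNt
      (by rintro _ ⟨x, hx, rfl⟩; exact hx.2.1) (v := ((0 : ℝ), a))
      (fun h => ha (congrArg Prod.snd h)) rfl
  have hΦ : ∀ s ∈ Ioo (-1 : ℝ) 1, ∀ t, (φ.flow hZ hσ s).toFun t = σ s (φ.toFun t) := by
    intro s hs t
    unfold Sec.flow
    rw [dif_pos hs]
  obtain ⟨h, hIV⟩ := phaseVariation_of_section_flow hL hZ hσ hΦ
  set Ψ : ℝ × ℝ → Phase π k :=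
    fun p => legendreGraph L ((φ.flow hZ hσ p.1).jet (2 * k - 1) p.2) with hΨdef
  have hΨ : ∀ r, Ψ (0, r) = legendreGraph L (φ.jet (2 * k - 1) r) := fun r =>
    congrArg (legendreGraph L) (h.jet_eq r)
  have hint : IntegrableOn (pullCurve (thetaR L) fun r => Ψ (0, r)) V := by
    rw [funext hΨ]
    exact hcrit.1.congr_fun (fun t _ => pullCurve_thetaL hL φ t) hV.measurableSet
  have hd : HasDerivAt (fun s => ∫ t in V, pullCurve (thetaR L) (fun r => Ψ (s, r)) t) 0 0 := by
    simpa only [pullCurve_thetaL hL] using hcrit.2 Z hZ 1 σ hσ _ hΦ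
  have hres : ∀ r, φ.toFun r ∈ e.source →
      residual L Ψ r = w (e (φ.toFun r)) * g r := by
    intro r hr
    have h1 : deltaPos e Ψ r 0 = w (e (φ.toFun r)) • a := by
      have hx := (((h.contDiffOn_positions he).contDiffAt
        ((h.isOpen_dom (e := e)).mem_nhds (h.mem_dom hr))).differentiableAt (by simp)).hasFDerivAt
      have h2 : HasDerivAt (fun s => positions e Ψ (s, r)) (deltaPos e Ψ r) 0 :=
        (HasFDerivAt.comp_hasDerivAt (x := (0 : ℝ)) (f := fun s : ℝ => (s, r)) hx
          ((hasDerivAt_id _).prodMk (hasDerivAt_const _ _))).differentiableAt.hasDerivAt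
      have h3 : (fun s => positions e Ψ (s, r) 0) =ᶠ[𝓝 0] fun s =>
          (e (φ.toFun r)).2 + F (s, e (φ.toFun r)) • a := by
        filter_upwards [isOpen_Ioo.mem_nhds hσ.zero_mem] with s hs
        obtain ⟨h4, h5⟩ := hflow s hs _ hr
        rw [← hΦ s hs] at h4 h5
        have h6 := congrArg (fun z : JetCoord n (2 * k - 1) => z.2 0)
          ((φ.flow hZ hσ s).jetCoord_jet he (2 * k - 1) h4)
        refine h6.trans ?_
        exact (congrFun iteratedDeriv_zero r).trans (congrArg Prod.snd h5)
      exact ((hasDerivAt_pi.1 h2 0)).unique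
        ((((hFd (e (φ.toFun r))).smul_const a).const_add _).congr_of_eventuallyEq h3)
    rw [h.residual_legendreGraph hΨ hL he y₀ hr, h1, map_smul, smul_eq_mul]
  have hzero := h.residual_eq_zero hL hIV hV hint hd hgt (fun r => ?_) t
  · rw [hres t ht] at hzero
    exact mul_ne_zero hwt.ne' hgt hzero
  · by_cases hrN : φ.toFun r ∈ N
    · have h4 := hrN.2.2
      rw [φ.isSection] at h4
      rw [hres r hrN.1, mul_assoc]
      exact mul_nonneg (hw0 _) h4.le
    · rw [(h.hasDerivAt_action hL hIV hV hint).2.1 r fun hr => hrN (hZN hr), zero_mul]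

end Stationarity

end HOMech

end

/-! ### The equivalence theorem -/

theorem mainTheorem2 {n k : ℕ} [NeZero k] {E : Type*} [TopologicalSpace E] [T2Space E]
    [SecondCountableTopology E] [ChartedSpace (ℝ × Fib n) E]
    [IsManifold 𝓘(ℝ, ℝ × Fib n) ∞ E] (π : FibreBundle n E)
    (L : Jet π k → ℝ) (hL : ContMDiff 𝓘(ℝ, JetCoord n k) 𝓘(ℝ, ℝ) ∞ L)
    (V : Set ℝ) (hV : IsOpen V) :
    (∀ ψ : ℝ → Phase π k, IsSolutionLH L V ψ →
      IsSmoothSection (H := JetCoord n (2 * k - 1)) Jet.base (fun t => (ψ t).jet) ∧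
      IsHolonomic (fun t => (ψ t).jet) ∧
      ∃ φ : Sec π, (∀ t, φ.toFun t = (ψ t).jet.pt) ∧ IsCriticalL L V φ ∧
        SatisfiesEulerLagrange L V φ) ∧
    (∀ φ : Sec π, IsCriticalL L V φ →
      IsSolutionLH L V (fun t => legendreGraph L (φ.jet (2 * k - 1) t))) := by
  refine ⟨fun ψ hψ => ?_, fun φ hφ => ?_⟩
  · obtain ⟨φ, hφpt, hφ⟩ := hψ.holonomic
    have hφ' : ∀ t, (ψ t).jet = φ.jet (2 * k - 1) t := fun t => (hφ t).symm
    have hEL : ∀ (e : OpenPartialHomeomorph E (ℝ × Fib n)) (he : IsAdapted π e) (y₀ : Jet π k),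
        ∀ t ∈ V, φ.toFun t ∈ e.source → elCovector he y₀ L (φ.curve e) t = 0 :=
      fun e he y₀ t htV ht =>
        elCovector_eq_zero_of_isCriticalLH hL hV hψ.isSection.1 hφ' hψ.critical he y₀ htV ht
    refine ⟨⟨contMDiff_phase_jet.comp hψ.isSection.1, hψ.isSection.2⟩, hψ.holonomic, φ, hφpt,
      isCriticalL_of_elCovector hL hV ?_ hEL, fun e he t htV ht A => ?_⟩
    -- Convergence for ψ is convergence for φ: both integrands are L ∘ j^kφ, even if ψ leaves the
    -- Legendre graph outside V.
    · rw [← pullCurve_thetaR_eq_thetaL hL hψ.isSection.1 hφ']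
      exact hψ.critical.1
    · rw [elCovector_apply hL he _ ht, hEL e he _ t htV ht]
      rfl
  · refine ⟨⟨(contMDiff_legendreGraph hL).comp (φ.contMDiff_jet _), fun t => φ.base_jet _ t⟩,
      ⟨φ, fun t => (φ.pt_jet _ t).symm, fun t => rfl⟩, ?_⟩
    exact isCriticalLH_of_elCovector hL hV hφ.1 fun e he y₀ t htV ht =>
      elCovector_eq_zero_of_isCriticalL hL hV hφ he y₀ htV ht
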